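/- Let $G$ be a connected, locally finite graph (loops and parallel edges are allowed), and let $v_0$ be a vertex of $G$. For a finite set $B$ of vertices let $G_B$ be the graph obtained from $G$ by collapsing all vertices outside $B$ to a single vertex (keeping parallel edges). The wired uniform spanning forest (wired USF) of $G$ is the random set of edges whose law is the weak limit of the laws of the uniform spanning trees of $G_B$ as $B$ increases to the set of all vertices of $G$. Random subgraphs are identified with their sets of edges and contain all vertices of $G$. Let $m\ge 0$ and let $F,F_0,F_1,\dots,F_m$ be independent samples of the wired USF of $G$. Let $\mathcal C_0$ be the vertex set of the component of $v_0$ in $F$ and, for $1\le j\le m$, let $\mathcal C_j$ be the union of the vertex sets of all components of $F$ that are contained in $\mathcal C_{j-1}$ or adjacent in $G$ to $\mathcal C_{j-1}$. Let $Q_0$ be the vertex set of the component of $v_0$ in $F_0$ and, for $1\le j\le m$, let $Q_j$ be the union of the vertex sets of all components of $F_j$ that intersect $Q_{j-1}$. Then $\mathcal C_m$ stochastically dominates $Q_m$; that is, there is a coupling $\mu$ of $\mathcal C_m$ and $Q_m$ (a probability measure on pairs of vertex sets whose marginals are the laws of $\mathcal C_m$ and $Q_m$) such that $\mu[\mathcal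 C_m\supseteq Q_m]=1$. -/

import Mathlib

open MeasureTheory ProbabilityTheory Filter Topology
open scoped Graph

namespace WiredUSF

/- Graphs are Mathlib's `Graph α β`: undirected graphs with vertices `V(G) : Set α` and edges
`E(G) : Set β`, in which loops and parallel edges are allowed.  Parallel edges have to be kept
because collapsing vertices creates them.  A (random) subgraph with the full vertex set is
given by its (random) set of edges. -/

variable {α β : Type*}

/-- The graph is connected: any two vertices are joined by a path (and there is a vertex). -/
def Connected (G : Graph α β) : Prop := G.toSimpleGraph.Connected

/-- Every vertex is incident to finitely many edges. -/
def LocallyFinite (G : Graph α β) : Prop := ∀ v ∈ V(G), (G.incidenceSet v).Finite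

/-- The spanning subgraph `(V(G), ω ∩ E(G))`, as a simple graph on the vertices of `G`. It is used
only to speak of connected components; multiplicities and loops do not matter for them. -/
def spanningSubgraph (G : Graph α β) (ω : Set β) : SimpleGraph V(G) :=
  (G.restrict ω).toSimpleGraph

/-- `T` is the edge set of a spanning tree of `G`: the subgraph `(V(G), T)` has no loops and no
parallel edges, and it is a tree. -/
def IsSpanningTree (G : Graph α β) (T : Set β) : Prop :=
  T ⊆ E(G) ∧ (G.restrict T).Simple ∧ (spanningSubgraph G T).IsTree

/-- The probability that the uniform spanning tree of `G` belongs to `𝒜`: the proportion of the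
spanning trees of `G` that lie in `𝒜`. (Used only for graphs which have at least one and at most
finitely many spanning trees.) -/
noncomputable def ustProb (G : Graph α β) (𝒜 : Set (Set β)) : ℝ :=
  ({T | IsSpanningTree G T ∧ T ∈ 𝒜}.ncard : ℝ) / ({T | IsSpanningTree G T}.ncard : ℝ)

open Classical in
/-- The graph obtained from `G` by collapsing all vertices outside `B` to one vertex `none`
(which is absent if all vertices are in `B`).  The edges are those of `G`; an edge with both
ends outside `B` becomes a loop, and so lies in no spanning tree. -/
noncomputable def wire (G : Graph α β) (B : Finset α) : Graph (Option α) β :=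
  G.map (fun x => if x ∈ B then some x else none)

/-- `μ` is the law of the wired uniform spanning forest of `G`: the weak limit, as the finite
vertex set `B` increases to all vertices, of the uniform spanning trees of the wired graphs
`wire G B`.  Weak convergence of random edge sets is convergence of the probabilities of all
cylinder events `{ω | ω ∩ K = A}`, with `K` a finite set of edges. -/
def IsWiredUSF (G : Graph α β) (μ : Measure (Set β)) : Prop :=
  IsProbabilityMeasure μ ∧
    ∀ (K : Finset β) (A : Set β),
      Tendsto (fun B : Finset α => ustProb (wire G B) {T | T ∩ (K : Set β) = A}) atTop
        (𝓝 (μ.real {ω | ω ∩ (K : Set β) = A}))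

/-- The vertex set `𝒞(x, ω)` of the component of `x` in the spanning subgraph `ω`. -/
def component (G : Graph α β) (ω : Set β) (x : V(G)) : Set V(G) :=
  ((spanningSubgraph G ω).connectedComponentMk x).supp

/-- The sets `𝒞_j`: `𝒞_0` is the component of `v₀` in `ω`, and `𝒞_{j+1}` is the union of all
components of `ω` which are contained in `𝒞_j` or adjacent (in `G`) to `𝒞_j`. -/
def adjacentHull (G : Graph α β) (ω : Set β) (v₀ : V(G)) : ℕ → Set V(G)
  | 0 => component G ω v₀
  | j + 1 =>
      ⋃ c ∈ {c : (spanningSubgraph G ω).ConnectedComponent |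
        c.supp ⊆ adjacentHull G ω v₀ j ∨
          ∃ x ∈ c.supp, ∃ y ∈ adjacentHull G ω v₀ j, G.Adj (x : α) (y : α)}, c.supp

/-- The sets `Q_j`, formed from `ω_0, …, ω_j`: `Q_0` is the component of `v₀` in `ω_0`, and
`Q_{j+1}` is the union of all components of `ω_{j+1}` which intersect `Q_j`. -/
def successiveHull (G : Graph α β) (v₀ : V(G)) : (j : ℕ) → (Fin (j + 1) → Set β) → Set V(G)
  | 0, ω => component G (ω 0) v₀
  | j + 1, ω =>
      ⋃ c ∈ {c : (spanningSubgraph G (ω (Fin.last (j + 1)))).ConnectedComponent |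
        (c.supp ∩ successiveHull G v₀ j (fun i => ω i.castSucc)).Nonempty}, c.supp

/-- The random set `A` stochastically dominates the random set `Q`: there is a coupling `ν` of
`A` and `Q`, i.e. a probability measure whose marginals are their laws, with `ν[A ⊇ Q] = 1`.
(Sets of subsets carry the product σ-algebra.  Since `ν` is a probability measure, the
two equations between laws force `A` and `Q` to be a.e.-measurable.) -/
def StochDominates {Ω X : Type*} [MeasurableSpace Ω] (P : Measure Ω) (A Q : Ω → Set X) : Prop :=
  ∃ ν : Measure (Set X × Set X), IsProbabilityMeasure ν ∧
    ν.map Prod.fst = P.map A ∧ ν.map Prod.snd = P.map Q ∧ ∀ᵐ p ∂ν, p.2 ⊆ p.1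

end WiredUSF

/-! Each step of the exploration in `F` is compared with one fresh independent sample. Suppose that
exploring `𝒞_j` along a large finite edge set `R` has found the vertex set `D`. The edges queried
are the set `K` of edges of `R` touching `D`; let `A` be those found open. Given this, `F` outside
`K` dominates the fresh sample outside `K`.

To see this, wire the graph outside a large `B` for `F`, and outside a smaller `W` for the fresh
sample. Conditioning on the trace contracts `A` and deletes `K \ A`. Passing from `B` to `W` sends
every end of `A` outside `W` to the wired vertex, while every end of `A` inside `W` has all its
edges in `K`. Hence, whatever trace the smaller tree has on `K`, its contracted graph is, for the
edges outside `K`, a quotient of the contracted larger graph. The uniform spanning tree of a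
quotient is dominated by that of the graph (`condSum_quotient_mul_le`, `condSum_collapse_mul_le`).

The edges of `K` in the fresh sample are lost, but each has an end in `D`, so starting from the
neighbourhood of `D` makes up for them (`hull_subset_hull_nbhd`). This is why adjacent components
are added to `𝒞_j`. So `𝒞_{j+1}` dominates the union of the components of a fresh sample that meet
`𝒞_j` (`integral_hullEvent_le`). That union increases with the starting set, so induction compares
the increasing events depending on finitely many vertices (`measureReal_successiveHull_le`), and
Strassen's theorem (`exists_monotone_coupling`) produces the coupling.

Domination for quotients comes from negative association. By the matrix-tree theorem the spanning
trees have determinantal weights; log-submodularity of determinants gives pairwise negative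
correlation under all conditionings; the Feder–Mihail induction extends it to increasing functions
(`PairwiseNegative.condSum_mul_le`). -/

namespace WiredUSF

/-! ### Negative association from pairwise negative correlation -/

section NegativeAssociation

variable {E : Type*} [DecidableEq E]

/-- The `w`-weighted sum of `g` over the sets `I ∪ T` with `T ⊆ R`. -/
def condSum (w g : Finset E → ℝ) (I R : Finset E) : ℝ := ∑ T ∈ R.powerset, g T * w (I ∪ T)

/-- Pairwise negative correlation of a weight on finite sets, under all conditionings. -/
def PairwiseNegative (w : Finset E → ℝ) : Prop :=
  ∀ (I R : Finset E) (e f : E), Disjoint I R → e ∉ I → e ∉ R → f ∉ I → f ∉ R → e ≠ f →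
    condSum w 1 (insert e (insert f I)) R * condSum w 1 I R ≤
      condSum w 1 (insert e I) R * condSum w 1 (insert f I) R

lemma condSum_insert (w g : Finset E → ℝ) (I R : Finset E) {f : E} (hf : f ∉ R) :
    condSum w g I (insert f R) =
      condSum w g I R + condSum w (fun T => g (insert f T)) (insert f I) R := by
  unfold condSum
  rw [Finset.sum_powerset_insert hf]
  simp [Finset.union_insert, Finset.insert_union]

lemma condSum_nonneg {w g : Finset E → ℝ} (hw : ∀ T, 0 ≤ w T) (hg : ∀ T, 0 ≤ g T)
    (I R : Finset E) : 0 ≤ condSum w g I R :=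
  Finset.sum_nonneg fun T _ => mul_nonneg (hg T) (hw _)

lemma condSum_eq_zero_of {w : Finset E → ℝ} (hw : ∀ T, 0 ≤ w T) {I R : Finset E}
    (h : condSum w 1 I R = 0) (g : Finset E → ℝ) : condSum w g I R = 0 := by
  unfold condSum at h ⊢
  rw [Finset.sum_eq_zero_iff_of_nonneg (fun T _ => by simpa using hw _)] at h
  exact Finset.sum_eq_zero fun T hT => by
    have := h T hT
    simp only [Pi.one_apply, one_mul] at this
    simp [this]

/-- Every set charged by a homogeneous weight has the same number of elements. -/
lemma sum_condSum_insert {w : Finset E → ℝ} {n : ℕ} (hn : ∀ T, w T ≠ 0 → T.card = n)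
    (g : Finset E → ℝ) {I R : Finset E} (hIR : Disjoint I R) :
    ∑ f ∈ R, condSum w (fun T => g (insert f T)) (insert f I) (R.erase f) =
      ((n : ℝ) - I.card) * condSum w g I R := by
  have h1 : ∀ f ∈ R, condSum w (fun T => g (insert f T)) (insert f I) (R.erase f) =
      ∑ T ∈ R.powerset, if f ∈ T then g T * w (I ∪ T) else 0 := by
    intro f hf
    conv_rhs => rw [← Finset.insert_erase hf]
    rw [Finset.sum_powerset_insert (Finset.notMem_erase f R)]
    rw [Finset.sum_eq_zero, zero_add]
    · refine Finset.sum_congr rfl fun T hT => ?_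
      simp [Finset.union_insert, Finset.insert_union]
    · intro T hT
      rw [Finset.mem_powerset] at hT
      rw [if_neg]
      intro h
      exact Finset.notMem_erase f R (hT h)
  rw [Finset.sum_congr rfl h1, Finset.sum_comm, condSum, Finset.mul_sum]
  refine Finset.sum_congr rfl fun T hT => ?_
  rw [Finset.mem_powerset] at hT
  rw [← Finset.sum_filter, Finset.sum_const, nsmul_eq_mul]
  have : R.filter (fun f => f ∈ T) = T := by
    ext x; simp only [Finset.mem_filter]; exact ⟨fun h => h.2, fun h => ⟨hT h, h⟩⟩
  rw [this]
  -- A charged set `I ∪ T` has `n` elements, so `T` is counted `n - I.card` times; uncharged sets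
  -- contribute zero.
  by_cases h0 : w (I ∪ T) = 0
  · simp [h0]
  · have := hn _ h0
    rw [Finset.card_union_of_disjoint (hIR.mono_right hT)] at this
    rw [← this]; push_cast; ring

/-- **Feder–Mihail**: under pairwise negative correlation (for all conditionings), an increasing
function of the other elements is negatively correlated with the presence of `e`. -/
theorem PairwiseNegative.condSum_mul_le {w : Finset E → ℝ} (hneg : PairwiseNegative w)
    (hw : ∀ T, 0 ≤ w T) {n : ℕ} (hn : ∀ T, w T ≠ 0 → T.card = n) {e : E} :
    ∀ (R I : Finset E) (g : Finset E → ℝ), Disjoint I R → e ∉ I → e ∉ R →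
      (∀ T, 0 ≤ g T) → Monotone g →
      condSum w g (insert e I) R * condSum w 1 I R ≤
        condSum w g I R * condSum w 1 (insert e I) R := by
  intro R
  induction hk : R.card using Nat.strong_induction_on generalizing R with
  | _ k ih =>
  intro I g hIR heI heR hg hmono
  have hone : ∀ T : Finset E, (0 : ℝ) ≤ (1 : Finset E → ℝ) T := fun _ => zero_le_one
  rcases (condSum_nonneg hw hone I R).eq_or_lt with hz0 | hz0
  · rw [← hz0, mul_zero]
    exact mul_nonneg (condSum_nonneg hw hg _ _) (condSum_nonneg hw hone _ _)
  -- the contributions of the sets containing `f` and of those avoiding `f`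
  have split : ∀ f ∈ R, ∀ (h : Finset E → ℝ) (J : Finset E), condSum w h J R =
      condSum w h J (R.erase f) + condSum w (fun T => h (insert f T)) (insert f J) (R.erase f) := by
    intro f hf h J
    conv_lhs => rw [← Finset.insert_erase hf]
    exact condSum_insert w h J _ (Finset.notMem_erase f R)
  by_cases hdeg : ∃ f ∈ R, 0 < condSum w 1 I (R.erase f) ∧
      0 < condSum w 1 (insert f I) (R.erase f)
  · -- choose `f` positively correlated with `g`
    obtain ⟨f, hf, hf0, hf1, hcorr⟩ : ∃ f ∈ R, 0 < condSum w 1 I (R.erase f) ∧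
        0 < condSum w 1 (insert f I) (R.erase f) ∧
        condSum w g I (R.erase f) * condSum w 1 (insert f I) (R.erase f) ≤
        condSum w (fun T => g (insert f T)) (insert f I) (R.erase f) *
          condSum w 1 I (R.erase f) := by
      by_contra! hcon
      have hle : ∀ f ∈ R, condSum w (fun T => g (insert f T)) (insert f I) (R.erase f) *
          condSum w 1 I (R.erase f) ≤
          condSum w g I (R.erase f) * condSum w 1 (insert f I) (R.erase f) := by
        intro f hf
        rcases (condSum_nonneg hw hone I (R.erase f)).eq_or_lt with h | h
        · rw [← h, mul_zero, condSum_eq_zero_of hw h.symm, zero_mul]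
        rcases (condSum_nonneg hw hone (insert f I) (R.erase f)).eq_or_lt with h' | h'
        · rw [← h', mul_zero, condSum_eq_zero_of hw h'.symm, zero_mul]
        exact (hcon f hf h h').le
      obtain ⟨f₀, hf₀, ha, hb⟩ := hdeg
      have hlt := Finset.sum_lt_sum hle ⟨f₀, hf₀, hcon f₀ hf₀ ha hb⟩
      -- All charged sets have the same number of elements in `R`, so the unnormalised covariances
      -- of `g` with the indicators of the `f ∈ R` add up to zero. They cannot all be `≤ 0` with one
      -- strictly negative.
      have e1 := sum_condSum_insert hn g hIR
      have e2 := sum_condSum_insert hn (1 : Finset E → ℝ) hIR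
      have e3 : ∑ f ∈ R, (condSum w (fun T => g (insert f T)) (insert f I) (R.erase f) *
            condSum w 1 I (R.erase f) -
          condSum w g I (R.erase f) * condSum w 1 (insert f I) (R.erase f)) = 0 := by
        have : ∀ f ∈ R, (condSum w (fun T => g (insert f T)) (insert f I) (R.erase f) *
            condSum w 1 I (R.erase f) -
          condSum w g I (R.erase f) * condSum w 1 (insert f I) (R.erase f)) =
            condSum w (fun T => g (insert f T)) (insert f I) (R.erase f) * condSum w 1 I R -
            condSum w g I R * condSum w (fun T => (1 : Finset E → ℝ) (insert f T))
              (insert f I) (R.erase f) := by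
          intro f hf
          rw [split f hf g I, split f hf 1 I]
          have : (fun T => (1 : Finset E → ℝ) (insert f T)) = 1 := rfl
          rw [this]; ring
        rw [Finset.sum_congr rfl this, Finset.sum_sub_distrib, ← Finset.sum_mul, ← Finset.mul_sum,
          e1, e2]
        ring
      rw [Finset.sum_sub_distrib] at e3
      linarith
    have hlt : (R.erase f).card < k := by
      rw [← hk]; exact Finset.card_erase_lt_of_mem hf
    have hfI : f ∉ I := fun h => Finset.disjoint_left.1 hIR h hf
    have hef : e ≠ f := fun h => heR (h ▸ hf)
    have hfe := Finset.notMem_erase f R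
    have heR' : e ∉ R.erase f := fun h => heR (Finset.mem_of_mem_erase h)
    have hd : Disjoint I (R.erase f) := hIR.mono_right (Finset.erase_subset _ _)
    have hd' : Disjoint (insert f I) (R.erase f) := by
      rw [Finset.disjoint_insert_left]; exact ⟨hfe, hd⟩
    have ih0 := ih _ hlt (R.erase f) rfl I g hd heI heR' hg hmono
    have ih1 := ih _ hlt (R.erase f) rfl (insert f I) (fun T => g (insert f T)) hd'
      (by simp [hef, heI]) heR' (fun T => hg _)
      (fun T T' h => hmono (Finset.insert_subset_insert f h))
    have hnc := hneg I (R.erase f) e f hd heI heR' hfI hfe hef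
    rw [split f hf g (insert e I), split f hf 1 I, split f hf g I, split f hf 1 (insert e I)]
    have h1 : (fun T => (1 : Finset E → ℝ) (insert f T)) = 1 := rfl
    rw [h1, Finset.insert_comm f e I]
    have hz1f := condSum_nonneg hw hone (insert e (insert f I)) (R.erase f)
    have hz1f' := condSum_nonneg hw hone (insert e I) (R.erase f)
    generalize condSum w 1 I (R.erase f) = z0n at *
    generalize condSum w 1 (insert f I) (R.erase f) = z0y at *
    generalize condSum w 1 (insert e (insert f I)) (R.erase f) = z1y at *
    generalize condSum w 1 (insert e I) (R.erase f) = z1n at *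
    generalize condSum w g (insert e I) (R.erase f) = a1n at *
    generalize condSum w g I (R.erase f) = a0n at *
    generalize condSum w (fun T => g (insert f T)) (insert e (insert f I)) (R.erase f) = a1y at *
    generalize condSum w (fun T => g (insert f T)) (insert f I) (R.erase f) = a0y at *
    -- `p` and `q` are the means of `g` with `f` present and with `f` absent, when `e` is absent. By
    -- induction the presence of `e` raises neither mean, and by `hnc` it shifts mass towards the
    -- absence of `f`, where the mean is the smaller one.
    obtain ⟨p, rfl⟩ : ∃ p, a0y = p * z0y := ⟨a0y / z0y, by field_simp⟩
    obtain ⟨q, rfl⟩ : ∃ q, a0n = q * z0n := ⟨a0n / z0n, by field_simp⟩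
    have hpq : q ≤ p := by
      have : q * (z0n * z0y) ≤ p * (z0n * z0y) := by nlinarith
      exact le_of_mul_le_mul_right this (mul_pos hf0 hf1)
    have ha1y : a1y ≤ p * z1y := by
      have : a1y * z0y ≤ (p * z1y) * z0y := by nlinarith
      exact le_of_mul_le_mul_right this hf1
    have ha1n : a1n ≤ q * z1n := by
      have : a1n * z0n ≤ (q * z1n) * z0n := by nlinarith
      exact le_of_mul_le_mul_right this hf0
    have h2 : (a1n + a1y) * (z0n + z0y) ≤ (q * z1n + p * z1y) * (z0n + z0y) :=
      mul_le_mul_of_nonneg_right (by linarith) (by linarith)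
    nlinarith [mul_nonneg (sub_nonneg.2 hpq) (sub_nonneg.2 hnc)]
  · -- exactly one set avoiding `e` is charged
    push Not at hdeg
    have hone' : ∀ f ∈ R, condSum w 1 I (R.erase f) = 0 ∨
        condSum w 1 (insert f I) (R.erase f) = 0 := by
      intro f hf
      rcases (condSum_nonneg hw hone I (R.erase f)).eq_or_lt with h | h
      · exact Or.inl h.symm
      · exact Or.inr (le_antisymm (hdeg f hf h) (condSum_nonneg hw hone _ _))
    have mem_pos : ∀ T ⊆ R, ∀ f ∈ T, ∀ J : Finset E, 0 < w (J ∪ T) →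
        0 < condSum w 1 (insert f J) (R.erase f) := by
      intro T hT f hf J hpos
      refine Finset.sum_pos' (fun U _ => by simpa using hw _) ⟨T.erase f, ?_, ?_⟩
      · rw [Finset.mem_powerset]; exact Finset.erase_subset_erase f hT
      · simpa [Finset.insert_union, ← Finset.union_insert, Finset.insert_erase hf] using hpos
    have notMem_pos : ∀ T ⊆ R, ∀ f, f ∉ T → ∀ J : Finset E, 0 < w (J ∪ T) →
        0 < condSum w 1 J (R.erase f) := by
      intro T hT f hf J hpos
      refine Finset.sum_pos' (fun U _ => by simpa using hw _) ⟨T, ?_, by simpa using hpos⟩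
      rw [Finset.mem_powerset]; exact Finset.subset_erase.2 ⟨hT, hf⟩
    obtain ⟨T₀, hT₀R, hT₀⟩ : ∃ T₀ ⊆ R, 0 < w (I ∪ T₀) := by
      by_contra! hcon
      refine hz0.not_ge (Finset.sum_nonpos fun T hT => ?_)
      simpa using hcon T (Finset.mem_powerset.1 hT)
    have huniq : ∀ T ⊆ R, 0 < w (I ∪ T) → T = T₀ := by
      intro T hT hpos
      have key : ∀ A ⊆ R, ∀ B ⊆ R, 0 < w (I ∪ A) → 0 < w (I ∪ B) → A ⊆ B := by
        intro A hA B hB hwA hwB f hf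
        by_contra hfB
        rcases hone' f (hA hf) with h | h
        · exact (notMem_pos B hB f hfB I hwB).ne' h
        · exact (mem_pos A hA f hf I hwA).ne' h
      exact (key T hT T₀ hT₀R hpos hT₀).antisymm (key T₀ hT₀R T hT hT₀ hpos)
    -- An `f ∉ T₀` never occurs without `e`. If it occurred with `e`, the left side of `hnc` would
    -- be positive and the right side zero.
    have hsub : ∀ T ⊆ R, 0 < w (insert e I ∪ T) → T ⊆ T₀ := by
      intro T hT hpos f hf
      by_contra hfT₀
      have hfR := hT hf
      have hfI : f ∉ I := fun h => Finset.disjoint_left.1 hIR h hfR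
      have hef : e ≠ f := fun h => heR (h ▸ hfR)
      have hnc := hneg I (R.erase f) e f (hIR.mono_right (Finset.erase_subset _ _)) heI
        (fun h => heR (Finset.mem_of_mem_erase h)) hfI (Finset.notMem_erase f R) hef
      have hp0 := notMem_pos T₀ hT₀R f hfT₀ I hT₀
      have hp1 := mem_pos T hT f hf (insert e I) hpos
      rw [Finset.insert_comm] at hp1
      have := (hone' f hfR).resolve_left hp0.ne'
      rw [this, mul_zero] at hnc
      exact absurd hnc (mul_pos hp1 hp0).not_ge
    have ha0 : condSum w g I R = g T₀ * condSum w 1 I R := by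
      unfold condSum
      rw [Finset.mul_sum]
      refine Finset.sum_congr rfl fun T hT => ?_
      rcases (hw (I ∪ T)).eq_or_lt with h | h
      · simp [← h]
      · rw [huniq T (Finset.mem_powerset.1 hT) h]; simp
    have ha1 : condSum w g (insert e I) R ≤ g T₀ * condSum w 1 (insert e I) R := by
      unfold condSum
      rw [Finset.mul_sum]
      refine Finset.sum_le_sum fun T hT => ?_
      rcases (hw (insert e I ∪ T)).eq_or_lt with h | h
      · simp only [← h, mul_zero, le_refl]
      · have := hmono (hsub T (Finset.mem_powerset.1 hT) h)
        simpa using mul_le_mul_of_nonneg_right this h.le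
    rw [ha0]
    nlinarith [mul_le_mul_of_nonneg_right ha1 hz0.le]

end NegativeAssociation

/-! ### Cauchy–Binet and negative correlation of determinantal weights -/

section DeterminantalWeights

set_option linter.unusedSectionVars false

open Matrix

variable {E ι : Type*} [DecidableEq E] [Fintype ι] [DecidableEq ι]

/-- The Gram matrix `∑ x_e b_e b_eᵀ` of the vectors `b_e`, `e ∈ S`, with weights `x`. -/
def gram (b : E → ι → ℝ) (x : E → ℝ) (S : Finset E) : Matrix ι ι ℝ :=
  ∑ e ∈ S, x e • vecMulVec (b e) (b e)

/-- The squared volume spanned by the vectors `b_e`, `e ∈ T`, if there are as many of them as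
the dimension, and `0` otherwise. -/
def detWeight (b : E → ι → ℝ) (T : Finset E) : ℝ :=
  if T.card = Fintype.card ι then (gram b 1 T).det else 0

lemma gram_posSemidef (b : E → ι → ℝ) {x : E → ℝ} (hx : ∀ e, 0 ≤ x e) (S : Finset E) :
    (gram b x S).PosSemidef := by
  refine Matrix.posSemidef_sum S fun e _ => ?_
  have h := Matrix.posSemidef_vecMulVec_self_star (b e)
  rw [star_trivial] at h
  exact h.smul (hx e)

/-- Multilinearity in the rows expands the determinant as a sum over maps `φ : ι → E`, which are
grouped by their image. A map that is not injective gives two equal rows, so only images of full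
size count. The coefficients need no formula here: `det_gram` reads them off at `x = 1`, `S = T`. -/
lemma det_gram_aux (b : E → ι → ℝ) : ∃ C : Finset E → ℝ,
    (∀ T, T.card ≠ Fintype.card ι → C T = 0) ∧
    ∀ (x : E → ℝ) (S : Finset E), (gram b x S).det = ∑ T ∈ S.powerset, (∏ e ∈ T, x e) * C T := by
  let k : (ι → E) → ℝ := fun φ => (∏ i, b (φ i) i) * det (Matrix.of fun i => b (φ i))
  have hk : ∀ φ : ι → E, ¬ Function.Injective φ → k φ = 0 := by
    intro φ hφ
    rw [Function.Injective] at hφ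
    push Not at hφ
    obtain ⟨i, j, hij, hne⟩ := hφ
    have : det (Matrix.of fun i => b (φ i)) = 0 := by
      refine Matrix.det_zero_of_row_eq hne ?_
      ext l; simp [hij]
    simp [k, this]
  refine ⟨fun T => ∑ φ ∈ Fintype.piFinset (fun _ : ι => T),
    if Finset.univ.image φ = T then k φ else 0, ?_, ?_⟩
  · intro T hT
    refine Finset.sum_eq_zero fun φ _ => ?_
    split_ifs with h
    · refine hk φ fun hinj => hT ?_
      rw [← h, Finset.card_image_of_injective _ hinj, Finset.card_univ]
    · rfl
  · intro x S
    have h1 : (gram b x S).det = ∑ φ ∈ Fintype.piFinset (fun _ : ι => S), (∏ i, x (φ i)) * k φ := by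
      have : gram b x S = Matrix.of (fun i => ∑ e ∈ S, (x e * b e i) • b e) := by
        ext i j
        simp [gram, Matrix.sum_apply, vecMulVec_apply, Finset.sum_apply, mul_assoc]
      rw [this]
      have h2 := (Matrix.detRowAlternating (R := ℝ) (n := ι)).toMultilinearMap.map_sum_finset
        (fun i e => (x e * b e i) • b e) (fun _ => S)
      refine Eq.trans h2 (Finset.sum_congr rfl fun φ _ => ?_)
      have h3 := (Matrix.detRowAlternating (R := ℝ) (n := ι)).toMultilinearMap.map_smul_univ
        (fun i => x (φ i) * b (φ i) i) (fun i => b (φ i))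
      refine Eq.trans h3 ?_
      rw [Finset.prod_mul_distrib, smul_eq_mul, mul_assoc]
      rfl
    rw [h1, ← Finset.sum_fiberwise_of_maps_to (s := Fintype.piFinset (fun _ : ι => S))
      (t := S.powerset) (g := fun φ => Finset.univ.image φ)]
    · refine Finset.sum_congr rfl fun T hT => ?_
      rw [Finset.mem_powerset] at hT
      rw [Finset.mul_sum, Finset.sum_filter]
      symm
      refine Finset.sum_subset_zero_on_sdiff (Fintype.piFinset_subset _ _ fun _ => hT) ?_ ?_
      · intro φ hφ
        rw [Finset.mem_sdiff, Fintype.mem_piFinset, Fintype.mem_piFinset] at hφ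
        rw [if_neg]
        intro h
        exact hφ.2 fun i => h ▸ Finset.mem_image_of_mem φ (Finset.mem_univ i)
      · intro φ hφ
        split_ifs with h
        · by_cases hinj : Function.Injective φ
          · rw [← h, Finset.prod_image fun a _ b _ hab => hinj hab]
          · rw [hk φ hinj, mul_zero, mul_zero]
        · rw [mul_zero]
    · intro φ hφ
      rw [Fintype.mem_piFinset] at hφ
      rw [Finset.mem_powerset]
      exact Finset.image_subset_iff.2 fun i _ => hφ i

/-- **Cauchy–Binet** for Gram matrices. -/
theorem det_gram (b : E → ι → ℝ) (x : E → ℝ) (S : Finset E) :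
    (gram b x S).det = ∑ T ∈ S.powerset, (∏ e ∈ T, x e) * detWeight b T := by
  obtain ⟨C, hC, h⟩ := det_gram_aux b
  have hCw : ∀ T, detWeight b T = C T := by
    intro T
    unfold detWeight
    split_ifs with hT
    · rw [h, Finset.sum_eq_single T]
      · simp
      · intro U hU hne
        rw [hC, mul_zero]
        intro hU'
        exact hne (Finset.eq_of_subset_of_card_le (Finset.mem_powerset.1 hU) (by omega))
      · intro hT'
        exact absurd (Finset.mem_powerset_self T) hT'
    · exact (hC T hT).symm
  rw [h]
  exact Finset.sum_congr rfl fun T _ => by rw [hCw]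

/-- The determinant of a positive semidefinite matrix is log-submodular under the addition of
rank-one matrices. -/
lemma det_add_add_mul_det_le {L : Matrix ι ι ℝ} (hL : L.PosSemidef) (u v : ι → ℝ) :
    (L + vecMulVec u u + vecMulVec v v).det * L.det ≤
      (L + vecMulVec u u).det * (L + vecMulVec v v).det := by
  have hvv : ∀ w : ι → ℝ, (vecMulVec w w).PosSemidef := fun w => by
    have h := Matrix.posSemidef_vecMulVec_self_star w
    rwa [star_trivial] at h
  by_cases h0 : L.det = 0
  · rw [h0, mul_zero]
    exact mul_nonneg (hL.add (hvv u)).det_nonneg (hL.add (hvv v)).det_nonneg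
  have hu : IsUnit L.det := isUnit_iff_ne_zero.2 h0
  have hone : ∀ w : ι → ℝ, (L + vecMulVec w w).det = L.det * (1 + w ⬝ᵥ L⁻¹ *ᵥ w) := by
    intro w
    rw [vecMulVec_eq Unit, Matrix.det_add_replicateCol_mul_replicateRow hu]
    congr 2
    simp [Matrix.mul_apply, dotProduct, mulVec, Finset.sum_mul, Finset.mul_sum, replicateCol,
      replicateRow]
    rw [Finset.sum_comm]
    exact Finset.sum_congr rfl fun i _ => Finset.sum_congr rfl fun j _ => by ring
  have htwo : (L + vecMulVec u u + vecMulVec v v).det = L.det *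
      ((1 + u ⬝ᵥ L⁻¹ *ᵥ u) * (1 + v ⬝ᵥ L⁻¹ *ᵥ v) - (u ⬝ᵥ L⁻¹ *ᵥ v) * (v ⬝ᵥ L⁻¹ *ᵥ u)) := by
    let U : Matrix ι (Fin 2) ℝ := Matrix.of fun i j => ![u i, v i] j
    have h1 : L + vecMulVec u u + vecMulVec v v = L * (1 + L⁻¹ * U * Uᵀ) := by
      rw [mul_add, mul_one, Matrix.mul_assoc L⁻¹, Matrix.mul_nonsing_inv_cancel_left _ _ hu, add_assoc]
      congr 1
      ext i j
      simp [U, Matrix.mul_apply, vecMulVec_apply]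
    rw [h1, det_mul, Matrix.det_one_add_mul_comm, Matrix.det_fin_two]
    have h2 : ∀ i j : Fin 2, (Uᵀ * (L⁻¹ * U)) i j = (fun k => U k i) ⬝ᵥ L⁻¹ *ᵥ (fun k => U k j) := by
      intro i j
      simp [Matrix.mul_apply, dotProduct, mulVec]
    simp only [Matrix.add_apply, h2]
    simp [U]
  have hsymm : v ⬝ᵥ L⁻¹ *ᵥ u = u ⬝ᵥ L⁻¹ *ᵥ v := by
    have hT : L⁻¹ᵀ = L⁻¹ := by
      rw [Matrix.transpose_nonsing_inv]
      congr 1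
      simpa using hL.isHermitian.eq
    rw [dotProduct_mulVec, ← mulVec_transpose, hT, dotProduct_comm]
  -- The two sides differ by the square of `L.det * (u ⬝ᵥ L⁻¹ *ᵥ v)`.
  rw [htwo, hone, hone, hsymm]
  nlinarith [mul_nonneg (mul_self_nonneg L.det) (mul_self_nonneg (u ⬝ᵥ L⁻¹ *ᵥ v))]

/-- By Cauchy–Binet the determinants over `S`, `S ∪ {e}`, `S ∪ {f}` and `S ∪ {e, f}` are `a`, `a +
a_e`, `a + a_f` and `a + a_e + a_f + a_ef`. Log-submodularity of the determinant then becomes `a_ef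
* a ≤ a_e * a_f`. General weights `x` are allowed so that large weights can force elements into the
set. -/
lemma condSum_detWeight_mul_le (b : E → ι → ℝ) {x : E → ℝ} (hx : ∀ e, 0 ≤ x e) (S : Finset E)
    {e f : E} (he : e ∉ S) (hf : f ∉ S) (hef : e ≠ f) (hxe : x e = 1) (hxf : x f = 1) :
    condSum (detWeight b) (fun T => ∏ i ∈ T, x i) {e, f} S *
        condSum (detWeight b) (fun T => ∏ i ∈ T, x i) ∅ S ≤
      condSum (detWeight b) (fun T => ∏ i ∈ T, x i) {e} S *
        condSum (detWeight b) (fun T => ∏ i ∈ T, x i) {f} S := by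
  set g : Finset E → ℝ := fun T => ∏ i ∈ T, x i with hg
  have hdet : ∀ R : Finset E, (gram b x R).det = condSum (detWeight b) g ∅ R := by
    intro R; rw [det_gram]; simp [condSum, hg]
  have hins : ∀ a : E, x a = 1 → (fun T => g (insert a T)) = g := by
    intro a ha
    funext T
    by_cases h : a ∈ T
    · rw [Finset.insert_eq_of_mem h]
    · simp [hg, Finset.prod_insert h, ha]
  have hgram : ∀ (a : E) (R : Finset E), a ∉ R → x a = 1 →
      gram b x (insert a R) = gram b x R + vecMulVec (b a) (b a) := by
    intro a R ha hxa
    rw [gram, Finset.sum_insert ha, hxa, one_smul, add_comm]; rfl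
  have key := det_add_add_mul_det_le (gram_posSemidef b hx S) (b f) (b e)
  have hefS : e ∉ insert f S := by simp [hef, he]
  rw [← hgram f S hf hxf, ← hgram e _ hefS hxe, ← hgram e S he hxe, hdet, hdet, hdet, hdet,
    condSum_insert _ _ _ _ hefS, condSum_insert _ _ _ _ he, condSum_insert _ _ _ _ hf,
    condSum_insert _ _ _ _ hf, hins e hxe, hins f hxf, Finset.insert_comm] at key
  have hins' : (fun T => g (insert e (insert f T))) = g :=
    funext fun T => (congrFun (hins e hxe) (insert f T)).trans (congrFun (hins f hxf) T)
  simp only [insert_empty_eq, hins'] at key ⊢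
  nlinarith [key]

theorem pairwiseNegative_detWeight (b : E → ι → ℝ) : PairwiseNegative (detWeight b) := by
  intro I R e f hIR heI heR hfI hfR hef
  -- give the elements of `I` the weight `1 / s` and let `s` tend to `0`
  let r : Finset E → ℝ → ℝ := fun J s =>
    ∑ U ∈ (I ∪ R).powerset, s ^ (I \ U).card * detWeight b (J ∪ U)
  have hcont : ∀ J, Continuous (r J) := fun J => by unfold r; fun_prop
  -- At `s = 0` exactly the `U` containing `I` survive, since `0 ^ k` is `1` for `k = 0` and `0`
  -- otherwise.
  have hzero : ∀ J, r J 0 = condSum (detWeight b) 1 (J ∪ I) R := by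
    intro J
    unfold r condSum
    rw [← Finset.sum_subset (s₁ := R.powerset.image (fun T => I ∪ T))]
    · rw [Finset.sum_image]
      · refine Finset.sum_congr rfl fun T _ => ?_
        have : I \ (I ∪ T) = ∅ := Finset.sdiff_eq_empty_iff_subset.2 Finset.subset_union_left
        simp [this, Finset.union_assoc]
      · intro T hT T' hT' h
        have hT := Finset.mem_powerset.1 hT
        have hT' := Finset.mem_powerset.1 hT'
        have h := congrArg (fun A => A \ I) h
        simpa [Finset.union_sdiff_left, Finset.sdiff_eq_self_of_disjoint (hIR.mono_right hT).symm,
          Finset.sdiff_eq_self_of_disjoint (hIR.mono_right hT').symm] using h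
    · intro U hU
      obtain ⟨T, hT, rfl⟩ := Finset.mem_image.1 hU
      exact Finset.mem_powerset.2 (Finset.union_subset_union_right (Finset.mem_powerset.1 hT))
    · intro U hU hU'
      have hne : (I \ U).card ≠ 0 := by
        intro h0
        rw [Finset.card_eq_zero, Finset.sdiff_eq_empty_iff_subset] at h0
        refine hU' (Finset.mem_image.2 ⟨U \ I, ?_, ?_⟩)
        · rw [Finset.mem_powerset] at hU ⊢
          rw [sdiff_le_iff]; exact hU
        · rw [Finset.union_sdiff_of_subset h0]
      rw [zero_pow hne, zero_mul]
  have hpos : ∀ s : ℝ, 0 < s → r {e, f} s * r ∅ s ≤ r {e} s * r {f} s := by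
    intro s hs
    let x : E → ℝ := fun a => if a ∈ I then s⁻¹ else 1
    -- The factor `s ^ I.card` clears the denominators: the weight `s⁻¹ ^ (I ∩ U).card` of `U`
    -- becomes `s ^ (I \ U).card`.
    have hr : ∀ J, r J s = s ^ I.card * condSum (detWeight b) (fun T => ∏ i ∈ T, x i) J (I ∪ R) := by
      intro J
      unfold r condSum
      rw [Finset.mul_sum]
      refine Finset.sum_congr rfl fun U _ => ?_
      have : ∏ i ∈ U, x i = s⁻¹ ^ (I ∩ U).card := by
        simp only [x]
        rw [Finset.prod_ite, Finset.prod_const, Finset.prod_const_one, mul_one]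
        congr 2
        ext a; simp [and_comm]
      simp only [this]
      rw [← Finset.card_sdiff_add_card_inter I U, pow_add, inv_pow]
      field_simp
    have := condSum_detWeight_mul_le b (x := x) (fun a => by
      simp only [x]; split_ifs <;> positivity) (I ∪ R) (e := e) (f := f)
      (by simp [heI, heR]) (by simp [hfI, hfR]) hef (by simp [x, heI]) (by simp [x, hfI])
    rw [hr, hr, hr, hr]
    nlinarith [mul_le_mul_of_nonneg_left this (mul_self_nonneg (s ^ I.card))]
  have hlim : r {e, f} 0 * r ∅ 0 ≤ r {e} 0 * r {f} 0 := by
    have h1 : Tendsto (fun s => r {e, f} s * r ∅ s) (𝓝[>] 0) (𝓝 (r {e, f} 0 * r ∅ 0)) :=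
      (((hcont _).mul (hcont _)).tendsto 0).mono_left nhdsWithin_le_nhds
    have h2 : Tendsto (fun s => r {e} s * r {f} s) (𝓝[>] 0) (𝓝 (r {e} 0 * r {f} 0)) :=
      (((hcont _).mul (hcont _)).tendsto 0).mono_left nhdsWithin_le_nhds
    refine le_of_tendsto_of_tendsto h1 h2 ?_
    filter_upwards [self_mem_nhdsWithin] with s hs using hpos s hs
  rw [hzero, hzero, hzero, hzero] at hlim
  simpa [Finset.insert_union] using hlim

end DeterminantalWeights

/-! ### Spanning trees of finite multigraphs, contraction and the matrix-tree theorem -/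

section FiniteTrees

variable {E V : Type*}

/-- The edges in `T` join all the vertices: no proper cut of the vertex set avoids `T`. -/
def Joins (ends : E → V × V) (T : Finset E) : Prop :=
  ∀ φ : V → Prop, (∀ e ∈ T, φ (ends e).1 ↔ φ (ends e).2) → ∀ x y, φ x → φ y

/-- `T` is the edge set of a spanning tree of the multigraph given by `ends`. -/
def IsTreeOn (ends : E → V × V) (T : Finset E) : Prop :=
  Joins ends T ∧ T.card + 1 = Nat.card V

open Classical in
/-- The indicator function of the spanning trees. -/
noncomputable def treeWeight (ends : E → V × V) (T : Finset E) : ℝ :=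
  if IsTreeOn ends T then 1 else 0

lemma treeWeight_nonneg (ends : E → V × V) (T : Finset E) : 0 ≤ treeWeight ends T := by
  unfold treeWeight; split_ifs <;> norm_num

lemma Joins.eq {ends : E → V × V} {T : Finset E} (h : Joins ends T) {γ : Type*} (φ : V → γ)
    (hφ : ∀ e ∈ T, φ (ends e).1 = φ (ends e).2) (x y : V) : φ x = φ y := by
  have := h (fun v => φ x = φ v) (fun e he => by rw [hφ e he]) x y rfl
  exact this

lemma Joins.mono {ends : E → V × V} {T U : Finset E} (h : Joins ends T) (hTU : T ⊆ U) :
    Joins ends U := fun φ hφ => h φ fun e he => hφ e (hTU he)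

/-- The coboundary map, from functions on the vertices to functions on `T`. -/
def coboundary (ends : E → V × V) (T : Finset E) : (V → ℝ) →ₗ[ℝ] (T → ℝ) where
  toFun h e := h (ends e).1 - h (ends e).2
  map_add' h h' := by ext e; simp; ring
  map_smul' c h := by ext e; simp; ring

/-- Only constant functions have zero coboundary when `T` joins the vertices, so the bound is
rank–nullity for `coboundary`. -/
lemma Joins.card_le [Finite V] {ends : E → V × V} {T : Finset E} (h : Joins ends T) :
    Nat.card V ≤ T.card + 1 := by
  classical
  cases nonempty_fintype V
  rcases isEmpty_or_nonempty V with hV | ⟨⟨v⟩⟩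
  · simp
  have hker : Module.finrank ℝ (LinearMap.ker (coboundary ends T)) ≤ 1 := by
    refine finrank_le_one ⟨1, by ext e; simp [coboundary]⟩ fun u => ⟨u.1 v, ?_⟩
    ext x
    have hu : ∀ e ∈ T, u.1 (ends e).1 = u.1 (ends e).2 := fun e he =>
      sub_eq_zero.1 (congrFun (LinearMap.mem_ker.1 u.2) ⟨e, he⟩)
    simpa using h.eq u.1 hu v x
  have hrange : Module.finrank ℝ (LinearMap.range (coboundary ends T)) ≤ T.card := by
    refine (Submodule.finrank_le _).trans ?_
    simp
  have := LinearMap.finrank_range_add_finrank_ker (coboundary ends T)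
  rw [Module.finrank_fintype_fun_eq_card] at this
  rw [Nat.card_eq_fintype_card]
  omega

/-- Take a minimal joining subset `T` of `S`. By minimality every `e ∈ T` has a cut crossed by `e`
alone, so the coboundary map is onto; its kernel contains the constants, and rank–nullity bounds
`T.card` from above. -/
lemma Joins.exists_isTreeOn [Finite V] [Nonempty V] {ends : E → V × V} {S : Finset E}
    (h : Joins ends S) : ∃ T ⊆ S, IsTreeOn ends T := by
  classical
  cases nonempty_fintype V
  obtain ⟨T, hTS, hT⟩ : ∃ T ⊆ S, Minimal (Joins ends) T := exists_minimal_le_of_wellFoundedLT _ S h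
  refine ⟨T, hTS, hT.prop, le_antisymm ?_ hT.prop.card_le⟩
  have hsurj : LinearMap.range (coboundary ends T) = ⊤ := by
    rw [eq_top_iff, ← (Pi.basisFun ℝ T).span_eq, Submodule.span_le]
    rintro _ ⟨e, rfl⟩
    have hnot : ¬ Joins ends (T.erase e) := fun hj =>
      Finset.notMem_erase e.1 T (hT.le_of_le hj (Finset.erase_subset _ _) e.2)
    unfold Joins at hnot
    push Not at hnot
    obtain ⟨φ, hφ, x, y, hx, hy⟩ := hnot
    have hne : ¬ (φ (ends e).1 ↔ φ (ends e).2) := by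
      intro he
      refine hy (hT.prop φ (fun a ha => ?_) x y hx)
      by_cases hae : a = e
      · rw [hae]; exact he
      · exact hφ a (Finset.mem_erase.2 ⟨hae, ha⟩)
    let h : V → ℝ := fun v => if φ v then 1 else 0
    have hz : ∀ a ∈ T, a ≠ e → h (ends a).1 - h (ends a).2 = 0 := by
      intro a ha hae
      have := hφ a (Finset.mem_erase.2 ⟨hae, ha⟩)
      simp [h, this]
    have hnz : h (ends e).1 - h (ends e).2 ≠ 0 := by
      by_cases h1 : φ (ends e).1 <;> by_cases h2 : φ (ends e).2 <;> simp_all [h]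
    refine ⟨(h (ends e).1 - h (ends e).2)⁻¹ • h, ?_⟩
    rw [map_smul]
    ext a
    by_cases hae : a = e
    · subst hae
      simp [coboundary, hnz]
    · have := hz a a.2 (fun h' => hae (Subtype.ext h'))
      simp [coboundary, this, hae]
  have hker : 0 < Module.finrank ℝ (LinearMap.ker (coboundary ends T)) := by
    rw [Module.finrank_pos_iff]
    refine ⟨⟨1, by ext e; simp [coboundary]⟩, 0, fun h0 => ?_⟩
    have := congrFun (congrArg Subtype.val h0) (Classical.arbitrary V)
    simp at this
  have := LinearMap.finrank_range_add_finrank_ker (coboundary ends T)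
  rw [hsurj, finrank_top, Module.finrank_fintype_fun_eq_card, Module.finrank_fintype_fun_eq_card,
    Fintype.card_coe] at this
  rw [Nat.card_eq_fintype_card]
  omega

/-- The equivalence relation of being joined by edges in `A`. -/
def joinSetoid (ends : E → V × V) (A : Finset E) : Setoid V where
  r x y := ∀ φ : V → Prop, (∀ e ∈ A, φ (ends e).1 ↔ φ (ends e).2) → (φ x ↔ φ y)
  iseqv := ⟨fun _ _ _ => Iff.rfl, fun h φ hφ => (h φ hφ).symm,
    fun h h' φ hφ => (h φ hφ).trans (h' φ hφ)⟩

/-- The vertices of the graph in which the edges in `A` are contracted. -/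
abbrev Contract (ends : E → V × V) (A : Finset E) : Type _ := Quotient (joinSetoid ends A)

/-- The ends of the edges after contraction of the edges in `A`. -/
def contractEnds (ends : E → V × V) (A : Finset E) (e : E) : Contract ends A × Contract ends A :=
  (Quotient.mk _ (ends e).1, Quotient.mk _ (ends e).2)

lemma contract_mk_eq {ends : E → V × V} {A : Finset E} {e : E} (he : e ∈ A) :
    (Quotient.mk (joinSetoid ends A) (ends e).1) = Quotient.mk _ (ends e).2 :=
  Quotient.sound fun _ hφ => hφ e he

lemma joins_contractEnds [DecidableEq E] {ends : E → V × V} {A T : Finset E} :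
    Joins (contractEnds ends A) T ↔ Joins ends (A ∪ T) := by
  constructor
  · intro h φ hφ x y hx
    let ψ : Contract ends A → Prop := Quotient.lift φ fun a b hab => by
      exact propext (hab φ fun e he => hφ e (Finset.mem_union_left _ he))
    exact h ψ (fun e he => hφ e (Finset.mem_union_right _ he)) (Quotient.mk _ x) (Quotient.mk _ y) hx
  · intro h φ hφ x y hx
    induction x using Quotient.inductionOn with | _ x =>
    induction y using Quotient.inductionOn with | _ y =>
    refine h (fun v => φ (Quotient.mk _ v)) (fun e he => ?_) x y hx
    rcases Finset.mem_union.1 he with he | he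
    · rw [contract_mk_eq he]
    · exact hφ e he

/-- Contracting part of a tree loses exactly one vertex per edge. Upper bound: `U \ A` still joins
the contracted graph. Lower bound: functions constant along the edges of `A` descend to the
contraction, and they form a space of codimension at most `A.card`. -/
lemma card_contract [Finite V] [DecidableEq E] {ends : E → V × V} {A U : Finset E} (hAU : A ⊆ U)
    (hU : IsTreeOn ends U) : Nat.card (Contract ends A) + A.card = Nat.card V := by
  classical
  apply le_antisymm
  · have h : Joins (contractEnds ends A) (U \ A) := by
      rw [joins_contractEnds, Finset.union_sdiff_of_subset hAU]; exact hU.1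
    have := h.card_le
    have h2 := Finset.card_sdiff_add_card_eq_card hAU
    have h3 := hU.2
    omega
  · cases nonempty_fintype V
    cases nonempty_fintype (Contract ends A)
    let P : (Contract ends A → ℝ) →ₗ[ℝ] (V → ℝ) := LinearMap.funLeft ℝ ℝ (Quotient.mk _)
    have hker : LinearMap.ker (coboundary ends A) ≤ LinearMap.range P := by
      intro h hh
      have hh' : ∀ e ∈ A, h (ends e).1 = h (ends e).2 := fun e he =>
        sub_eq_zero.1 (congrFun (LinearMap.mem_ker.1 hh) ⟨e, he⟩)
      refine ⟨Quotient.lift h fun a b hab => ?_, rfl⟩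
      exact (hab (fun v => h a = h v) (fun e he => by rw [hh' e he])).1 rfl
    have h1 := Submodule.finrank_mono hker
    have h2 := LinearMap.finrank_range_le P
    have h3 : Module.finrank ℝ (LinearMap.range (coboundary ends A)) ≤ A.card := by
      refine (Submodule.finrank_le _).trans ?_
      simp
    have h4 := LinearMap.finrank_range_add_finrank_ker (coboundary ends A)
    rw [Module.finrank_fintype_fun_eq_card] at h4 h2
    rw [Nat.card_eq_fintype_card, Nat.card_eq_fintype_card]
    omega

lemma isTreeOn_contractEnds [Finite V] [DecidableEq E] {ends : E → V × V} {A U T : Finset E}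
    (hAU : A ⊆ U) (hU : IsTreeOn ends U) (hAT : Disjoint A T) :
    IsTreeOn (contractEnds ends A) T ↔ IsTreeOn ends (A ∪ T) := by
  unfold IsTreeOn
  rw [joins_contractEnds, Finset.card_union_of_disjoint hAT, ← card_contract hAU hU]
  exact and_congr_right fun _ => by omega

/-- The incidence vectors of the edges, with the coordinate of the root `r` removed. -/
def incidence [DecidableEq V] (ends : E → V × V) (r : V) (e : E) (v : {v : V // v ≠ r}) : ℝ :=
  (if (ends e).1 = v then 1 else 0) - (if (ends e).2 = v then 1 else 0)

/-- Modulo the integer span of the columns, the two ends of every edge of `T` have equal basis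
vectors. Hence all of them agree with that of the root, which is `0`, and the columns span the
integer lattice. The square integer matrix `M` is therefore invertible, its determinant is `±1`, and
the Gram matrix is `M * Mᵀ`. -/
lemma det_gram_incidence_of_joins [Fintype V] [DecidableEq V] [DecidableEq E] {ends : E → V × V}
    (r : V) {T : Finset E} (hT : Joins ends T) (hc : T.card = Fintype.card {v : V // v ≠ r}) :
    (gram (incidence ends r) 1 T).det = 1 := by
  let σ : {v : V // v ≠ r} ≃ T := Fintype.equivOfCardEq (by simp [hc])
  let M : Matrix {v : V // v ≠ r} {v : V // v ≠ r} ℤ := Matrix.of fun v j =>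
    (if (ends (σ j)).1 = v then 1 else 0) - (if (ends (σ j)).2 = v then 1 else 0)
  have hspan : ∀ v : {v : V // v ≠ r}, ∃ c : {v : V // v ≠ r} → ℤ,
      ∑ j, c j • M.col j = Pi.single v 1 := by
    intro v
    rw [← Submodule.mem_span_range_iff_exists_fun]
    let Λ := Submodule.span ℤ (Set.range M.col)
    let δ : V → ({v : V // v ≠ r} → ℤ) := fun x w => if x = w then 1 else 0
    have h := hT.eq (fun x => Submodule.Quotient.mk (p := Λ) (δ x)) (fun e he => by
      rw [Submodule.Quotient.eq]
      refine Submodule.subset_span ⟨σ.symm ⟨e, he⟩, ?_⟩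
      ext w
      simp [M, δ, Matrix.col]) v r
    rw [Submodule.Quotient.eq] at h
    convert h using 1
    ext w
    have : r ≠ w := w.2.symm
    simp [δ, this, Pi.single_apply, Subtype.ext_iff, eq_comm]
  choose c hc' using hspan
  have hMC : M * Matrix.of (fun j v => c v j) = 1 := by
    ext i v
    have := congrFun (hc' v) i
    simp only [Finset.sum_apply, Pi.smul_apply, smul_eq_mul, Matrix.col_apply] at this
    rw [Matrix.mul_apply, Matrix.one_apply, ← Pi.single_apply, ← this]
    exact Finset.sum_congr rfl fun j _ => by rw [Matrix.of_apply, mul_comm]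
  have hunit : IsUnit M.det := by
    have := congrArg Matrix.det hMC
    rw [Matrix.det_mul, Matrix.det_one] at this
    exact IsUnit.of_mul_eq_one _ this
  have hsq : M.det * M.det = 1 := Int.isUnit_mul_self hunit
  have hgram : gram (incidence ends r) 1 T =
      M.map (Int.castRingHom ℝ) * (M.map (Int.castRingHom ℝ)).transpose := by
    ext i j
    rw [Matrix.mul_apply, gram, Matrix.sum_apply, ← Finset.sum_coe_sort T, ← σ.sum_comp]
    refine Finset.sum_congr rfl fun k _ => ?_
    simp [Matrix.vecMulVec_apply, M, incidence]
  rw [hgram, Matrix.det_mul, Matrix.det_transpose]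
  have : (M.map (Int.castRingHom ℝ)).det = (M.det : ℝ) := by
    rw [← RingHom.mapMatrix_apply, ← RingHom.map_det]; rfl
  rw [this]
  exact_mod_cast hsq

/-- The indicator of the side of an uncrossed cut that does not contain the root is a nonzero vector
in the left kernel. -/
lemma det_gram_incidence_of_not_joins [Fintype V] [DecidableEq V] {ends : E → V × V}
    (r : V) {T : Finset E} (hT : ¬ Joins ends T) : (gram (incidence ends r) 1 T).det = 0 := by
  classical
  unfold Joins at hT
  push Not at hT
  obtain ⟨φ, hφ, x, y, hx, hy⟩ := hT
  let h : V → ℝ := fun v => if (φ v ↔ φ r) then 0 else 1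
  have hr : h r = 0 := by simp [h]
  have hh : ∀ e ∈ T, h (ends e).1 = h (ends e).2 := by
    intro e he
    simp only [h, hφ e he]
  have hne : ∃ v : {v : V // v ≠ r}, h v ≠ 0 := by
    by_cases hφr : φ r
    · refine ⟨⟨y, fun h' => hy (h' ▸ hφr)⟩, ?_⟩
      simp [h, hφr, hy]
    · refine ⟨⟨x, fun h' => hφr (h' ▸ hx)⟩, ?_⟩
      simp [h, hφr, hx]
  have hsum : ∀ z : V, ∑ v : {v : V // v ≠ r}, h v * (if z = v then 1 else 0) = h z := by
    intro z
    by_cases hz : z = r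
    · rw [hz, hr]
      exact Finset.sum_eq_zero fun v _ => by rw [if_neg v.2.symm, mul_zero]
    · rw [Finset.sum_eq_single ⟨z, hz⟩]
      · simp
      · intro v _ hv
        rw [if_neg fun h' => hv (Subtype.ext h'.symm), mul_zero]
      · simp
  rw [← Matrix.exists_vecMul_eq_zero_iff]
  obtain ⟨v, hv⟩ := hne
  refine ⟨fun v => h v, fun h0 => hv (congrFun h0 v), ?_⟩
  ext j
  simp only [Matrix.vecMul, dotProduct, gram, Matrix.sum_apply, Pi.zero_apply, Finset.mul_sum]
  rw [Finset.sum_comm]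
  refine Finset.sum_eq_zero fun e he => ?_
  have : ∑ v : {v : V // v ≠ r}, h v * incidence ends r e v = 0 := by
    simp only [incidence, mul_sub, Finset.sum_sub_distrib, hsum, hh e he, sub_self]
  simp only [Pi.one_apply, one_smul, Matrix.vecMulVec_apply, ← mul_assoc]
  rw [← Finset.sum_mul, this, zero_mul]

/-- The matrix-tree theorem in local form: `treeWeight` is the determinantal weight of the incidence
vectors with the root coordinate removed. -/
theorem pairwiseNegative_treeWeight [Finite V] [DecidableEq E] (ends : E → V × V) :
    PairwiseNegative (treeWeight ends) := by
  classical
  cases nonempty_fintype V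
  rcases isEmpty_or_nonempty V with hV | ⟨⟨r⟩⟩
  · have : treeWeight ends = 0 := by
      funext T
      simp [treeWeight, IsTreeOn]
    intro I R e f _ _ _ _ _ _
    simp [this, condSum]
  · have : treeWeight ends = detWeight (incidence ends r) := by
      funext T
      have hcard : Fintype.card {v : V // v ≠ r} + 1 = Nat.card V := by
        have := Fintype.card_subtype_compl (fun v => v = r)
        have h1 : 0 < Fintype.card V := Fintype.card_pos_iff.2 ⟨r⟩
        rw [Fintype.card_subtype_eq] at this
        rw [Nat.card_eq_fintype_card, this]; omega
      unfold treeWeight detWeight IsTreeOn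
      by_cases hc : T.card = Fintype.card {v : V // v ≠ r}
      · rw [if_pos hc]
        by_cases hj : Joins ends T
        · rw [det_gram_incidence_of_joins r hj hc, if_pos ⟨hj, by omega⟩]
        · rw [det_gram_incidence_of_not_joins r hj, if_neg fun h => hj h.1]
      · rw [if_neg hc, if_neg fun h => hc (by omega)]
    rw [this]
    exact pairwiseNegative_detWeight _

end FiniteTrees

/-! ### Trees of quotient graphs are dominated -/

section QuotientDomination

variable {E V V₁ V₂ : Type*}

lemma condSum_map {E' : Type*} [DecidableEq E] [DecidableEq E'] (w g : Finset E' → ℝ)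
    (I : Finset E') (f : E ↪ E') (S : Finset E) :
    condSum w g I (S.map f) = ∑ T ∈ S.powerset, g (T.map f) * w (I ∪ T.map f) := by
  unfold condSum
  symm
  refine Finset.sum_nbij (fun T => T.map f) ?_ ?_ ?_ fun _ _ => rfl
  · intro T hT
    rw [Finset.mem_powerset] at hT ⊢
    exact Finset.map_subset_map.2 hT
  · intro T _ T' _ h
    exact Finset.map_injective f h
  · intro U hU
    rw [Finset.mem_coe, Finset.mem_powerset, Finset.subset_map_iff] at hU
    obtain ⟨T, hT, rfl⟩ := hU
    exact ⟨T, Finset.mem_coe.2 (Finset.mem_powerset.2 hT), rfl⟩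

lemma card_eq_of_treeWeight_ne_zero {ends : E → V × V} {T : Finset E}
    (h : treeWeight ends T ≠ 0) : T.card = Nat.card V - 1 := by
  have : IsTreeOn ends T := by
    by_contra hn
    exact h (by simp [treeWeight, hn])
  have := this.2
  omega

lemma exists_isTreeOn_of_condSum_pos [DecidableEq E] {ends : E → V × V} {I R : Finset E}
    (h : 0 < condSum (treeWeight ends) 1 I R) : ∃ T ⊆ R, IsTreeOn ends (I ∪ T) := by
  by_contra! hcon
  refine h.ne' (Finset.sum_eq_zero fun T hT => ?_)
  simp [treeWeight, hcon T (Finset.mem_powerset.1 hT)]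

lemma condSum_treeWeight_pos [DecidableEq E] {ends : E → V × V} {I R T : Finset E} (hT : T ⊆ R)
    (h : IsTreeOn ends (I ∪ T)) : 0 < condSum (treeWeight ends) 1 I R :=
  Finset.sum_pos' (fun U _ => by simpa using treeWeight_nonneg ends _)
    ⟨T, Finset.mem_powerset.2 hT, by simp [treeWeight, h]⟩

/-- Forcing the edges of a forest `Y` into the tree decreases the rest stochastically. -/
lemma condSum_treeWeight_mul_le [Finite V] [DecidableEq E] {ends : E → V × V} {R Y : Finset E}
    (hRY : Disjoint Y R) {g : Finset E → ℝ} (hg : ∀ T, 0 ≤ g T) (hmono : Monotone g) :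
    condSum (treeWeight ends) g Y R * condSum (treeWeight ends) 1 ∅ R ≤
      condSum (treeWeight ends) g ∅ R * condSum (treeWeight ends) 1 Y R := by
  have hw := treeWeight_nonneg ends
  have hone : ∀ T : Finset E, (0 : ℝ) ≤ (1 : Finset E → ℝ) T := fun _ => zero_le_one
  induction Y using Finset.induction_on with
  | empty => exact le_rfl
  | insert x Y hxY ih =>
    rw [Finset.disjoint_insert_left] at hRY
    have ih := ih hRY.2
    rcases (condSum_nonneg hw hone ∅ R).eq_or_lt with h0 | h0
    · rw [← h0, mul_zero]
      exact mul_nonneg (condSum_nonneg hw hg _ _) (condSum_nonneg hw hone _ _)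
    rcases (condSum_nonneg hw hone (insert x Y) R).eq_or_lt with h1 | h1
    · rw [condSum_eq_zero_of hw h1.symm, ← h1, zero_mul, mul_zero]
    -- The intermediate normalisation must not vanish: `Y` is part of a tree and `R` joins all
    -- vertices, so edges of `R` complete `Y` to a tree.
    have hpos : 0 < condSum (treeWeight ends) 1 Y R := by
      obtain ⟨T, hTR, hT⟩ := exists_isTreeOn_of_condSum_pos h0
      obtain ⟨U, hUR, hU⟩ := exists_isTreeOn_of_condSum_pos h1
      have hYU : Y ⊆ insert x Y ∪ U :=
        (Finset.subset_insert x Y).trans Finset.subset_union_left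
      have hj : Joins (contractEnds ends Y) R :=
        joins_contractEnds.2 (hT.1.mono (by
          rw [Finset.empty_union]; exact hTR.trans Finset.subset_union_right))
      have : Nonempty V := by
        by_contra hV
        rw [not_nonempty_iff] at hV
        have := hT.2
        simp at this
      have : Nonempty (Contract ends Y) := this.map (Quotient.mk _)
      obtain ⟨T', hT'R, hT'⟩ := hj.exists_isTreeOn
      exact condSum_treeWeight_pos hT'R
        ((isTreeOn_contractEnds hYU hU (hRY.2.mono_right hT'R)).1 hT')
    have step := (pairwiseNegative_treeWeight ends).condSum_mul_le hw
      (fun T hT => card_eq_of_treeWeight_ne_zero hT) R Y g hRY.2 hxY hRY.1 hg hmono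
    have e1 : condSum (treeWeight ends) g (insert x Y) R * condSum (treeWeight ends) 1 ∅ R *
        condSum (treeWeight ends) 1 Y R ≤ condSum (treeWeight ends) g ∅ R *
        condSum (treeWeight ends) 1 (insert x Y) R * condSum (treeWeight ends) 1 Y R := by
      nlinarith [mul_le_mul_of_nonneg_right step h0.le, mul_le_mul_of_nonneg_right ih h1.le]
    exact le_of_mul_le_mul_right e1 hpos

/-- The uniform spanning tree of a quotient graph is stochastically dominated by the uniform
spanning tree of the graph. -/
theorem condSum_quotient_mul_le [Finite V₁] [Finite V₂] [DecidableEq E] {ends₁ : E → V₁ × V₁}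
    {ends₂ : E → V₂ × V₂} {p : V₁ → V₂} (hp : Function.Surjective p) {S : Finset E}
    (hS : ∀ e ∈ S, p (ends₁ e).1 = (ends₂ e).1 ∧ p (ends₁ e).2 = (ends₂ e).2)
    {g : Finset E → ℝ} (hg : ∀ T, 0 ≤ g T) (hmono : Monotone g) :
    condSum (treeWeight ends₂) g ∅ S * condSum (treeWeight ends₁) 1 ∅ S ≤
      condSum (treeWeight ends₁) g ∅ S * condSum (treeWeight ends₂) 1 ∅ S := by
  classical
  cases nonempty_fintype V₁
  cases nonempty_fintype V₂
  let s := Function.surjInv hp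
  have hps : ∀ y, p (s y) = y := Function.surjInv_eq hp
  -- extra edges which join every vertex to the representative of its fibre
  let ends : E ⊕ V₁ → V₁ × V₁ := Sum.elim ends₁ fun v => (v, s (p v))
  -- Forbidding `X` gives the tree of the first graph. Forcing all of `X` contracts the fibres of
  -- `p` and gives the tree of the quotient. The representatives `s y` need no extra edge, so `X` is
  -- a forest with one edge for each vertex lost.
  let X : Finset (E ⊕ V₁) := (Finset.univ.filter fun v => v ∉ Set.range s).map .inr
  let g' : Finset (E ⊕ V₁) → ℝ := fun T => g T.toLeft
  have hmono' : Monotone g' := fun T U h => hmono (Finset.toLeft_monotone h)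
  have hXS : Disjoint X (S.map .inl) := by
    rw [Finset.disjoint_left]
    intro a ha hb
    obtain ⟨v, _, rfl⟩ := Finset.mem_map.1 ha
    obtain ⟨e, _, he⟩ := Finset.mem_map.1 hb
    exact Sum.inl_ne_inr he
  have hXcard : Nat.card V₁ = Nat.card V₂ + X.card := by
    have h1 : (Finset.univ.filter fun v => v ∈ Set.range s).card = Fintype.card V₂ := by
      have : (Finset.univ.filter fun v => v ∈ Set.range s) = Finset.univ.image s := by
        ext v; simp
      rw [this, Finset.card_image_of_injective _ (Function.injective_surjInv hp), Finset.card_univ]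
    rw [Nat.card_eq_fintype_card, Nat.card_eq_fintype_card, ← h1, Finset.card_map,
      Finset.card_filter_add_card_filter_not, Finset.card_univ]
  have hw₁ : ∀ T : Finset E, treeWeight ends (∅ ∪ T.map .inl) = treeWeight ends₁ (∅ ∪ T) := by
    intro T
    unfold treeWeight IsTreeOn Joins
    simp only [Finset.empty_union, Finset.card_map, Finset.forall_mem_map]
    rfl
  have hw₂ : ∀ T ⊆ S, treeWeight ends (X ∪ T.map .inl) = treeWeight ends₂ (∅ ∪ T) := by
    intro T hT
    have hj : Joins ends (X ∪ T.map .inl) ↔ Joins ends₂ T := by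
      constructor
      · intro h φ hφ x y hx
        have := h (fun v => φ (p v)) (fun e he => ?_) (s x) (s y) (by simpa only [hps] using hx)
        · simpa only [hps] using this
        · rcases Finset.mem_union.1 he with he | he
          · obtain ⟨v, _, rfl⟩ := Finset.mem_map.1 he
            simp [ends, hps]
          · obtain ⟨a, ha, rfl⟩ := Finset.mem_map.1 he
            simpa [ends, (hS a (hT ha)).1, (hS a (hT ha)).2] using hφ a ha
      · intro h φ hφ x y hx
        have hfib : ∀ v, φ v ↔ φ (s (p v)) := by
          intro v
          by_cases hv : v ∈ Set.range s
          · obtain ⟨y, rfl⟩ := hv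
            rw [hps]
          · exact hφ (.inr v) (Finset.mem_union_left _ (Finset.mem_map.2 ⟨v, by simpa using hv, rfl⟩))
        rw [hfib] at hx ⊢
        refine h (fun v => φ (s v)) (fun e he => ?_) (p x) (p y) hx
        rw [← (hS e (hT he)).1, ← (hS e (hT he)).2, ← hfib, ← hfib]
        exact hφ (.inl e) (Finset.mem_union_right _ (Finset.mem_map_of_mem _ he))
    have : IsTreeOn ends (X ∪ T.map .inl) ↔ IsTreeOn ends₂ (∅ ∪ T) := by
      have hcm : (T.map (Function.Embedding.inl : E ↪ E ⊕ V₁)).card = T.card := Finset.card_map _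
      unfold IsTreeOn
      rw [hj, Finset.empty_union, hXcard, Finset.card_union_of_disjoint
        (hXS.mono_right (Finset.map_subset_map.2 hT)), hcm]
      exact and_congr_right fun _ => by omega
    unfold treeWeight
    simp only [this]
  have hleft : ∀ T : Finset E, (T.map (Function.Embedding.inl : E ↪ E ⊕ V₁)).toLeft = T := by
    intro T; ext e; simp
  have hsum₁ : ∀ h : Finset E → ℝ, condSum (treeWeight ends) (fun T => h T.toLeft) ∅ (S.map .inl) =
      condSum (treeWeight ends₁) h ∅ S := by
    intro h
    rw [condSum_map]
    exact Finset.sum_congr rfl fun T _ => by rw [hw₁, hleft]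
  have hsum₂ : ∀ h : Finset E → ℝ, condSum (treeWeight ends) (fun T => h T.toLeft) X (S.map .inl) =
      condSum (treeWeight ends₂) h ∅ S := by
    intro h
    rw [condSum_map]
    exact Finset.sum_congr rfl fun T hT => by rw [hw₂ T (Finset.mem_powerset.1 hT), hleft]
  have key := condSum_treeWeight_mul_le (ends := ends) hXS (fun T => hg T.toLeft) hmono'
  rw [← hsum₁, ← hsum₁, ← hsum₂, ← hsum₂]
  exact key

end QuotientDomination

/-! ### Domination for a tree conditioned on its trace -/

section ConditionedTrees

variable {E V₁ V₂ : Type*}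

lemma condSum_contract [Finite V₁] [DecidableEq E] {ends : E → V₁ × V₁} {A R U : Finset E}
    (hAU : A ⊆ U) (hU : IsTreeOn ends U) (hAR : Disjoint A R) (g : Finset E → ℝ) :
    condSum (treeWeight (contractEnds ends A)) g ∅ R = condSum (treeWeight ends) g A R := by
  refine Finset.sum_congr rfl fun T hT => ?_
  rw [Finset.empty_union]
  have h := isTreeOn_contractEnds hAU hU (hAR.mono_right (Finset.mem_powerset.1 hT))
  unfold treeWeight
  by_cases hT' : IsTreeOn ends (A ∪ T)
  · rw [if_pos hT', if_pos (h.2 hT')]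
  · rw [if_neg hT', if_neg (fun h' => hT' (h.1 h'))]

/-- Let `π` collapse vertices of a graph. Condition the spanning tree of the graph to have trace
`A` on `K`, where every edge touching an end of `A` that `π` does not send to `z` lies in `K`.
Then outside `K` the tree dominates the tree of the collapsed graph with any given trace. -/
theorem condSum_collapse_mul_le [Finite V₁] [Finite V₂] [DecidableEq E] {ends₁ : E → V₁ × V₁}
    {ends₂ : E → V₂ × V₂} {π : V₁ → V₂} (hπ : Function.Surjective π) {K R : Finset E}
    (hKR : Disjoint K R)
    (hends : ∀ e ∈ R, π (ends₁ e).1 = (ends₂ e).1 ∧ π (ends₁ e).2 = (ends₂ e).2)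
    {A A' : Finset E} (hA : A ⊆ K) (hA' : A' ⊆ K) {D : Set V₁} (z : V₂)
    (hAD : ∀ e ∈ A, (ends₁ e).1 ∈ D ∧ (ends₁ e).2 ∈ D)
    (hD : ∀ x ∈ D, π x ≠ z → ∀ e ∈ R, (ends₂ e).1 ≠ π x ∧ (ends₂ e).2 ≠ π x)
    {g : Finset E → ℝ} (hg : ∀ T, 0 ≤ g T) (hmono : Monotone g) :
    condSum (treeWeight ends₂) g A' R * condSum (treeWeight ends₁) 1 A R ≤
      condSum (treeWeight ends₁) g A R * condSum (treeWeight ends₂) 1 A' R := by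
  classical
  have hw₁ := treeWeight_nonneg ends₁
  have hw₂ := treeWeight_nonneg ends₂
  have hone : ∀ T : Finset E, (0 : ℝ) ≤ (1 : Finset E → ℝ) T := fun _ => zero_le_one
  rcases (condSum_nonneg hw₁ hone A R).eq_or_lt with h1 | h1
  · rw [← h1, mul_zero]
    exact mul_nonneg (condSum_nonneg hw₁ hg _ _) (condSum_nonneg hw₂ hone _ _)
  rcases (condSum_nonneg hw₂ hone A' R).eq_or_lt with h2 | h2
  · rw [condSum_eq_zero_of hw₂ h2.symm, ← h2, zero_mul, mul_zero]
  obtain ⟨T₁, hT₁R, hT₁⟩ := exists_isTreeOn_of_condSum_pos h1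
  obtain ⟨T₂, hT₂R, hT₂⟩ := exists_isTreeOn_of_condSum_pos h2
  -- All of `D` goes to the class of `z`, so that the map is constant along `A` and factors through
  -- the contraction. It still agrees with `π` at the ends of the edges of `R`, because these avoid
  -- `π x` for `x ∈ D` unless `π x = z`.
  let p₀ : V₁ → Contract ends₂ A' := fun x =>
    if x ∈ D then Quotient.mk _ z else Quotient.mk _ (π x)
  let p : Contract ends₁ A → Contract ends₂ A' := Quotient.lift p₀ fun x y hxy =>
    (hxy (fun v => p₀ x = p₀ v) fun e he => by
      simp only [p₀, if_pos (hAD e he).1, if_pos (hAD e he).2]).1 rfl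
  have hp₀ : ∀ x, (∃ e ∈ R, (ends₂ e).1 = π x ∨ (ends₂ e).2 = π x) → p₀ x = Quotient.mk _ (π x) := by
    rintro x ⟨e, he, hex⟩
    by_cases hx : x ∈ D
    · by_cases hz : π x = z
      · simp only [p₀, if_pos hx, hz]
      · have := hD x hx hz e he
        tauto
    · simp only [p₀, if_neg hx]
  -- Having a class in the range of `p` holds at `z` and is preserved along the tree `A' ∪ T₂`: an
  -- edge of `A'` stays in one class, and both ends of an edge of `R` are in the range.
  have hpsurj : Function.Surjective p := by
    have hz : ∃ a, p a = Quotient.mk _ z := by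
      obtain ⟨x, hx⟩ := hπ z
      refine ⟨Quotient.mk _ x, ?_⟩
      change p₀ x = _
      simp only [p₀, hx, ite_self]
    have hR : ∀ e ∈ R, ∀ y, (ends₂ e).1 = y ∨ (ends₂ e).2 = y → ∃ a, p a = Quotient.mk _ y := by
      intro e he y hy
      obtain ⟨x, rfl⟩ := hπ y
      exact ⟨Quotient.mk _ x, hp₀ x ⟨e, he, hy⟩⟩
    intro y
    induction y using Quotient.inductionOn with | _ y =>
    refine hT₂.1 (fun y => ∃ a, p a = Quotient.mk _ y) (fun e he => ?_) z y hz
    rcases Finset.mem_union.1 he with he | he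
    · rw [contract_mk_eq he]
    · exact iff_of_true (hR e (hT₂R he) _ (Or.inl rfl)) (hR e (hT₂R he) _ (Or.inr rfl))
  have key := condSum_quotient_mul_le (ends₁ := contractEnds ends₁ A)
    (ends₂ := contractEnds ends₂ A') hpsurj (S := R) (fun e he => ?_) hg hmono
  · rwa [condSum_contract Finset.subset_union_left hT₁ (Finset.disjoint_of_subset_left hA hKR),
      condSum_contract Finset.subset_union_left hT₁ (Finset.disjoint_of_subset_left hA hKR),
      condSum_contract Finset.subset_union_left hT₂ (Finset.disjoint_of_subset_left hA' hKR),
      condSum_contract Finset.subset_union_left hT₂ (Finset.disjoint_of_subset_left hA' hKR)] at key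
  · obtain ⟨h1, h2⟩ := hends e he
    constructor
    · exact (hp₀ _ ⟨e, he, Or.inl h1.symm⟩).trans (by rw [h1]; rfl)
    · exact (hp₀ _ ⟨e, he, Or.inr h2.symm⟩).trans (by rw [h2]; rfl)

/-- Total probability over the trace on `K`, by splitting `T` into `T ∩ K` and `T \ K`. -/
lemma condSum_eq_sum_trace [DecidableEq E] (w g : Finset E → ℝ) {K S : Finset E} (hK : K ⊆ S) :
    condSum w (fun T => g (T \ K)) ∅ S = ∑ A ∈ K.powerset, condSum w g A (S \ K) := by
  unfold condSum
  rw [← Finset.sum_product']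
  refine Finset.sum_nbij' (fun T => (T ∩ K, T \ K)) (fun p => p.1 ∪ p.2) ?_ ?_ ?_ ?_ ?_
  · intro T hT
    rw [Finset.mem_powerset] at hT
    rw [Finset.mem_product, Finset.mem_powerset, Finset.mem_powerset]
    exact ⟨Finset.inter_subset_right, Finset.sdiff_subset_sdiff hT subset_rfl⟩
  · rintro ⟨A, T⟩ h
    rw [Finset.mem_product, Finset.mem_powerset, Finset.mem_powerset] at h
    exact Finset.mem_powerset.2 (Finset.union_subset (h.1.trans hK) (h.2.trans Finset.sdiff_subset))
  · intro T _
    exact (Finset.union_comm _ _).trans (Finset.sdiff_union_inter T K)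
  · rintro ⟨A, T⟩ h
    rw [Finset.mem_product, Finset.mem_powerset, Finset.mem_powerset] at h
    have hd : Disjoint T K := Finset.disjoint_of_subset_left h.2 Finset.sdiff_disjoint
    have h1 := h.1
    ext x
    · simp only [Finset.mem_inter, Finset.mem_union]
      have : x ∈ T → x ∉ K := fun h => Finset.disjoint_left.1 hd h
      have : x ∈ A → x ∈ K := fun h => h1 h
      tauto
    · simp only [Finset.mem_sdiff, Finset.mem_union]
      have : x ∈ T → x ∉ K := fun h => Finset.disjoint_left.1 hd h
      have : x ∈ A → x ∈ K := fun h => h1 h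
      tauto
  · intro T _
    simp only [Finset.empty_union]
    rw [Finset.union_comm, Finset.sdiff_union_inter]

lemma condSum_trace [DecidableEq E] (w g : Finset E → ℝ) {K S A : Finset E} (hK : K ⊆ S)
    (hA : A ⊆ K) :
    condSum w (fun T => if T ∩ K = A then g (T \ K) else 0) ∅ S = condSum w g A (S \ K) := by
  unfold condSum
  simp only [ite_mul, zero_mul]
  rw [← Finset.sum_filter]
  refine Finset.sum_nbij' (fun T => T \ K) (fun T => A ∪ T) ?_ ?_ ?_ ?_ ?_
  · intro T hT
    simp only [Finset.mem_filter, Finset.mem_powerset] at hT ⊢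
    exact Finset.sdiff_subset_sdiff hT.1 subset_rfl
  · intro T hT
    simp only [Finset.mem_filter, Finset.mem_powerset] at hT ⊢
    refine ⟨Finset.union_subset (hA.trans hK) (hT.trans Finset.sdiff_subset), ?_⟩
    have hd : Disjoint T K := Finset.disjoint_of_subset_left hT Finset.sdiff_disjoint
    rw [Finset.union_inter_distrib_right, Finset.inter_eq_left.2 hA,
      Finset.disjoint_iff_inter_eq_empty.1 hd, Finset.union_empty]
  · intro T hT
    simp only [Finset.mem_filter, Finset.mem_powerset] at hT
    rw [← hT.2, Finset.union_comm, Finset.sdiff_union_inter]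
  · intro T hT
    rw [Finset.mem_powerset] at hT
    have hd : Disjoint T K := Finset.disjoint_of_subset_left hT Finset.sdiff_disjoint
    rw [Finset.union_sdiff_distrib, Finset.sdiff_eq_empty_iff_subset.2 hA, Finset.empty_union,
      Finset.sdiff_eq_self_of_disjoint hd]
  · intro T hT
    simp only [Finset.mem_filter, Finset.mem_powerset] at hT
    congr 2
    rw [← hT.2, Finset.empty_union, Finset.union_comm, Finset.sdiff_union_inter]

/-- The version of `condSum_collapse_mul_le` in which the tree of the collapsed graph is not
conditioned. -/
theorem condSum_trace_collapse_mul_le [Finite V₁] [Finite V₂] [DecidableEq E]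
    {ends₁ : E → V₁ × V₁}
    {ends₂ : E → V₂ × V₂} {π : V₁ → V₂} (hπ : Function.Surjective π) {K S : Finset E}
    (hKS : K ⊆ S)
    (hends : ∀ e ∈ S, π (ends₁ e).1 = (ends₂ e).1 ∧ π (ends₁ e).2 = (ends₂ e).2)
    {A : Finset E} (hA : A ⊆ K) {D : Set V₁} (z : V₂)
    (hAD : ∀ e ∈ A, (ends₁ e).1 ∈ D ∧ (ends₁ e).2 ∈ D)
    (hD : ∀ x ∈ D, π x ≠ z → ∀ e ∈ S \ K, (ends₂ e).1 ≠ π x ∧ (ends₂ e).2 ≠ π x)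
    {g : Finset E → ℝ} (hg : ∀ T, 0 ≤ g T) (hmono : Monotone g) :
    condSum (treeWeight ends₂) (fun T => g (T \ K)) ∅ S *
        condSum (treeWeight ends₁) (fun T => if T ∩ K = A then 1 else 0) ∅ S ≤
      condSum (treeWeight ends₁) (fun T => if T ∩ K = A then g (T \ K) else 0) ∅ S *
        condSum (treeWeight ends₂) 1 ∅ S := by
  have h1 := condSum_trace (treeWeight ends₁) 1 hKS hA
  have h2 := condSum_eq_sum_trace (treeWeight ends₂) 1 hKS
  simp only [Pi.one_apply] at h1 h2
  change condSum (treeWeight ends₂) 1 ∅ S = _ at h2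
  rw [condSum_eq_sum_trace _ _ hKS, h1, condSum_trace _ _ hKS hA, h2, Finset.sum_mul,
    Finset.mul_sum]
  exact Finset.sum_le_sum fun A' hA' => condSum_collapse_mul_le hπ Finset.disjoint_sdiff
    (fun e he => hends e (Finset.sdiff_subset he)) hA (Finset.mem_powerset.1 hA') z hAD hD hg hmono

end ConditionedTrees

/-! ### Graph-theoretic spanning trees as joining sets of the right size -/

section SpanningTrees

variable {α β : Type*}

lemma spanningSubgraph_adj {G : Graph α β} {ω : Set β} {x y : V(G)} :
    (spanningSubgraph G ω).Adj x y ↔ x ≠ y ∧ ∃ e ∈ ω, G.IsLink e x y := by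
  unfold spanningSubgraph
  refine Iff.trans (Graph.toSimpleGraph_adj (G := G.restrict ω) (u := x) (v := y) |>.to_iff) ?_
  simp only [Graph.Adj, Graph.restrict_isLink]
  refine and_congr_right fun _ => exists_congr fun e => ?_
  tauto

/-- The spanning trees of a finite graph, in terms of a choice `ends` of the two ends of every
edge. -/
theorem isSpanningTree_iff {H : Graph α β} [Finite V(H)] {ends : β → V(H) × V(H)}
    (hends : ∀ e ∈ E(H), H.IsLink e (ends e).1 (ends e).2) (T : Finset β) :
    IsSpanningTree H T ↔ (T : Set β) ⊆ E(H) ∧ IsTreeOn ends T := by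
  classical
  cases nonempty_fintype V(H)
  unfold IsSpanningTree
  refine and_congr_right fun hTE => ?_
  have hadj : ∀ {x y : V(H)}, (spanningSubgraph H T).Adj x y ↔
      x ≠ y ∧ ∃ e ∈ T, s((ends e).1, (ends e).2) = s(x, y) := by
    intro x y
    rw [spanningSubgraph_adj]
    refine and_congr_right fun _ => exists_congr fun e => and_congr_right fun he => ?_
    rw [(hends e (hTE he)).isLink_iff_sym2_eq]
    simp only [Sym2.eq_iff, Subtype.ext_iff]
  have hconn : (spanningSubgraph H T).Preconnected ↔ Joins ends T := by
    constructor
    · intro h φ hφ x y hx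
      obtain ⟨p⟩ := h x y
      induction p with
      | nil => exact hx
      | cons hab _ ih =>
        refine ih ?_
        obtain ⟨_, e, he, hs⟩ := hadj.1 hab
        have := hφ e he
        rcases Sym2.eq_iff.1 hs with ⟨h1, h2⟩ | ⟨h1, h2⟩
        · rw [h1, h2] at this; exact this.1 hx
        · rw [h1, h2] at this; exact this.2 hx
    · intro h x y
      refine h (fun v => (spanningSubgraph H T).Reachable x v) (fun e he => ?_) x y
        (SimpleGraph.Reachable.refl x)
      by_cases hne : (ends e).1 = (ends e).2
      · rw [hne]
      · have : (spanningSubgraph H T).Adj (ends e).1 (ends e).2 := hadj.2 ⟨hne, e, he, rfl⟩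
        exact ⟨fun h => h.trans this.reachable, fun h => h.trans this.symm.reachable⟩
  have hedge : (spanningSubgraph H T).edgeFinset =
      (T.filter fun e => (ends e).1 ≠ (ends e).2).image fun e => s((ends e).1, (ends e).2) := by
    ext a
    induction a using Sym2.inductionOn with | _ x y =>
    rw [SimpleGraph.mem_edgeFinset, SimpleGraph.mem_edgeSet, hadj]
    simp only [Finset.mem_image, Finset.mem_filter]
    constructor
    · rintro ⟨hne, e, he, hs⟩
      refine ⟨e, ⟨he, ?_⟩, hs⟩
      rcases Sym2.eq_iff.1 hs with ⟨h1, h2⟩ | ⟨h1, h2⟩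
      · rw [h1, h2]; exact hne
      · rw [h1, h2]; exact hne.symm
    · rintro ⟨e, ⟨he, hne⟩, hs⟩
      refine ⟨?_, e, he, hs⟩
      rcases Sym2.eq_iff.1 hs with ⟨h1, h2⟩ | ⟨h1, h2⟩
      · rw [← h1, ← h2]; exact hne
      · rw [← h1, ← h2]; exact hne.symm
  rw [SimpleGraph.isTree_iff_connected_and_card, SimpleGraph.connected_iff, hconn]
  have hcardE : Nat.card (spanningSubgraph H T).edgeSet =
      (spanningSubgraph H T).edgeFinset.card := by
    rw [Nat.card_eq_fintype_card, ← SimpleGraph.edgeFinset_card]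
  rw [hcardE]
  unfold IsTreeOn
  constructor
  · rintro ⟨hsimple, ⟨hj, -⟩, hcard⟩
    refine ⟨hj, ?_⟩
    rw [← hcard, hedge]
    have hfilter : (T.filter fun e => (ends e).1 ≠ (ends e).2) = T := by
      refine Finset.filter_true_of_mem fun e he h => ?_
      refine hsimple.toLoopless.not_isLoopAt e (ends e).1 ?_
      rw [Graph.restrict_isLoopAt]
      refine ⟨?_, he⟩
      have := hends e (hTE he)
      rw [← h] at this
      exact this
    rw [hfilter, Finset.card_image_of_injOn]
    intro e he f hf hef
    have he' := hends e (hTE he)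
    have hf' := hends f (hTE hf)
    refine hsimple.eq_of_isLink (e := e) (f := f) (x := (ends e).1) (y := (ends e).2) ?_ ?_
    · rw [Graph.restrict_isLink]; tauto
    · rw [Graph.restrict_isLink]
      have : H.IsLink f (ends e).1 (ends e).2 := by
        rw [hf'.isLink_iff_sym2_eq]
        simpa only [Sym2.eq_iff, Subtype.ext_iff] using hef.symm
      tauto
  · rintro ⟨hj, hcard⟩
    have hne : Nonempty V(H) := by
      by_contra h
      rw [not_nonempty_iff] at h
      simp at hcard
    have hconn' : (spanningSubgraph H T).Connected := by
      rw [SimpleGraph.connected_iff]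
      exact ⟨hconn.2 hj, hne⟩
    -- A connected simple graph needs at least as many edges as `T` has elements. So no element of
    -- `T` is lost in passing to the simple graph, which rules out loops and parallel edges.
    have h1 := hconn'.card_vert_le_card_edgeSet_add_one
    rw [hcardE, hedge] at h1
    have h2 := Finset.card_image_le (s := T.filter fun e => (ends e).1 ≠ (ends e).2)
      (f := fun e => s((ends e).1, (ends e).2))
    have h3 := Finset.card_filter_le T (fun e => (ends e).1 ≠ (ends e).2)
    have hfilter : (T.filter fun e => (ends e).1 ≠ (ends e).2) = T :=
      Finset.eq_of_subset_of_card_le (Finset.filter_subset _ _) (by omega)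
    rw [hfilter] at h1 h2
    have hinj : Set.InjOn (fun e => s((ends e).1, (ends e).2)) T :=
      Finset.card_image_iff.1 (by omega)
    have hsimple : (H.restrict (T : Set β)).Simple :=
      { not_isLoopAt := fun e x hx => by
          rw [Graph.restrict_isLoopAt] at hx
          have he : e ∈ T := hx.2
          rw [← hfilter, Finset.mem_filter] at he
          refine he.2 ?_
          have hl := (hends e (hTE he.1)).isLink_iff_sym2_eq.1 hx.1
          rcases Sym2.eq_iff.1 hl with ⟨h1, h2⟩ | ⟨h1, h2⟩ <;> exact Subtype.ext (h1.trans h2.symm)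
        eq_of_isLink := fun e f x y he hf => by
          rw [Graph.restrict_isLink] at he hf
          have heT : e ∈ T := by tauto
          have hfT : f ∈ T := by tauto
          refine hinj heT hfT ?_
          have h1 := (hends e (hTE heT)).isLink_iff_sym2_eq.1 he.2
          have h2 := (hends f (hTE hfT)).isLink_iff_sym2_eq.1 hf.2
          have h3 := h1.trans h2.symm
          simpa only [Sym2.eq_iff, Subtype.ext_iff] using h3 }
    refine ⟨hsimple, ⟨hj, hne⟩, ?_⟩
    rw [hedge, hfilter, Finset.card_image_of_injOn hinj, hcard]

end SpanningTrees

/-! ### Comparison of the trees of two wired graphs -/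

section WiredTrees

variable {α β : Type*}

/-- The edges with an end in `B`. -/
def touchSet (G : Graph α β) (B : Set α) : Set β := {e | ∃ x ∈ B, G.Inc e x}

lemma touchSet_subset (G : Graph α β) (B : Set α) : touchSet G B ⊆ E(G) := by
  rintro e ⟨x, _, h⟩
  exact h.edge_mem

lemma finite_touchSet {G : Graph α β} (hlf : LocallyFinite G) {B : Set α} (hB : B.Finite) :
    (touchSet G B).Finite := by
  have : touchSet G B ⊆ ⋃ x ∈ B, G.incidenceSet x := by
    rintro e ⟨x, hx, h⟩
    exact Set.mem_biUnion hx h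
  refine Set.Finite.subset (hB.biUnion fun x _ => ?_) this
  by_cases hx : x ∈ V(G)
  · exact hlf x hx
  · convert Set.finite_empty
    ext e
    simp only [Graph.mem_incidenceSet, Set.mem_empty_iff_false, iff_false]
    exact fun h => hx h.vertex_mem

open Classical in
/-- The vertex of `wire G B` which a vertex of `G` is sent to. -/
noncomputable def collapse (G : Graph α β) (B : Finset α) (x : V(G)) : V(wire G B) :=
  ⟨if x.1 ∈ B then some x.1 else none, Set.mem_image_of_mem _ x.2⟩

lemma collapse_surjective (G : Graph α β) (B : Finset α) : Function.Surjective (collapse G B) := by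
  rintro ⟨_, x, hx, rfl⟩
  exact ⟨⟨x, hx⟩, rfl⟩

lemma collapse_of_mem {G : Graph α β} {B : Finset α} {x : V(G)} (h : x.1 ∈ B) :
    (collapse G B x).1 = some x.1 := by simp [collapse, h]

lemma collapse_of_notMem {G : Graph α β} {B : Finset α} {x : V(G)} (h : x.1 ∉ B) :
    (collapse G B x).1 = none := by simp [collapse, h]

instance finite_vertexSet_wire (G : Graph α β) (B : Finset α) : Finite V(wire G B) := by
  classical
  refine Set.Finite.subset ((B.image some ∪ {none} : Finset (Option α)).finite_toSet) ?_
  rintro _ ⟨x, hx, rfl⟩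
  dsimp only
  split_ifs with h <;> simp [h]

/-- Wiring outside the smaller set is a further quotient; `π` is the map needed for the collapse
theorems. -/
lemma exists_collapse_comp (G : Graph α β) {W B : Finset α} (hWB : W ⊆ B) :
    ∃ π : V(wire G B) → V(wire G W), Function.Surjective π ∧
      ∀ x, π (collapse G B x) = collapse G W x := by
  have h : ∀ x y, collapse G B x = collapse G B y → collapse G W x = collapse G W y := by
    intro x y hxy
    have hxy := congrArg Subtype.val hxy
    apply Subtype.ext
    by_cases hx : x.1 ∈ B <;> by_cases hy : y.1 ∈ B
    · rw [collapse_of_mem hx, collapse_of_mem hy, Option.some_inj] at hxy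
      rw [Subtype.ext hxy]
    · rw [collapse_of_mem hx, collapse_of_notMem hy] at hxy; simp at hxy
    · rw [collapse_of_notMem hx, collapse_of_mem hy] at hxy; simp at hxy
    · rw [collapse_of_notMem fun h => hx (hWB h), collapse_of_notMem fun h => hy (hWB h)]
  let s := Function.surjInv (collapse_surjective G B)
  have hs : ∀ x, collapse G W (s (collapse G B x)) = collapse G W x := fun x =>
    h _ _ (Function.surjInv_eq _ _)
  refine ⟨fun v => collapse G W (s v), fun w => ?_, hs⟩
  obtain ⟨x, rfl⟩ := collapse_surjective G W w
  exact ⟨collapse G B x, hs x⟩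

lemma exists_ends {G : Graph α β} (hne : V(G).Nonempty) :
    ∃ ends : β → V(G) × V(G), ∀ e ∈ E(G), G.IsLink e (ends e).1 (ends e).2 := by
  have : ∀ e : β, ∃ p : V(G) × V(G), e ∈ E(G) → G.IsLink e p.1 p.2 := by
    intro e
    by_cases he : e ∈ E(G)
    · obtain ⟨x, y, h⟩ := Graph.exists_isLink_of_mem_edgeSet he
      exact ⟨(⟨x, h.left_mem⟩, ⟨y, h.right_mem⟩), fun _ => h⟩
    · obtain ⟨x, hx⟩ := hne
      exact ⟨(⟨x, hx⟩, ⟨x, hx⟩), fun h => absurd h he⟩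
  choose ends h using this
  exact ⟨ends, h⟩

/-- The ends of the edges in `wire G B`. -/
noncomputable def wireEnds {G : Graph α β} (ends : β → V(G) × V(G)) (B : Finset α) (e : β) :
    V(wire G B) × V(wire G B) := (collapse G B (ends e).1, collapse G B (ends e).2)

lemma isSpanningTree_wire_iff {G : Graph α β} {ends : β → V(G) × V(G)}
    (hends : ∀ e ∈ E(G), G.IsLink e (ends e).1 (ends e).2) (B : Finset α) (T : Finset β) :
    IsSpanningTree (wire G B) T ↔ (T : Set β) ⊆ E(G) ∧ IsTreeOn (wireEnds ends B) T :=
  isSpanningTree_iff (H := wire G B) (ends := wireEnds ends B) (fun e he => (hends e he).map _) T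

/-- An edge with no end in `B` becomes a loop at `none`. -/
lemma IsSpanningTree.subset_touchSet {G : Graph α β} {B : Finset α} {T : Set β}
    (h : IsSpanningTree (wire G B) T) : T ⊆ touchSet G B := by
  intro e he
  by_contra hcon
  obtain ⟨x, y, hxy⟩ := Graph.exists_isLink_of_mem_edgeSet (show e ∈ E(G) from h.1 he)
  have hx : x ∉ B := fun hx => hcon ⟨x, hx, hxy.inc_left⟩
  have hy : y ∉ B := fun hy => hcon ⟨y, hy, hxy.inc_right⟩
  refine h.2.1.toLoopless.not_isLoopAt e none ?_
  rw [Graph.restrict_isLoopAt]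
  exact ⟨⟨x, y, hxy, by simp [hx], by simp [hy]⟩, he⟩

-- The ground set `S` may be larger than the set of edges touching `B`, so that the trees of two
-- wired graphs can be summed over the same `S`.
open Classical in
lemma ncard_isSpanningTree {G : Graph α β} {ends : β → V(G) × V(G)}
    (hends : ∀ e ∈ E(G), G.IsLink e (ends e).1 (ends e).2) {B : Finset α} {S : Finset β}
    (hBS : touchSet G B ⊆ S) (hS : (S : Set β) ⊆ E(G)) (𝒜 : Set (Set β)) :
    ({T | IsSpanningTree (wire G B) T ∧ T ∈ 𝒜}.ncard : ℝ) =
      condSum (treeWeight (wireEnds ends B)) (fun T => if (T : Set β) ∈ 𝒜 then 1 else 0) ∅ S := by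
  have h1 : {T | IsSpanningTree (wire G B) T ∧ T ∈ 𝒜} = (fun T : Finset β => (T : Set β)) ''
      ↑(S.powerset.filter fun T : Finset β => (T : Set β) ∈ 𝒜 ∧ IsTreeOn (wireEnds ends B) T) := by
    ext T
    simp only [Set.mem_ofPred_eq, Set.mem_image, Finset.mem_coe, Finset.mem_filter,
      Finset.mem_powerset]
    constructor
    · rintro ⟨hT, hA⟩
      have hfin : T.Finite := S.finite_toSet.subset (hT.subset_touchSet.trans hBS)
      obtain ⟨T, rfl⟩ := hfin.exists_finset_coe
      exact ⟨T, ⟨by exact_mod_cast hT.subset_touchSet.trans hBS, hA,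
        ((isSpanningTree_wire_iff hends B T).1 hT).2⟩, rfl⟩
    · rintro ⟨T, ⟨hTS, hA, hT⟩, rfl⟩
      exact ⟨(isSpanningTree_wire_iff hends B T).2
        ⟨(Finset.coe_subset.2 hTS).trans hS, hT⟩, hA⟩
  rw [h1, Set.ncard_image_of_injective _ Finset.coe_injective, Set.ncard_coe_finset,
    Finset.card_filter, condSum, Nat.cast_sum]
  refine Finset.sum_congr rfl fun T _ => ?_
  rw [Finset.empty_union]
  unfold treeWeight
  by_cases h1 : (T : Set β) ∈ 𝒜 <;> by_cases h2 : IsTreeOn (wireEnds ends B) T <;> simp [h1, h2]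

open Classical in
lemma ustProb_wire_eq {G : Graph α β} {ends : β → V(G) × V(G)}
    (hends : ∀ e ∈ E(G), G.IsLink e (ends e).1 (ends e).2) {B : Finset α} {S : Finset β}
    (hBS : touchSet G B ⊆ S) (hS : (S : Set β) ⊆ E(G)) (𝒜 : Set (Set β)) :
    ustProb (wire G B) 𝒜 =
      condSum (treeWeight (wireEnds ends B)) (fun T => if (T : Set β) ∈ 𝒜 then 1 else 0) ∅ S /
        condSum (treeWeight (wireEnds ends B)) 1 ∅ S := by
  unfold ustProb
  have h := ncard_isSpanningTree hends hBS hS Set.univ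
  simp only [Set.mem_univ, and_true, if_true] at h
  rw [ncard_isSpanningTree hends hBS hS 𝒜, h]
  rfl

/-- Condition the uniform spanning tree of `wire G B` to have trace `A` on `K`. If all edges which
touch an end of `A` in `W ⊆ B` lie in `K`, then outside `K` the conditioned tree dominates the
uniform spanning tree of `wire G W`. -/
theorem ustProb_mul_le {G : Graph α β} (hne : V(G).Nonempty) (hlf : LocallyFinite G)
    {W B : Finset α} (hWB : W ⊆ B) {K A : Finset β} (hK : (K : Set β) ⊆ E(G)) (hA : A ⊆ K)
    (hex : ∀ e ∈ A, ∀ x ∈ W, G.Inc e x → G.incidenceSet x ⊆ K)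
    {𝒰 : Set (Set β)} (h𝒰 : IsUpperSet 𝒰) :
    ustProb (wire G W) {T | T \ K ∈ 𝒰} * ustProb (wire G B) {T | T ∩ K = A} ≤
      ustProb (wire G B) {T | T ∩ K = A ∧ T \ K ∈ 𝒰} := by
  classical
  obtain ⟨ends, hends⟩ := exists_ends hne
  have hBfin := finite_touchSet hlf B.finite_toSet
  let S : Finset β := hBfin.toFinset ∪ K
  have hS : (S : Set β) ⊆ E(G) := by
    simp only [S, Finset.coe_union, Set.Finite.coe_toFinset]
    exact Set.union_subset (touchSet_subset G B) hK
  have hBS : touchSet G B ⊆ S := by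
    simp only [S, Finset.coe_union, Set.Finite.coe_toFinset]
    exact Set.subset_union_left
  have hWS : touchSet G W ⊆ S := by
    refine Set.Subset.trans ?_ hBS
    rintro e ⟨x, hx, h⟩
    exact ⟨x, hWB hx, h⟩
  obtain ⟨π, hπ, hπc⟩ := exists_collapse_comp G hWB
  -- `z` is the wired vertex `none`. If `W` contains all vertices there is none, and any `z` will
  -- do.
  obtain ⟨z, hz⟩ : ∃ z : V(wire G W), ∀ y : V(wire G W), y.1 = none → y = z := by
    by_cases h : none ∈ V(wire G W)
    · exact ⟨⟨none, h⟩, fun y hy => Subtype.ext hy⟩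
    · exact ⟨collapse G W ⟨hne.some, hne.some_mem⟩, fun y hy => absurd (hy ▸ y.2) h⟩
  have key := condSum_trace_collapse_mul_le (ends₁ := wireEnds ends B) (ends₂ := wireEnds ends W)
    hπ (K := K) (S := S) Finset.subset_union_right (fun e _ => ⟨hπc _, hπc _⟩) hA
    (D := {v | ∃ e ∈ A, ∃ x : V(G), G.Inc e x ∧ collapse G B x = v}) z
    (fun e he => ⟨⟨e, he, _, (hends e (hK (hA he))).inc_left, rfl⟩,
      ⟨e, he, _, (hends e (hK (hA he))).inc_right, rfl⟩⟩) ?_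
    (g := fun T => if (T : Set β) ∈ 𝒰 then 1 else 0) (fun T => by split_ifs <;> norm_num) ?_
  · rw [ustProb_wire_eq hends hWS hS, ustProb_wire_eq hends hBS hS, ustProb_wire_eq hends hBS hS]
    simp only [Set.mem_ofPred_eq]
    have e1 : ∀ T : Finset β, ((T : Set β) \ K ∈ 𝒰) = (((T \ K : Finset β) : Set β) ∈ 𝒰) := by
      intro T; rw [Finset.coe_sdiff]
    have e2 : ∀ T : Finset β, ((T : Set β) ∩ K = A) = (T ∩ K = A) := by
      intro T; rw [← Finset.coe_inter, Finset.coe_inj]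
    simp only [e1, e2, ite_and]
    have n1 := condSum_nonneg (treeWeight_nonneg (wireEnds ends W)) (g := 1)
      (fun _ => zero_le_one) ∅ S
    have n2 := condSum_nonneg (treeWeight_nonneg (wireEnds ends B)) (g := 1)
      (fun _ => zero_le_one) ∅ S
    rw [div_mul_div_comm]
    rcases n1.eq_or_lt with h1 | h1
    · rw [← h1, zero_mul, div_zero]
      refine div_nonneg (condSum_nonneg (treeWeight_nonneg _) (fun T => ?_) _ _) n2
      split_ifs <;> norm_num
    rcases n2.eq_or_lt with h2 | h2
    · rw [← h2, mul_zero, div_zero, div_zero]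
    rw [div_le_div_iff₀ (mul_pos h1 h2) h2]
    nlinarith [mul_le_mul_of_nonneg_right key h2.le]
  -- An end `x` of `A` that is not collapsed to `z` lies in `W`; by `hex` its edges are all in `K`,
  -- so `e ∉ K` avoids it.
  · rintro _ ⟨e₀, he₀, x, hx, rfl⟩ hxz e he
    rw [Finset.mem_sdiff] at he
    rw [hπc] at hxz ⊢
    have hxW : x.1 ∈ W := by
      by_contra h
      exact hxz (hz _ (collapse_of_notMem h))
    have hnot : ∀ y : V(G), G.Inc e y → collapse G W y ≠ collapse G W x := by
      intro y hy h
      have h := congrArg Subtype.val h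
      rw [collapse_of_mem hxW] at h
      by_cases hyW : y.1 ∈ W
      · rw [collapse_of_mem hyW, Option.some_inj] at h
        rw [h] at hy
        exact he.2 (hex e₀ he₀ x hxW hx hy)
      · rw [collapse_of_notMem hyW] at h
        simp at h
    exact ⟨hnot _ (hends e (hS he.1)).inc_left, hnot _ (hends e (hS he.1)).inc_right⟩
  · intro T U hTU
    dsimp only
    split_ifs with h1 h2
    · exact le_rfl
    · exact absurd (h𝒰 (Finset.coe_subset.2 hTU) h1) h2
    · exact zero_le_one
    · exact le_rfl

end WiredTrees

/-! ### Events and functions depending on finitely many points -/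

section LocalEvents

variable {X : Type*}

/-- The function `g` of a set depends only on the part of the set in `K`. -/
def DependsOnlyOn {Y : Type*} (g : Set X → Y) (K : Finset X) : Prop := ∀ ω, g (ω ∩ K) = g ω

lemma measurableSet_inter_eq (K : Finset X) (A : Set X) :
    MeasurableSet {ω : Set X | ω ∩ K = A} := by
  by_cases hA : A ⊆ K
  · have : {ω : Set X | ω ∩ K = A} = ⋂ e ∈ K, {ω | e ∈ ω ↔ e ∈ A} := by
      ext ω
      simp only [Set.mem_ofPred_eq, Set.mem_iInter]
      constructor
      · rintro rfl e he
        simp [he]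
      · intro h
        ext e
        constructor
        · rintro ⟨h1, h2⟩
          exact (h e h2).1 h1
        · exact fun h1 => ⟨(h e (hA h1)).2 h1, hA h1⟩
    rw [this]
    refine Finset.measurableSet_biInter _ fun e _ => ?_
    by_cases he : e ∈ A
    · simpa [he] using measurableSet_mem e
    · simpa [he] using measurableSet_notMem e
  · convert MeasurableSet.empty
    ext ω
    simp only [Set.mem_ofPred_eq, Set.mem_empty_iff_false, iff_false]
    rintro rfl
    exact hA Set.inter_subset_right

/-- The preimage of any set whatever is a finite union of cylinders. -/
lemma DependsOnlyOn.measurable {Y : Type*} [MeasurableSpace Y] {g : Set X → Y} {K : Finset X}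
    (hg : DependsOnlyOn g K) : Measurable g := by
  intro s _
  classical
  have : g ⁻¹' s = ⋃ A ∈ K.powerset.filter fun A : Finset X => g A ∈ s, {ω : Set X | ω ∩ K = (A : Set X)} := by
    ext ω
    simp only [Set.mem_preimage, Finset.mem_filter, Finset.mem_powerset, Set.mem_iUnion,
      Set.mem_ofPred_eq, exists_prop]
    constructor
    · intro h
      obtain ⟨A, hA⟩ := (K.finite_toSet.inter_of_right ω).exists_finset_coe
      refine ⟨A, ⟨?_, ?_⟩, hA.symm⟩
      · rw [← Finset.coe_subset, hA]; exact Set.inter_subset_right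
      · rw [hA, hg]; exact h
    · rintro ⟨A, ⟨_, h⟩, hA⟩
      rw [← hg, hA]; exact h
  rw [this]
  exact Finset.measurableSet_biUnion _ fun A _ => measurableSet_inter_eq K _

lemma DependsOnlyOn.measurableSet {𝒜 : Set (Set X)} {K : Finset X}
    (h : DependsOnlyOn (· ∈ 𝒜) K) : MeasurableSet 𝒜 :=
  measurableSet_setOfPred.2 h.measurable

end LocalEvents

/-! ### Passage to the infinite-volume forest -/

section Limits

variable {α β : Type*}

open Classical in
/-- The spanning tree probabilities of an event in terms of the traces in it. -/
lemma ustProb_eq_sum {G : Graph α β} (hne : V(G).Nonempty) (hlf : LocallyFinite G) (B : Finset α)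
    {L : Finset β} {𝒜 : Set (Set β)} (h𝒜 : DependsOnlyOn (· ∈ 𝒜) L) :
    ustProb (wire G B) 𝒜 = ∑ A ∈ L.powerset.filter fun A : Finset β => (A : Set β) ∈ 𝒜,
      ustProb (wire G B) {T | T ∩ L = (A : Set β)} := by
  obtain ⟨ends, hends⟩ := exists_ends hne
  have hBfin := finite_touchSet hlf B.finite_toSet
  have hBS : touchSet G B ⊆ hBfin.toFinset := by simp
  have hS : (hBfin.toFinset : Set β) ⊆ E(G) := by simpa using touchSet_subset G B
  simp only [ustProb_wire_eq hends hBS hS]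
  rw [← Finset.sum_div]
  congr 1
  unfold condSum
  rw [Finset.sum_comm]
  refine Finset.sum_congr rfl fun T _ => ?_
  rw [← Finset.sum_mul]
  congr 1
  have : ∀ A : Finset β, ((T : Set β) ∈ {T : Set β | T ∩ L = (A : Set β)}) ↔ T ∩ L = A := by
    intro A
    rw [Set.mem_ofPred_eq, ← Finset.coe_inter, Finset.coe_inj]
  simp only [this]
  rw [Finset.sum_ite_eq]
  simp only [Finset.mem_filter, Finset.mem_powerset, Finset.inter_subset_right, true_and,
    Finset.coe_inter]
  have h := h𝒜 T
  simp only [eq_iff_iff] at h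
  simp only [h]

lemma measureReal_eq_sum (μ : Measure (Set β)) [IsFiniteMeasure μ]
    {L : Finset β} {𝒜 : Set (Set β)} (h𝒜 : DependsOnlyOn (· ∈ 𝒜) L) [DecidablePred (· ∈ 𝒜)] :
    μ.real 𝒜 = ∑ A ∈ L.powerset.filter fun A : Finset β => (A : Set β) ∈ 𝒜, μ.real {T | T ∩ L = (A : Set β)} := by
  classical
  rw [← measureReal_biUnion_finset]
  · congr 1
    ext ω
    have h := h𝒜 ω
    simp only [eq_iff_iff] at h
    simp only [Finset.mem_filter, Finset.mem_powerset, Set.mem_iUnion, Set.mem_ofPred_eq,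
      exists_prop]
    constructor
    · intro hω
      obtain ⟨A, hA⟩ := (L.finite_toSet.inter_of_right ω).exists_finset_coe
      refine ⟨A, ⟨?_, ?_⟩, hA.symm⟩
      · rw [← Finset.coe_subset, hA]; exact Set.inter_subset_right
      · rw [hA]; exact h.2 hω
    · rintro ⟨A, ⟨_, hA'⟩, hA⟩
      rw [← h, hA]; exact hA'
  · intro A _ A' _ hne
    refine Set.disjoint_left.2 fun ω h1 h2 => hne ?_
    rw [Set.mem_ofPred_eq] at h1 h2
    exact_mod_cast h1.symm.trans h2
  · exact fun A _ => measurableSet_inter_eq L _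

lemma IsWiredUSF.tendsto {G : Graph α β} (hne : V(G).Nonempty) (hlf : LocallyFinite G)
    {μ : Measure (Set β)} (hμ : IsWiredUSF G μ) {L : Finset β} {𝒜 : Set (Set β)}
    (h𝒜 : DependsOnlyOn (· ∈ 𝒜) L) :
    Tendsto (fun B : Finset α => ustProb (wire G B) 𝒜) atTop (𝓝 (μ.real 𝒜)) := by
  classical
  have := hμ.1
  rw [measureReal_eq_sum μ h𝒜]
  refine Tendsto.congr (fun B => (ustProb_eq_sum hne hlf B h𝒜).symm) ?_
  exact tendsto_finsetSum _ fun A _ => hμ.2 L A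

/-- This allows the law of each sample to be replaced by that of `F` on local events. -/
lemma IsWiredUSF.measureReal_eq {G : Graph α β} (hne : V(G).Nonempty) (hlf : LocallyFinite G)
    {μ μ' : Measure (Set β)} (hμ : IsWiredUSF G μ) (hμ' : IsWiredUSF G μ') {L : Finset β}
    {𝒜 : Set (Set β)} (h𝒜 : DependsOnlyOn (· ∈ 𝒜) L) : μ.real 𝒜 = μ'.real 𝒜 :=
  tendsto_nhds_unique (hμ.tendsto hne hlf h𝒜) (hμ'.tendsto hne hlf h𝒜)

/-- The finite-volume probabilities are uniformly close to the limit for all events which depend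
on a given finite set of edges. -/
lemma IsWiredUSF.eventually_le {G : Graph α β} (hne : V(G).Nonempty) (hlf : LocallyFinite G)
    {μ : Measure (Set β)} (hμ : IsWiredUSF G μ) (L : Finset β) {ε : ℝ} (hε : 0 < ε) :
    ∀ᶠ B : Finset α in atTop, ∀ 𝒜 : Set (Set β), DependsOnlyOn (· ∈ 𝒜) L →
      μ.real 𝒜 ≤ ustProb (wire G B) 𝒜 + ε := by
  classical
  let N : ℝ := L.powerset.card
  have hN : 0 < N := by
    simp only [N, Nat.cast_pos, Finset.card_pos]
    exact ⟨∅, Finset.empty_mem_powerset L⟩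
  have h : ∀ᶠ B : Finset α in atTop, ∀ A ∈ L.powerset,
      μ.real {T | T ∩ L = (A : Set β)} ≤ ustProb (wire G B) {T | T ∩ L = (A : Set β)} + ε / N := by
    rw [eventually_all_finset]
    intro A _
    have := (hμ.2 L A).eventually (lt_mem_nhds (sub_lt_self _ (div_pos hε hN)))
    filter_upwards [this] with B hB
    linarith
  filter_upwards [h] with B hB 𝒜 h𝒜
  have := hμ.1
  rw [measureReal_eq_sum μ h𝒜, ustProb_eq_sum hne hlf B h𝒜]
  calc _ ≤ ∑ A ∈ L.powerset.filter fun A : Finset β => (A : Set β) ∈ 𝒜,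
        (ustProb (wire G B) {T | T ∩ L = (A : Set β)} + ε / N) :=
        Finset.sum_le_sum fun A hA => hB A (Finset.mem_of_mem_filter A hA)
    _ ≤ _ := by
      rw [Finset.sum_add_distrib, Finset.sum_const, nsmul_eq_mul]
      gcongr
      · have hle : ((L.powerset.filter fun A : Finset β => (A : Set β) ∈ 𝒜).card : ℝ) ≤ N := by
          simp only [N]
          exact_mod_cast Finset.card_filter_le _ _
        calc _ ≤ N * (ε / N) := mul_le_mul_of_nonneg_right hle (div_pos hε hN).le
          _ = ε := by field_simp

/-- The infinite-volume form of `ustProb_mul_le`. -/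
theorem IsWiredUSF.ustProb_mul_le {G : Graph α β} (hne : V(G).Nonempty) (hlf : LocallyFinite G)
    {μ : Measure (Set β)} (hμ : IsWiredUSF G μ)
    {W : Finset α} {K A : Finset β} (hK : (K : Set β) ⊆ E(G)) (hA : A ⊆ K)
    (hex : ∀ e ∈ A, ∀ x ∈ W, G.Inc e x → G.incidenceSet x ⊆ K)
    {𝒰 : Set (Set β)} (h𝒰 : IsUpperSet 𝒰) {L : Finset β} (hL : DependsOnlyOn (· ∈ 𝒰) L) :
    ustProb (wire G W) {T | T \ K ∈ 𝒰} * μ.real {T | T ∩ K = A} ≤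
      μ.real {T | T ∩ K = A ∧ T \ K ∈ 𝒰} := by
  classical
  have h1 : DependsOnlyOn (fun ω => ω ∈ {T : Set β | T ∩ K = A ∧ T \ K ∈ 𝒰}) (K ∪ L) := by
    intro ω
    have e1 : ω ∩ ((K ∪ L : Finset β) : Set β) ∩ K = ω ∩ K := by
      ext x; simp; tauto
    have e2 : (ω ∩ ((K ∪ L : Finset β) : Set β)) \ K ∩ L = ω \ K ∩ L := by
      ext x; simp; tauto
    have e3 := hL ((ω ∩ ((K ∪ L : Finset β) : Set β)) \ K)
    have e4 := hL (ω \ K)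
    rw [e2] at e3
    simp only [Set.mem_ofPred_eq, e1, ← e3, e4]
  -- Only the larger set `B` tends to all vertices; `W` stays fixed.
  refine le_of_tendsto_of_tendsto ((hμ.2 K A).const_mul _) (hμ.tendsto hne hlf h1) ?_
  filter_upwards [eventually_ge_atTop W] with B hB
  exact WiredUSF.ustProb_mul_le hne hlf hB hK hA hex h𝒰

end Limits

/-! ### Deterministic properties of hulls and of the exploration -/

section Hulls

variable {α β : Type*}

/-- The union of the components of `ω` which intersect `S`. -/
def hull (G : Graph α β) (ω : Set β) (S : Set V(G)) : Set V(G) :=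
  {x | ∃ s ∈ S, (spanningSubgraph G ω).Reachable s x}

/-- The vertices in `S` or adjacent to `S` by an edge in `L`. -/
def nbhd (G : Graph α β) (L : Set β) (S : Set V(G)) : Set V(G) :=
  S ∪ {y | ∃ e ∈ L, ∃ x ∈ S, G.IsLink e x y}

/-- The sets `𝒞_j` of `adjacentHull`, computed with the edges in `L` only. -/
def explored (G : Graph α β) (L ω : Set β) (v₀ : V(G)) : ℕ → Set V(G)
  | 0 => hull G (ω ∩ L) {v₀}
  | j + 1 => hull G (ω ∩ L) (nbhd G L (explored G L ω v₀ j))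

variable {G : Graph α β} {ω ω' L L' : Set β} {S S' : Set V(G)} {x y v₀ : V(G)} {j : ℕ}

lemma subset_hull : S ⊆ hull G ω S := fun x hx => ⟨x, hx, .refl x⟩

lemma subset_nbhd : S ⊆ nbhd G L S := Set.subset_union_left

lemma reachable_of_isLink {e : β} (he : e ∈ ω) (h : G.IsLink e x y) :
    (spanningSubgraph G ω).Reachable x y := by
  by_cases hxy : x = y
  · rw [hxy]
  · exact (spanningSubgraph_adj.2 ⟨hxy, e, he, h⟩).reachable

lemma mem_hull_of_isLink {e : β} (he : e ∈ ω) (h : G.IsLink e x y) (hx : x ∈ hull G ω S) :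
    y ∈ hull G ω S := by
  obtain ⟨s, hs, hr⟩ := hx
  exact ⟨s, hs, hr.trans (reachable_of_isLink he h)⟩

/-- The hull is the least set which contains `S` and is closed under the edges in `ω`. -/
lemma hull_subset_of {T : Set V(G)} (hST : S ⊆ T)
    (hT : ∀ e ∈ ω, ∀ x y : V(G), G.IsLink e x y → x ∈ T → y ∈ T) : hull G ω S ⊆ T := by
  have key : ∀ {a b : V(G)} (p : (spanningSubgraph G ω).Walk a b), a ∈ T → b ∈ T := by
    intro a b p
    induction p with
    | nil => exact id
    | cons h _ ih =>
      intro ha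
      obtain ⟨-, e, he, hl⟩ := spanningSubgraph_adj.1 h
      exact ih (hT e he _ _ hl ha)
  rintro x ⟨s, hs, ⟨p⟩⟩
  exact key p (hST hs)

lemma hull_mono (hω : ω ⊆ ω') (hS : S ⊆ S') : hull G ω S ⊆ hull G ω' S' :=
  hull_subset_of (hS.trans subset_hull) fun _ he _ _ h hx => mem_hull_of_isLink (hω he) h hx

lemma nbhd_mono (hL : L ⊆ L') (hS : S ⊆ S') : nbhd G L S ⊆ nbhd G L' S' := by
  rintro y (hy | ⟨e, he, x, hx, h⟩)
  · exact Or.inl (hS hy)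
  · exact Or.inr ⟨e, hL he, x, hS hx, h⟩

lemma explored_mono (hω : ω ⊆ ω') (hL : L ⊆ L') :
    explored G L ω v₀ j ⊆ explored G L' ω' v₀ j := by
  induction j with
  | zero => exact hull_mono (Set.inter_subset_inter hω hL) subset_rfl
  | succ j ih => exact hull_mono (Set.inter_subset_inter hω hL) (nbhd_mono hL ih)

lemma explored_subset_succ : explored G L ω v₀ j ⊆ explored G L ω v₀ (j + 1) :=
  subset_nbhd.trans subset_hull

lemma explored_mono_right {i : ℕ} (hij : i ≤ j) : explored G L ω v₀ i ⊆ explored G L ω v₀ j :=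
  monotone_nat_of_le_succ (f := explored G L ω v₀) (fun _ => explored_subset_succ) hij

lemma mem_explored_of_isLink {e : β} (he : e ∈ ω) (heL : e ∈ L) (h : G.IsLink e x y)
    (hx : x ∈ explored G L ω v₀ j) : y ∈ explored G L ω v₀ j := by
  cases j with
  | zero => exact mem_hull_of_isLink ⟨he, heL⟩ h hx
  | succ j => exact mem_hull_of_isLink ⟨he, heL⟩ h hx

/-- The edges in `L` with an end in `D`. -/
def edgesAt (G : Graph α β) (L : Set β) (D : Set V(G)) : Set β :=
  {e ∈ L | ∃ x ∈ D, G.Inc e x}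

/-- Growing the hull of `S` only queries edges with an end in the hull itself. -/
lemma hull_congr {D : Set V(G)} (hD : hull G (ω ∩ L) S ⊆ D)
    (h : ω' ∩ edgesAt G L D = ω ∩ edgesAt G L D) : hull G (ω' ∩ L) S = hull G (ω ∩ L) S := by
  have hmem : ∀ e ∈ L, ∀ x y : V(G), G.IsLink e x y → x ∈ hull G (ω ∩ L) S →
      (e ∈ ω' ↔ e ∈ ω) := by
    intro e he x y hl hx
    have heD : e ∈ edgesAt G L D := ⟨he, x, hD hx, hl.inc_left⟩
    have := Set.ext_iff.1 h e
    simp only [Set.mem_inter_iff, heD, and_true] at this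
    exact this
  apply Set.Subset.antisymm
  · refine hull_subset_of subset_hull fun e he x y hl hx => ?_
    exact mem_hull_of_isLink ⟨(hmem e he.2 x y hl hx).1 he.1, he.2⟩ hl hx
  · have : hull G (ω ∩ L) S ⊆ hull G (ω' ∩ L) S ∩ hull G (ω ∩ L) S := by
      refine hull_subset_of (fun s hs => ⟨subset_hull hs, subset_hull hs⟩) fun e he x y hl hx => ?_
      exact ⟨mem_hull_of_isLink ⟨(hmem e he.2 x y hl hx.2).2 he.1, he.2⟩ hl hx.1,
        mem_hull_of_isLink he hl hx.2⟩
    exact this.trans Set.inter_subset_left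

/-- The explored set is determined by the states of the edges which touch it. -/
lemma explored_congr (h : ω' ∩ edgesAt G L (explored G L ω v₀ j) =
    ω ∩ edgesAt G L (explored G L ω v₀ j)) : explored G L ω' v₀ j = explored G L ω v₀ j := by
  -- The stages before `j` lie inside stage `j`, so their queries are among the edges on which the
  -- two configurations agree.
  have key : ∀ i ≤ j, explored G L ω' v₀ i = explored G L ω v₀ i := by
    intro i hi
    induction i with
    | zero => exact hull_congr (explored_mono_right (i := 0) hi) h
    | succ i ih =>
      have ih := ih (Nat.le_of_succ_le hi)
      rw [explored, ih]
      exact hull_congr (explored_mono_right (i := i + 1) hi) h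
  exact key j le_rfl

/-- Passing through the edges at `D` can be replaced by starting from the neighbourhood of `D`. -/
lemma hull_subset_hull_nbhd {D : Set V(G)} {K : Set β} (hK : K ⊆ edgesAt G L' D) :
    hull G (ω ∩ L) D ⊆ hull G ((ω \ K) ∩ L) (nbhd G L' D) := by
  refine hull_subset_of (subset_nbhd.trans subset_hull) fun e he x y hl hx => ?_
  -- An edge of `K` has an end in `D`, so `y` lies in `D` or is joined to it by an edge of `L'`.
  by_cases heK : e ∈ K
  · obtain ⟨heL', z, hz, hez⟩ := hK heK
    rcases hez.eq_or_eq_of_isLink hl with h | h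
    · rw [Subtype.ext h] at hz
      exact subset_hull (Or.inr ⟨e, heL', x, hz, hl⟩)
    · rw [Subtype.ext h] at hz
      exact subset_hull (Or.inl hz)
  · exact mem_hull_of_isLink ⟨⟨he.1, heK⟩, he.2⟩ hl hx

/-- The increasing union of the hulls contains the starting points and is closed under every edge,
since one index serves for both the edge and the vertex. -/
lemma hull_iUnion {l : ℕ → Set β} {s : ℕ → Set V(G)} (hl : Monotone l) (hs : Monotone s) :
    hull G (⋃ n, l n) (⋃ n, s n) = ⋃ n, hull G (l n) (s n) := by
  apply Set.Subset.antisymm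
  · refine hull_subset_of (Set.iUnion_mono fun n => subset_hull) fun e he x y h hx => ?_
    obtain ⟨n, hn⟩ := Set.mem_iUnion.1 he
    obtain ⟨m, hm⟩ := Set.mem_iUnion.1 hx
    refine Set.mem_iUnion.2 ⟨max n m, mem_hull_of_isLink (hl (le_max_left n m) hn) h ?_⟩
    exact hull_mono (hl (le_max_right n m)) (hs (le_max_right n m)) hm
  · exact Set.iUnion_subset fun n => hull_mono (Set.subset_iUnion l n) (Set.subset_iUnion s n)

lemma hull_inter_edgeSet : hull G (ω ∩ E(G)) S = hull G ω S := by
  apply Set.Subset.antisymm (hull_mono Set.inter_subset_left subset_rfl)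
  exact hull_subset_of subset_hull fun e he x y h hx => mem_hull_of_isLink ⟨he, h.edge_mem⟩ h hx

lemma nbhd_iUnion {l : ℕ → Set β} {s : ℕ → Set V(G)} (hl : Monotone l) (hs : Monotone s) :
    nbhd G (⋃ n, l n) (⋃ n, s n) = ⋃ n, nbhd G (l n) (s n) := by
  apply Set.Subset.antisymm
  · rintro y (hy | ⟨e, he, x, hx, h⟩)
    · exact Set.iUnion_mono (fun n => subset_nbhd) hy
    · obtain ⟨n, hn⟩ := Set.mem_iUnion.1 he
      obtain ⟨m, hm⟩ := Set.mem_iUnion.1 hx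
      exact Set.mem_iUnion.2 ⟨max n m, Or.inr ⟨e, hl (le_max_left n m) hn, x,
        hs (le_max_right n m) hm, h⟩⟩
  · exact Set.iUnion_subset fun n => nbhd_mono (Set.subset_iUnion l n) (Set.subset_iUnion s n)

lemma explored_iUnion {l : ℕ → Set β} (hl : Monotone l) :
    explored G (⋃ n, l n) ω v₀ j = ⋃ n, explored G (l n) ω v₀ j := by
  have hl' : Monotone fun n => ω ∩ l n := fun a b hab => Set.inter_subset_inter subset_rfl (hl hab)
  induction j with
  | zero =>
    simp only [explored]
    rw [Set.inter_iUnion, ← hull_iUnion hl' monotone_const, Set.iUnion_const]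
  | succ j ih =>
    have hm : Monotone fun n => explored G (l n) ω v₀ j := fun a b hab =>
      explored_mono subset_rfl (hl hab)
    simp only [explored]
    rw [ih, Set.inter_iUnion, nbhd_iUnion hl hm, hull_iUnion hl' fun a b hab =>
      nbhd_mono (hl hab) (hm hab)]

lemma mem_component_iff : y ∈ component G ω x ↔ (spanningSubgraph G ω).Reachable x y := by
  rw [component, SimpleGraph.ConnectedComponent.mem_supp_iff, SimpleGraph.ConnectedComponent.eq]
  exact ⟨fun h => h.symm, fun h => h.symm⟩

lemma component_eq_hull : component G ω x = hull G ω {x} := by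
  ext y
  simp [mem_component_iff, hull]

lemma biUnion_supp_eq_hull (p : (spanningSubgraph G ω).ConnectedComponent → Prop) (S : Set V(G))
    (h : ∀ c, p c ↔ ∃ x ∈ c.supp, x ∈ S) : ⋃ c ∈ {c | p c}, c.supp = hull G ω S := by
  ext y
  simp only [Set.mem_iUnion, Set.mem_ofPred_eq, exists_prop, h, hull]
  constructor
  · rintro ⟨c, ⟨x, hx, hxS⟩, hy⟩
    exact ⟨x, hxS, c.reachable_of_mem_supp hx hy⟩
  · rintro ⟨s, hs, hsy⟩
    exact ⟨(spanningSubgraph G ω).connectedComponentMk y, ⟨s,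
      SimpleGraph.ConnectedComponent.eq.2 hsy, hs⟩, rfl⟩

lemma successiveHull_succ (v₀ : V(G)) (j : ℕ) (ω : Fin (j + 2) → Set β) :
    successiveHull G v₀ (j + 1) ω =
      hull G (ω (Fin.last (j + 1))) (successiveHull G v₀ j fun i => ω i.castSucc) :=
  biUnion_supp_eq_hull _ _ fun _ => Iff.rfl

/-- A component contained in or adjacent to `𝒞_j` meets the neighbourhood of `𝒞_j`. Conversely, a
component meeting `𝒞_j` is contained in it, because `𝒞_j` is closed under the edges of `ω`. -/
lemma adjacentHull_eq_explored : adjacentHull G ω v₀ j = explored G E(G) ω v₀ j := by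
  induction j with
  | zero => rw [explored, hull_inter_edgeSet]; exact component_eq_hull
  | succ j ih =>
    rw [adjacentHull, explored, hull_inter_edgeSet, ih]
    have hclosed : ∀ c : (spanningSubgraph G ω).ConnectedComponent, ∀ x ∈ c.supp,
        x ∈ explored G E(G) ω v₀ j → c.supp ⊆ explored G E(G) ω v₀ j := by
      intro c x hx hxD y hy
      refine hull_subset_of (S := {x}) (by simpa using hxD) (fun e he a b hl ha => ?_)
        ⟨x, rfl, c.reachable_of_mem_supp hx hy⟩
      exact mem_explored_of_isLink he hl.edge_mem hl ha
    refine biUnion_supp_eq_hull _ _ fun c => ?_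
    constructor
    · rintro (h | ⟨x, hx, y, hy, e, he⟩)
      · obtain ⟨x, hx⟩ := c.nonempty_supp
        exact ⟨x, hx, Or.inl (h hx)⟩
      · exact ⟨x, hx, Or.inr ⟨e, he.edge_mem, y, hy, he.symm⟩⟩
    · rintro ⟨x, hx, hxD | ⟨e, -, y, hy, he⟩⟩
      · exact Or.inl (hclosed c x hx hxD)
      · exact Or.inr ⟨x, hx, y, hy, e, he.symm⟩

end Hulls

/-! ### Exhaustions by finite sets of vertices and of edges -/

section Exhaustion

variable {α β : Type*}

/-- A connected locally finite graph has an exhaustion by finite vertex sets. -/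
lemma exists_vertex_exhaustion {G : Graph α β} (hconn : Connected G) (hlf : LocallyFinite G)
    (v₀ : V(G)) : ∃ w : ℕ → Set α, Monotone w ∧ (∀ n, (w n).Finite) ∧ V(G) ⊆ ⋃ n, w n := by
  -- These are the balls around `v₀`: finite by local finiteness, covering by connectedness.
  let w : ℕ → Set α := fun n => Nat.rec {v₀.1} (fun _ s => s ∪ {y | ∃ x ∈ s, G.Adj x y}) n
  have hw : ∀ n, w (n + 1) = w n ∪ {y | ∃ x ∈ w n, G.Adj x y} := fun n => rfl
  refine ⟨w, monotone_nat_of_le_succ fun n => ?_, fun n => ?_, ?_⟩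
  · rw [hw]; exact Set.subset_union_left
  · induction n with
    | zero => exact Set.finite_singleton _
    | succ n ih =>
      rw [hw]
      refine ih.union ?_
      have : {y | ∃ x ∈ w n, G.Adj x y} ⊆ ⋃ e ∈ touchSet G (w n), {y | G.Inc e y} := by
        rintro y ⟨x, hx, e, he⟩
        exact Set.mem_biUnion (show e ∈ touchSet G (w n) from ⟨x, hx, he.inc_left⟩) he.inc_right
      refine Set.Finite.subset ((finite_touchSet hlf ih).biUnion fun e he => ?_) this
      obtain ⟨x, y, hxy⟩ := Graph.exists_isLink_of_mem_edgeSet (touchSet_subset G _ he)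
      refine Set.Finite.subset (Set.toFinite {x, y}) fun z hz => ?_
      exact hz.eq_or_eq_of_isLink hxy
  · intro x hx
    have hreach := hconn.preconnected v₀ ⟨x, hx⟩
    have key : ∀ {a b : V(G)} (p : G.toSimpleGraph.Walk a b), a.1 ∈ ⋃ n, w n → b.1 ∈ ⋃ n, w n := by
      intro a b p
      induction p with
      | nil => exact id
      | cons h _ ih =>
        intro ha
        obtain ⟨n, hn⟩ := Set.mem_iUnion.1 ha
        refine ih (Set.mem_iUnion.2 ⟨n + 1, ?_⟩)
        rw [hw]
        have h : G.Adj _ _ := ((Graph.toSimpleGraph_adj G _ _).mp h).2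
        exact Or.inr ⟨_, hn, h⟩
    obtain ⟨p⟩ := hreach
    exact key p (Set.mem_iUnion.2 ⟨0, rfl⟩)

/-- A connected locally finite graph has an exhaustion by finite sets of edges. -/
lemma exists_edge_exhaustion {G : Graph α β} (hconn : Connected G) (hlf : LocallyFinite G)
    (v₀ : V(G)) : ∃ l : ℕ → Finset β, Monotone l ∧ ⋃ n, (l n : Set β) = E(G) := by
  obtain ⟨w, hw, hfin, hV⟩ := exists_vertex_exhaustion hconn hlf v₀
  refine ⟨fun n => (finite_touchSet hlf (hfin n)).toFinset, fun a b hab => ?_, ?_⟩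
  · rw [Set.Finite.toFinset_subset_toFinset]
    rintro e ⟨x, hx, h⟩
    exact ⟨x, hw hab hx, h⟩
  · simp only [Set.Finite.coe_toFinset]
    refine (Set.iUnion_subset fun n => touchSet_subset G _).antisymm fun e he => ?_
    obtain ⟨x, y, hxy⟩ := Graph.exists_isLink_of_mem_edgeSet he
    obtain ⟨n, hn⟩ := Set.mem_iUnion.1 (hV hxy.left_mem)
    exact Set.mem_iUnion.2 ⟨n, x, hn, hxy.inc_left⟩

lemma countable_vertexSet {G : Graph α β} (hconn : Connected G) (hlf : LocallyFinite G)
    (v₀ : V(G)) : Countable V(G) := by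
  obtain ⟨w, _, hfin, hV⟩ := exists_vertex_exhaustion hconn hlf v₀
  exact (Set.Countable.mono hV (Set.countable_iUnion fun n => (hfin n).countable)).to_subtype

lemma exists_subset_of_exhaustion {X : Type*} {l : ℕ → Finset X} (hl : Monotone l) {K : Set X}
    (hfin : K.Finite) (hK : K ⊆ ⋃ n, (l n : Set X)) : ∃ n, K ⊆ l n := by
  induction K, hfin using Set.Finite.induction_on with
  | empty => exact ⟨0, Set.empty_subset _⟩
  | @insert a K _ _ ih =>
    rw [Set.insert_subset_iff] at hK
    obtain ⟨n, hn⟩ := ih hK.2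
    obtain ⟨m, hm⟩ := Set.mem_iUnion.1 hK.1
    refine ⟨max n m, Set.insert_subset (hl (le_max_right n m) hm) ?_⟩
    exact hn.trans (Finset.coe_subset.2 (hl (le_max_left n m)))

end Exhaustion

/-! ### One exploration step against a fresh sample, up to an error -/

section OneStep

variable {α β : Type*} {G : Graph α β}

/-- The event that the components of `ω ∩ r` which intersect `S` form a set in `𝒰`. -/
def hullEvent (G : Graph α β) (r : Set β) (𝒰 : Set (Set V(G))) (S : Set V(G)) : Set (Set β) :=
  {ω | hull G (ω ∩ r) S ∈ 𝒰}

lemma dependsOnlyOn_hullEvent (r : Finset β) (𝒰 : Set (Set V(G))) (S : Set V(G)) :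
    DependsOnlyOn (· ∈ hullEvent G r 𝒰 S) r := by
  intro ω
  simp only [hullEvent, Set.mem_ofPred_eq, Set.inter_assoc, Set.inter_self]

lemma isUpperSet_hullEvent (r : Set β) {𝒰 : Set (Set V(G))} (h𝒰 : IsUpperSet 𝒰) (S : Set V(G)) :
    IsUpperSet (hullEvent G r 𝒰 S) := fun _ _ h hω =>
  h𝒰 (hull_mono (Set.inter_subset_inter_left _ h) subset_rfl) hω

lemma hullEvent_mono (r : Set β) {𝒰 : Set (Set V(G))} (h𝒰 : IsUpperSet 𝒰) {S S' : Set V(G)}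
    (h : S ⊆ S') : hullEvent G r 𝒰 S ⊆ hullEvent G r 𝒰 S' := fun _ hω =>
  h𝒰 (hull_mono subset_rfl h) hω

/-- The vertices which have an influence on whether the hull with respect to edges in `r` belongs
to an event depending on the vertices in `M` only. -/
lemma exists_dependsOnlyOn_hullEvent {M : Finset V(G)} {𝒰 : Set (Set V(G))}
    (hM : DependsOnlyOn (· ∈ 𝒰) M) (r : Finset β) :
    ∃ M' : Finset V(G), DependsOnlyOn (hullEvent G r 𝒰) M' := by
  classical
  have hfin : {x : V(G) | ∃ e ∈ r, G.Inc e x}.Finite := by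
    have : {x : V(G) | ∃ e ∈ r, G.Inc e x} = ⋃ e ∈ r, {x : V(G) | G.Inc e x} := by
      ext; simp
    rw [this]
    refine r.finite_toSet.biUnion fun e _ => ?_
    by_cases he : e ∈ E(G)
    · obtain ⟨x, y, hxy⟩ := Graph.exists_isLink_of_mem_edgeSet he
      refine Set.Finite.of_finite_image (f := Subtype.val) ?_ Subtype.val_injective.injOn
      refine Set.Finite.subset (Set.toFinite {x, y}) ?_
      rintro _ ⟨z, hz, rfl⟩
      exact Graph.Inc.eq_or_eq_of_isLink hz hxy
    · convert Set.finite_empty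
      ext x
      simp only [Set.mem_ofPred_eq, Set.mem_empty_iff_false, iff_false]
      exact fun h => he h.edge_mem
  refine ⟨M ∪ hfin.toFinset, fun S => ?_⟩
  ext ω
  -- A point of `S` outside `M` and off the edges of `r` contributes only itself to the hull, and
  -- `𝒰` does not see it.
  have key : hull G (ω ∩ r) S ∩ M =
      hull G (ω ∩ r) (S ∩ ((M ∪ hfin.toFinset : Finset V(G)) : Set V(G))) ∩ M := by
    apply Set.Subset.antisymm
    · rintro x ⟨hx, hxM⟩
      refine ⟨?_, hxM⟩
      have : hull G (ω ∩ r) S ⊆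
          hull G (ω ∩ r) (S ∩ ((M ∪ hfin.toFinset : Finset V(G)) : Set V(G))) ∪
            (S \ ((M ∪ hfin.toFinset : Finset V(G)) : Set V(G))) := by
        refine hull_subset_of (fun s hs => ?_) fun e he a b hl ha => ?_
        · by_cases hsM : s ∈ ((M ∪ hfin.toFinset : Finset V(G)) : Set V(G))
          · exact Or.inl (subset_hull ⟨hs, hsM⟩)
          · exact Or.inr ⟨hs, hsM⟩
        · rcases ha with ha | ⟨_, ha⟩
          · exact Or.inl (mem_hull_of_isLink he hl ha)
          · refine absurd ?_ ha
            refine Finset.mem_coe.2 (Finset.mem_union_right _ ?_)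
            rw [Set.Finite.mem_toFinset]
            exact ⟨e, he.2, hl.inc_left⟩
      rcases this hx with h | h
      · exact h
      · exact absurd (Finset.mem_coe.2 (Finset.mem_union_left _ hxM)) h.2
    · exact Set.inter_subset_inter_left _ (hull_mono subset_rfl Set.inter_subset_left)
  have h1 := hM (hull G (ω ∩ r) S)
  have h2 := hM (hull G (ω ∩ r) (S ∩ ((M ∪ hfin.toFinset : Finset V(G)) : Set V(G))))
  rw [key] at h1
  simp only [eq_iff_iff] at h1 h2
  exact h2.symm.trans h1

variable {μ : Measure (Set β)}

lemma explored_dependsOnlyOn (R : Finset β) (v₀ : V(G)) (j : ℕ) :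
    DependsOnlyOn (fun ω => explored G R ω v₀ j) R := by
  intro ω
  refine explored_congr ?_
  ext e
  simp only [Set.mem_inter_iff, edgesAt, Set.mem_ofPred_eq]
  tauto

/-- The space is partitioned by the outcome of the exploration within `R`. On each cell,
`IsWiredUSF.ustProb_mul_le` compares the unqueried part of the forest with the tree of `wire G W`,
which stands in for the fresh sample at a cost of `ε`. Summing over the cells gives the integral. -/
lemma integral_le_measureReal_add (hne : V(G).Nonempty) (hlf : LocallyFinite G)
    (hμ : IsWiredUSF G μ) (v₀ : V(G)) (j : ℕ) {𝒰 : Set (Set V(G))} (h𝒰 : IsUpperSet 𝒰)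
    {r R : Finset β} (hrR : r ⊆ R) (hR : (R : Set β) ⊆ E(G)) {W : Finset α}
    (hW : touchSet G W ⊆ R) {ε : ℝ} (hε : ∀ 𝒜 : Set (Set β), DependsOnlyOn (· ∈ 𝒜) r →
      μ.real 𝒜 ≤ ustProb (wire G W) 𝒜 + ε) :
    ∫ ω, μ.real (hullEvent G r 𝒰 (explored G R ω v₀ j)) ∂μ ≤
      μ.real {ω | explored G E(G) ω v₀ (j + 1) ∈ 𝒰} + ε := by
  classical
  have := hμ.1
  -- the cells of the partition according to the explored edges and their states
  let D : Set β → Set V(G) := fun ω => explored G R ω v₀ j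
  let K : Set β → Finset β := fun ω => R.filter fun e => e ∈ edgesAt G R (D ω)
  have hK : ∀ ω, (K ω : Set β) = edgesAt G R (D ω) := by
    intro ω
    ext e
    simp only [K, Finset.coe_filter, Set.mem_ofPred_eq]
    exact ⟨fun h => h.2, fun h => ⟨h.1, h⟩⟩
  have hKE : ∀ ω, (K ω : Set β) ⊆ E(G) := fun ω =>
    (Finset.coe_subset.2 (Finset.filter_subset _ _)).trans hR
  have hcongr : ∀ ω ω' : Set β, ω' ∩ K ω = ω ∩ K ω → D ω' = D ω := by
    intro ω ω' h
    rw [hK] at h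
    exact explored_congr h
  -- `A` is a possible outcome exactly when exploring the configuration `A` itself queries all of
  -- `A`; it then represents its own cell.
  let I : Finset (Finset β) := R.powerset.filter fun A => A ⊆ K A
  let cell : Finset β → Set (Set β) := fun A => {ω | ω ∩ K A = A}
  have hcellD : ∀ A ∈ I, ∀ ω ∈ cell A, D ω = D A := by
    intro A hA ω hω
    refine hcongr A ω ?_
    rw [show ω ∩ K A = A from hω, Set.inter_eq_left.2]
    exact Finset.coe_subset.2 (Finset.mem_filter.1 hA).2
  have hcellK : ∀ A ∈ I, ∀ ω ∈ cell A, K ω = K A := by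
    intro A hA ω hω
    simp only [K, hcellD A hA ω hω]
  have hcover : ∀ ω, ∃ A ∈ I, ω ∈ cell A := by
    intro ω
    obtain ⟨A, hA⟩ := ((K ω).finite_toSet.inter_of_right ω).exists_finset_coe
    have hAK : A ⊆ K ω := by
      rw [← Finset.coe_subset, hA]; exact Set.inter_subset_right
    have hD : D A = D ω := by
      refine hcongr ω A ?_
      rw [hA, Set.inter_assoc, Set.inter_self]
    have hKA : K A = K ω := by simp only [K, hD]
    refine ⟨A, Finset.mem_filter.2 ⟨Finset.mem_powerset.2 (hAK.trans (Finset.filter_subset _ _)),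
      hKA ▸ hAK⟩, ?_⟩
    change ω ∩ K A = A
    rw [hKA, hA]
  have hdisj : ∀ A ∈ I, ∀ A' ∈ I, ∀ ω, ω ∈ cell A → ω ∈ cell A' → A = A' := by
    intro A hA A' hA' ω h h'
    have h1 : ω ∩ K A = A := h
    have h2 : ω ∩ K A' = A' := h'
    rw [← hcellK A hA ω h] at h1
    rw [← hcellK A' hA' ω h', h1] at h2
    exact_mod_cast h2
  have hcellmeas : ∀ A, MeasurableSet (cell A) := fun A => measurableSet_inter_eq _ _
  let g : Set V(G) → ℝ := fun S => μ.real (hullEvent G r 𝒰 S)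
  let C : Finset β → Set (Set β) := fun A =>
    {ω | ω ∩ K A = A ∧ ω \ K A ∈ hullEvent G r 𝒰 (nbhd G R (D A))}
  have hint : ∫ ω, g (D ω) ∂μ = ∑ A ∈ I, μ.real (cell A) * g (D A) := by
    have h1 : ∀ ω, g (D ω) = ∑ A ∈ I, (cell A).indicator (fun _ => g (D A)) ω := by
      intro ω
      obtain ⟨A, hA, hω⟩ := hcover ω
      rw [Finset.sum_eq_single_of_mem A hA, Set.indicator_of_mem hω, hcellD A hA ω hω]
      intro A' hA' hne
      rw [Set.indicator_of_notMem]
      exact fun h => hne (hdisj A' hA' A hA ω h hω)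
    rw [integral_congr_ae (ae_of_all _ h1), integral_finsetSum]
    · refine Finset.sum_congr rfl fun A _ => ?_
      rw [integral_indicator_const _ (hcellmeas A), smul_eq_mul]
    · exact fun A _ => (integrable_const _).indicator (hcellmeas A)
  have hC : ∀ A ∈ I, μ.real (cell A) * (g (D A) - ε) ≤ μ.real (C A) := by
    intro A hA
    have hAK : A ⊆ K A := (Finset.mem_filter.1 hA).2
    have h1 : ustProb (wire G W) {T | T \ K A ∈ hullEvent G r 𝒰 (nbhd G R (D A))} *
        μ.real (cell A) ≤ μ.real (C A) := by
      refine hμ.ustProb_mul_le hne hlf (hKE _) hAK ?_ (isUpperSet_hullEvent _ h𝒰 _)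
        (dependsOnlyOn_hullEvent r 𝒰 _)
      -- Both ends of a queried open edge lie in `D A`. If the end `x` is in `W`, all its edges are
      -- in `R` by `hW`, hence they are queried.
      intro e he x hx hex f hf
      have heK : e ∈ edgesAt G R (D A) := by rw [← hK]; exact hAK he
      obtain ⟨heR, z, hz, hez⟩ := heK
      have hxD : (⟨x, hex.vertex_mem⟩ : V(G)) ∈ D A := by
        obtain ⟨y, hl⟩ := hez
        rcases hex.eq_or_eq_of_isLink hl with h | h
        · convert hz
        · have : (⟨y, hl.right_mem⟩ : V(G)) ∈ D A :=
            mem_explored_of_isLink (x := z) (y := ⟨y, hl.right_mem⟩) he heR hl hz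
          convert this
      rw [hK]
      exact ⟨hW ⟨x, hx, hf⟩, _, hxD, hf⟩
    -- Starting from the neighbourhood makes up for the removal of `K A`, and `ε` pays for replacing
    -- `μ` by the tree of `wire G W`.
    have h2 : g (D A) - ε ≤
        ustProb (wire G W) {T | T \ K A ∈ hullEvent G r 𝒰 (nbhd G R (D A))} := by
      have hsub : hullEvent G r 𝒰 (D A) ⊆
          {T | T \ K A ∈ hullEvent G r 𝒰 (nbhd G R (D A))} := by
        intro T hT
        exact h𝒰 (hull_subset_hull_nbhd (hK A).subset) hT
      have h3 := hε (hullEvent G r 𝒰 (D A)) (dependsOnlyOn_hullEvent r 𝒰 _)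
      have h4 : ustProb (wire G W) (hullEvent G r 𝒰 (D A)) ≤
          ustProb (wire G W) {T | T \ K A ∈ hullEvent G r 𝒰 (nbhd G R (D A))} := by
        unfold ustProb
        refine div_le_div_of_nonneg_right (Nat.cast_le.2 (Set.ncard_le_ncard ?_ ?_))
          (Nat.cast_nonneg _)
        · exact fun T hT => ⟨hT.1, hsub hT.2⟩
        · refine Set.Finite.subset (finite_touchSet hlf W.finite_toSet).finite_subsets ?_
          exact fun T hT => hT.1.subset_touchSet
      change μ.real (hullEvent G r 𝒰 (D A)) - ε ≤ _
      linarith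
    calc μ.real (cell A) * (g (D A) - ε) ≤ _ := mul_le_mul_of_nonneg_left h2 measureReal_nonneg
      _ ≤ μ.real (C A) := by rw [mul_comm]; exact h1
  -- On `C A` the set explored within `R` is `D A`, so the hull of its neighbourhood by unqueried
  -- edges is part of the next stage of the full exploration.
  have hCsum : ∑ A ∈ I, μ.real (C A) ≤ μ.real {ω | explored G E(G) ω v₀ (j + 1) ∈ 𝒰} := by
    rw [← measureReal_biUnion_finset]
    · refine measureReal_mono ?_
      intro ω hω
      obtain ⟨A, hA, h1, h2⟩ := by simpa only [Set.mem_iUnion, exists_prop] using hω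
      refine h𝒰 ?_ h2
      have hD := hcellD A hA ω h1
      rw [← hD]
      refine hull_mono ?_ (nbhd_mono hR (explored_mono subset_rfl hR))
      exact fun e he => ⟨he.1.1, hR (hrR he.2)⟩
    · intro A hA A' hA' hne
      exact Set.disjoint_left.2 fun ω h h' => hne (hdisj A hA A' hA' ω h.1 h'.1)
    · intro A _
      refine (hcellmeas A).inter ?_
      have hd : DependsOnlyOn (fun ω : Set β => ω ∈ {ω : Set β | ω \ K A ∈
          hullEvent G r 𝒰 (nbhd G R (D A))}) r := by
        intro ω
        have e1 := dependsOnlyOn_hullEvent r 𝒰 (nbhd G R (D A)) ((ω ∩ r) \ K A)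
        have e2 := dependsOnlyOn_hullEvent r 𝒰 (nbhd G R (D A)) (ω \ K A)
        have e3 : ((ω ∩ r) \ K A) ∩ r = (ω \ K A) ∩ r := by ext x; simp; tauto
        rw [e3] at e1
        simp only [Set.mem_ofPred_eq, ← e1, e2]
      exact hd.measurableSet
  have hone : ∑ A ∈ I, μ.real (cell A) = 1 := by
    rw [← measureReal_biUnion_finset]
    · have : ⋃ A ∈ I, cell A = Set.univ := by
        rw [Set.eq_univ_iff_forall]
        intro ω
        obtain ⟨A, hA, h⟩ := hcover ω
        exact Set.mem_biUnion (Finset.mem_coe.2 hA) h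
      rw [this, probReal_univ]
    · intro A hA A' hA' hne
      exact Set.disjoint_left.2 fun ω h h' => hne (hdisj A hA A' hA' ω h h')
    · exact fun A _ => hcellmeas A
  have hsum := Finset.sum_le_sum hC
  simp only [mul_sub, Finset.sum_sub_distrib] at hsum
  rw [← Finset.sum_mul, hone, ← hint, one_mul] at hsum
  change ∫ ω, g (D ω) ∂μ ≤ _
  linarith

end OneStep

/-! ### Domination on local increasing events -/

section Domination

variable {α β : Type*} {G : Graph α β}

/-- As `M` is finite, some `s n` already contains the part of the union in `M`. -/
lemma mem_iUnion_iff_of_isUpperSet {X : Type*} {𝒰 : Set (Set X)} (h𝒰 : IsUpperSet 𝒰)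
    {M : Finset X} (hM : DependsOnlyOn (· ∈ 𝒰) M) {s : ℕ → Set X} (hs : Monotone s) :
    ⋃ n, s n ∈ 𝒰 ↔ ∃ n, s n ∈ 𝒰 := by
  constructor
  · intro h
    have key : ∀ K : Finset X, ∃ n, (⋃ n, s n) ∩ K ⊆ s n := by
      classical
      intro K
      induction K using Finset.induction_on with
      | empty => exact ⟨0, by simp⟩
      | insert a K _ ih =>
        obtain ⟨n, hn⟩ := ih
        by_cases ha : a ∈ ⋃ n, s n
        · obtain ⟨m, hm⟩ := Set.mem_iUnion.1 ha
          refine ⟨max n m, ?_⟩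
          rintro x ⟨hx, hxK⟩
          rcases Finset.mem_insert.1 (Finset.mem_coe.1 hxK) with rfl | hxK
          · exact hs (le_max_right n m) hm
          · exact hs (le_max_left n m) (hn ⟨hx, hxK⟩)
        · refine ⟨n, ?_⟩
          rintro x ⟨hx, hxK⟩
          rcases Finset.mem_insert.1 (Finset.mem_coe.1 hxK) with rfl | hxK
          · exact absurd hx ha
          · exact hn ⟨hx, hxK⟩
    obtain ⟨n, hn⟩ := key M
    refine ⟨n, h𝒰 hn ?_⟩
    have := hM (⋃ n, s n)
    simp only [eq_iff_iff] at this
    exact this.2 h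
  · rintro ⟨n, hn⟩
    exact h𝒰 (Set.subset_iUnion s n) hn

/-- Reachability is a countable union, over starting points and finite edge sets, of local events.
-/
lemma measurable_hull_of_exhaustion [Countable V(G)] {l : ℕ → Finset β} (hl : Monotone l)
    (hE : ⋃ n, (l n : Set β) = E(G)) :
    Measurable fun p : Set β × Set V(G) => hull G p.1 p.2 := by
  rw [measurable_set_iff]
  intro x
  have h : ∀ p : Set β × Set V(G), x ∈ hull G p.1 p.2 ↔
      ∃ n, ∃ s : V(G), s ∈ p.2 ∧ p.1 ∈ {ω : Set β | (spanningSubgraph G (ω ∩ l n)).Reachable s x} := by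
    intro p
    have hl' : Monotone fun n => p.1 ∩ (l n : Set β) := fun a b hab =>
      Set.inter_subset_inter_right _ (Finset.coe_subset.2 (hl hab))
    rw [← hull_inter_edgeSet, ← hE, Set.inter_iUnion, ← Set.iUnion_const (ι := ℕ) p.2,
      hull_iUnion hl' monotone_const]
    simp [hull]
  simp only [h]
  refine Measurable.exists fun n => Measurable.exists fun s => Measurable.and ?_ ?_
  · exact (measurable_set_mem s).comp measurable_snd
  · have hd : DependsOnlyOn (fun ω : Set β => ω ∈ {ω : Set β |
        (spanningSubgraph G (ω ∩ l n)).Reachable s x}) (l n) := by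
      intro ω
      simp only [Set.mem_ofPred_eq, Set.inter_assoc, Set.inter_self]
    exact hd.measurable.comp measurable_fst

lemma measurable_hull (hconn : Connected G) (hlf : LocallyFinite G) (v₀ : V(G)) :
    Measurable fun p : Set β × Set V(G) => hull G p.1 p.2 := by
  have := countable_vertexSet hconn hlf v₀
  obtain ⟨l, hl, hE⟩ := exists_edge_exhaustion hconn hlf v₀
  exact measurable_hull_of_exhaustion hl hE

lemma measurable_nbhd (hconn : Connected G) (hlf : LocallyFinite G) (v₀ : V(G)) :
    Measurable fun S : Set V(G) => nbhd G E(G) S := by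
  have := countable_vertexSet hconn hlf v₀
  rw [measurable_set_iff]
  intro y
  have h : ∀ S : Set V(G), y ∈ nbhd G E(G) S ↔ y ∈ S ∨ ∃ x : V(G), x ∈ S ∧ G.Adj x y := by
    intro S
    refine or_congr_right ?_
    constructor
    · rintro ⟨e, _, x, hx, h⟩
      exact ⟨x, hx, e, h⟩
    · rintro ⟨x, hx, e, h⟩
      exact ⟨e, h.edge_mem, x, hx, h⟩
  simp only [h]
  exact (measurable_set_mem y).or (Measurable.exists fun x =>
    (measurable_set_mem x).and measurable_const)

lemma measurable_explored (hconn : Connected G) (hlf : LocallyFinite G) (v₀ : V(G)) (j : ℕ) :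
    Measurable fun ω => explored G E(G) ω v₀ j := by
  have h := measurable_hull hconn hlf v₀
  induction j with
  | zero =>
    simp only [explored, hull_inter_edgeSet]
    exact h.comp (measurable_id.prodMk measurable_const)
  | succ j ih =>
    simp only [explored, hull_inter_edgeSet]
    exact h.comp (measurable_id.prodMk ((measurable_nbhd hconn hlf v₀).comp ih))

lemma measurable_successiveHull (hconn : Connected G) (hlf : LocallyFinite G) (v₀ : V(G))
    (j : ℕ) : Measurable fun ω : Fin (j + 1) → Set β => successiveHull G v₀ j ω := by
  have h := measurable_hull hconn hlf v₀
  induction j with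
  | zero =>
    have : (fun ω : Fin 1 → Set β => successiveHull G v₀ 0 ω) = fun ω => hull G (ω 0) {v₀} :=
      funext fun ω => component_eq_hull
    rw [this]
    have h0 : Measurable fun ω : Fin 1 → Set β => ω 0 := measurable_pi_apply (0 : Fin 1)
    exact h.comp (h0.prodMk measurable_const)
  | succ j ih =>
    simp only [successiveHull_succ]
    have h0 : ∀ i : Fin (j + 2), Measurable fun ω : Fin (j + 2) → Set β => ω i := fun i =>
      measurable_pi_apply i
    have h1 : Measurable fun (ω : Fin (j + 2) → Set β) (i : Fin (j + 1)) => ω i.castSucc :=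
      measurable_pi_iff.2 fun i => h0 i.castSucc
    exact h.comp ((h0 (Fin.last (j + 1))).prodMk (ih.comp h1))

variable {μ : Measure (Set β)}

/-- Given the explored set `D` of `j` steps, the next step dominates the union of the components,
in an independent sample, which intersect `D`. -/
theorem integral_hullEvent_le (hconn : Connected G) (hlf : LocallyFinite G)
    (hμ : IsWiredUSF G μ) (v₀ : V(G)) (j : ℕ) {𝒰 : Set (Set V(G))} (h𝒰 : IsUpperSet 𝒰)
    {M : Finset V(G)} (hM : DependsOnlyOn (· ∈ 𝒰) M) {r : Finset β} (hr : (r : Set β) ⊆ E(G)) :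
    ∫ ω, μ.real (hullEvent G r 𝒰 (explored G E(G) ω v₀ j)) ∂μ ≤
      μ.real {ω | explored G E(G) ω v₀ (j + 1) ∈ 𝒰} := by
  have := hμ.1
  have hne : V(G).Nonempty := ⟨v₀, v₀.2⟩
  obtain ⟨l, hl, hE⟩ := exists_edge_exhaustion hconn hlf v₀
  have hl' : Monotone fun n => (l n : Set β) := fun a b hab => Finset.coe_subset.2 (hl hab)
  -- The integrand sees the explored set only in the finite set `M'`, so for each `ω` it is
  -- eventually constant in `n`; dominated convergence applies.
  obtain ⟨M', hM'⟩ := exists_dependsOnlyOn_hullEvent hM r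
  have hlim : Tendsto (fun n => ∫ ω, μ.real (hullEvent G r 𝒰 (explored G (l n) ω v₀ j)) ∂μ) atTop
      (𝓝 (∫ ω, μ.real (hullEvent G r 𝒰 (explored G E(G) ω v₀ j)) ∂μ)) := by
    refine tendsto_integral_of_dominated_convergence (fun _ => 1) ?_ (integrable_const _) ?_ ?_
    · intro n
      have : DependsOnlyOn (fun ω => μ.real (hullEvent G r 𝒰 (explored G (l n) ω v₀ j))) (l n) :=
        fun ω => congrArg (fun S => μ.real (hullEvent G r 𝒰 S))
          (explored_dependsOnlyOn (l n) v₀ j ω)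
      exact this.measurable.aestronglyMeasurable
    · intro n
      refine ae_of_all _ fun ω => ?_
      rw [Real.norm_of_nonneg measureReal_nonneg]
      exact measureReal_le_one
    · refine ae_of_all _ fun ω => ?_
      have hev : ∀ᶠ n in atTop, ∀ x ∈ M', (x ∈ explored G (l n) ω v₀ j ↔
          x ∈ explored G E(G) ω v₀ j) := by
        rw [eventually_all_finset]
        intro x _
        by_cases hx : x ∈ explored G E(G) ω v₀ j
        · rw [← hE, explored_iUnion hl'] at hx
          obtain ⟨n, hn⟩ := Set.mem_iUnion.1 hx
          filter_upwards [eventually_ge_atTop n] with k hk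
          refine iff_of_true (explored_mono subset_rfl (hl' hk) hn) ?_
          rw [← hE, explored_iUnion hl']; exact hx
        · refine Eventually.of_forall fun n => iff_of_false (fun h => hx ?_) hx
          refine explored_mono subset_rfl ?_ h
          rw [← hE]; exact Set.subset_iUnion (fun n => (l n : Set β)) n
      refine tendsto_const_nhds.congr' ?_
      filter_upwards [hev] with n hn
      rw [← hM' (explored G E(G) ω v₀ j), ← hM' (explored G (l n) ω v₀ j)]
      congr 2
      ext x
      simp only [Set.mem_inter_iff, Finset.mem_coe]
      exact ⟨fun h => ⟨(hn x h.2).2 h.1, h.2⟩, fun h => ⟨(hn x h.2).1 h.1, h.2⟩⟩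
  -- The order of choices matters: `r` and `ε` are given, then `W` makes the tree accurate on `r`,
  -- and then `R = l n` must contain `r` and all edges touching `W`.
  refine le_of_forall_pos_le_add fun ε hε => ?_
  obtain ⟨W, hW⟩ := (hμ.eventually_le hne hlf r hε).exists
  obtain ⟨n₁, hn₁⟩ := exists_subset_of_exhaustion hl (finite_touchSet hlf W.finite_toSet)
    (hE ▸ touchSet_subset G W)
  obtain ⟨n₂, hn₂⟩ := exists_subset_of_exhaustion hl r.finite_toSet (hE ▸ hr)
  refine le_of_tendsto hlim ?_
  filter_upwards [eventually_ge_atTop n₁, eventually_ge_atTop n₂] with n h1 h2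
  refine integral_le_measureReal_add hne hlf hμ v₀ j h𝒰 ?_ ?_ (hn₁.trans (hl' h1)) hW
  · exact Finset.coe_subset.1 (hn₂.trans (hl' h2))
  · rw [← hE]; exact Set.subset_iUnion (fun n => (l n : Set β)) n

/-- A nonnegative function whose tails are larger has a larger integral. -/
lemma integral_le_integral_of_measureReal_lt_le {Ω Ω' : Type*} [MeasurableSpace Ω]
    [MeasurableSpace Ω'] {P : Measure Ω} {P' : Measure Ω'} [IsFiniteMeasure P] [IsFiniteMeasure P']
    {f : Ω → ℝ} {f' : Ω' → ℝ} (hf : Integrable f P) (hf' : Integrable f' P')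
    (hmf : Measurable f) (hmf' : Measurable f') (hf0 : ∀ x, 0 ≤ f x) (hf0' : ∀ x, 0 ≤ f' x)
    (h : ∀ t, P'.real {x | t < f' x} ≤ P.real {x | t < f x}) :
    ∫ x, f' x ∂P' ≤ ∫ x, f x ∂P := by
  rw [← ENNReal.ofReal_le_ofReal_iff (integral_nonneg hf0),
    ofReal_integral_eq_lintegral_ofReal hf' (ae_of_all _ hf0'),
    ofReal_integral_eq_lintegral_ofReal hf (ae_of_all _ hf0),
    lintegral_eq_lintegral_meas_lt _ (ae_of_all _ hf0') hmf'.aemeasurable,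
    lintegral_eq_lintegral_meas_lt _ (ae_of_all _ hf0) hmf.aemeasurable]
  exact lintegral_mono fun t =>
    (ENNReal.toReal_le_toReal (measure_ne_top _ _) (measure_ne_top _ _)).1 (h t)

/-- A comparison of the probabilities of increasing events gives a comparison of the expectations
of increasing functions. -/
lemma integral_le_integral_of_upperSet {Ω Ω' X : Type*} [MeasurableSpace Ω] [MeasurableSpace Ω']
    {P : Measure Ω} {P' : Measure Ω'} [IsProbabilityMeasure P] [IsProbabilityMeasure P']
    {A : Ω → Set X} {Q : Ω' → Set X} (hA : Measurable A) (hQ : Measurable Q)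
    {M : Finset X}
    (h : ∀ 𝒰 : Set (Set X), IsUpperSet 𝒰 → DependsOnlyOn (· ∈ 𝒰) M →
      P'.real {x | Q x ∈ 𝒰} ≤ P.real {x | A x ∈ 𝒰})
    {g : Set X → ℝ} (hg0 : ∀ S, 0 ≤ g S) (hg1 : ∀ S, g S ≤ 1) (hmono : Monotone g)
    (hM : DependsOnlyOn g M) :
    ∫ x, g (Q x) ∂P' ≤ ∫ x, g (A x) ∂P := by
  have hmA : Measurable fun x => g (A x) := hM.measurable.comp hA
  have hmQ : Measurable fun x => g (Q x) := hM.measurable.comp hQ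
  refine integral_le_integral_of_measureReal_lt_le
    (Integrable.of_bound hmA.aestronglyMeasurable 1 (ae_of_all _ fun x => by
      rw [Real.norm_of_nonneg (hg0 _)]; exact hg1 _))
    (Integrable.of_bound hmQ.aestronglyMeasurable 1 (ae_of_all _ fun x => by
      rw [Real.norm_of_nonneg (hg0 _)]; exact hg1 _)) hmA hmQ (fun _ => hg0 _) (fun _ => hg0 _)
    fun t => h {S | t < g S} (fun S S' hSS' hS => lt_of_lt_of_le hS (hmono hSS')) fun S => by
      simp only [Set.mem_ofPred_eq, hM S]

/-- The expectation of a function of a random set which depends on finitely many points. -/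
lemma integral_eq_sum_of_dependsOnlyOn {Ω X : Type*} [MeasurableSpace Ω] {P : Measure Ω}
    [IsProbabilityMeasure P] {A : Ω → Set X} (hA : Measurable A) {M : Finset X} {g : Set X → ℝ}
    (hM : DependsOnlyOn g M) :
    ∫ x, g (A x) ∂P = ∑ s ∈ M.powerset, P.real {x | A x ∩ M = (s : Set X)} * g s := by
  have hmeas : ∀ s : Finset X, MeasurableSet {x | A x ∩ M = (s : Set X)} := fun s =>
    hA (measurableSet_inter_eq M (s : Set X))
  have h1 : ∀ x, g (A x) = ∑ s ∈ M.powerset,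
      {x | A x ∩ M = (s : Set X)}.indicator (fun _ => g s) x := by
    intro x
    obtain ⟨s, hs⟩ := (M.finite_toSet.inter_of_right (A x)).exists_finset_coe
    have hsM : s ∈ M.powerset := by
      rw [Finset.mem_powerset, ← Finset.coe_subset, hs]; exact Set.inter_subset_right
    rw [Finset.sum_eq_single_of_mem s hsM, Set.indicator_of_mem (by exact hs.symm), hs, hM]
    intro s' _ hne
    rw [Set.indicator_of_notMem]
    intro h
    rw [Set.mem_ofPred_eq, ← hs] at h
    exact hne (by exact_mod_cast h.symm)
  rw [integral_congr_ae (ae_of_all _ h1), integral_finsetSum]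
  · refine Finset.sum_congr rfl fun s _ => ?_
    rw [integral_indicator_const _ (hmeas s), smul_eq_mul]
  · exact fun s _ => (integrable_const _).indicator (hmeas s)

/-- Fubini in finite form: only `Q x ∩ M` matters, so conditioning on `Q` is a finite sum over its
values. -/
lemma measureReal_hullEvent_eq_integral {Ω : Type*} [MeasurableSpace Ω] {P : Measure Ω}
    [IsProbabilityMeasure P] {Q : Ω → Set V(G)} {F : Ω → Set β} (hQ : Measurable Q)
    (hF : Measurable F) (hind : IndepFun Q F P) {r : Finset β} {𝒰 : Set (Set V(G))}
    {M : Finset V(G)} (hM : DependsOnlyOn (hullEvent G r 𝒰) M) :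
    P.real {x | F x ∈ hullEvent G r 𝒰 (Q x)} =
      ∫ x, (P.map F).real (hullEvent G r 𝒰 (Q x)) ∂P := by
  have hmE : ∀ S, MeasurableSet (hullEvent G r 𝒰 S) := fun S =>
    (dependsOnlyOn_hullEvent r 𝒰 S).measurableSet
  rw [integral_eq_sum_of_dependsOnlyOn hQ (g := fun S => (P.map F).real (hullEvent G r 𝒰 S))
    (M := M) fun S => by simp only [hM S]]
  have h1 : {x | F x ∈ hullEvent G r 𝒰 (Q x)} = ⋃ s ∈ M.powerset,
      (Q ⁻¹' {S | S ∩ M = (s : Set V(G))} ∩ F ⁻¹' hullEvent G r 𝒰 s) := by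
    ext x
    simp only [Set.mem_ofPred_eq, Set.mem_iUnion, Set.mem_inter_iff, Set.mem_preimage, exists_prop]
    constructor
    · intro h
      obtain ⟨s, hs⟩ := (M.finite_toSet.inter_of_right (Q x)).exists_finset_coe
      refine ⟨s, ?_, hs.symm, ?_⟩
      · rw [Finset.mem_powerset, ← Finset.coe_subset, hs]; exact Set.inter_subset_right
      · rw [hs, hM]; exact h
    · rintro ⟨s, -, hs, h⟩
      rw [← hM, hs]; exact h
  rw [h1, measureReal_biUnion_finset]
  · refine Finset.sum_congr rfl fun s _ => ?_
    rw [map_measureReal_apply hF (hmE _)]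
    simp only [measureReal_def]
    rw [hind.measure_inter_preimage_eq_mul _ _ (measurableSet_inter_eq M _) (hmE _),
      ENNReal.toReal_mul]
    rfl
  · intro s _ s' _ hne
    refine Set.disjoint_left.2 fun x h h' => hne ?_
    have e1 : Q x ∩ M = (s : Set V(G)) := h.1
    have e2 : Q x ∩ M = (s' : Set V(G)) := h'.1
    exact_mod_cast e1.symm.trans e2
  · exact fun s _ => (hQ (measurableSet_inter_eq M _)).inter (hF (hmE _))

lemma measureReal_iUnion_le {Ω : Type*} [MeasurableSpace Ω] {P : Measure Ω} [IsFiniteMeasure P]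
    {s : ℕ → Set Ω} (hs : Monotone s) {c : ℝ} (h : ∀ n, P.real (s n) ≤ c) :
    P.real (⋃ n, s n) ≤ c := by
  have := tendsto_measure_iUnion_atTop (μ := P) hs
  exact le_of_tendsto ((ENNReal.tendsto_toReal (measure_ne_top _ _)).comp this)
    (Eventually.of_forall h)

/-- Stochastic domination, for the probabilities of increasing events which depend on finitely
many vertices. -/
theorem measureReal_successiveHull_le (hconn : Connected G) (hlf : LocallyFinite G)
    (hμ : IsWiredUSF G μ) (v₀ : V(G)) {Ω : Type*} [MeasurableSpace Ω] {P : Measure Ω}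
    [IsProbabilityMeasure P] (m : ℕ) (F : Fin (m + 1) → Ω → Set β) (hF : ∀ i, Measurable (F i))
    (hlaw : ∀ i, IsWiredUSF G (P.map (F i))) (hind : iIndepFun F P)
    {𝒰 : Set (Set V(G))} (h𝒰 : IsUpperSet 𝒰) {M : Finset V(G)}
    (hM : DependsOnlyOn (· ∈ 𝒰) M) :
    P.real {x | successiveHull G v₀ m (fun i => F i x) ∈ 𝒰} ≤
      μ.real {ω | explored G E(G) ω v₀ m ∈ 𝒰} := by
  have := hμ.1
  have hne : V(G).Nonempty := ⟨v₀, v₀.2⟩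
  obtain ⟨l, hl, hE⟩ := exists_edge_exhaustion hconn hlf v₀
  have hl' : Monotone fun n => (l n : Set β) := fun a b hab => Finset.coe_subset.2 (hl hab)
  have hlE : ∀ n, (l n : Set β) ⊆ E(G) := fun n => by
    rw [← hE]; exact Set.subset_iUnion (fun n => (l n : Set β)) n
  -- hulls as increasing unions over finite sets of edges
  have hunion : ∀ (ω : Set β) (S : Set V(G)), hull G ω S = ⋃ n, hull G (ω ∩ l n) S := by
    intro ω S
    have hm : Monotone fun n => ω ∩ (l n : Set β) := fun a b hab =>
      Set.inter_subset_inter_right _ (hl' hab)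
    have h := hull_iUnion hm (monotone_const (c := S))
    rw [Set.iUnion_const, ← Set.inter_iUnion, hE, hull_inter_edgeSet] at h
    exact h
  have hmono : ∀ (ω : Set β) (S : Set V(G)), Monotone fun n => hull G (ω ∩ l n) S :=
    fun ω S a b hab => hull_mono (Set.inter_subset_inter_right _ (hl' hab)) subset_rfl
  have hhull : ∀ {𝒰 : Set (Set V(G))}, IsUpperSet 𝒰 → ∀ {M : Finset V(G)},
      DependsOnlyOn (· ∈ 𝒰) M → ∀ (ω : Set β) (S : Set V(G)),
        hull G ω S ∈ 𝒰 ↔ ∃ n, ω ∈ hullEvent G (l n) 𝒰 S := by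
    intro 𝒰 h𝒰 M hM ω S
    rw [hunion, mem_iUnion_iff_of_isUpperSet h𝒰 hM (hmono ω S)]
    rfl
  have hmonoE : ∀ {𝒰 : Set (Set V(G))}, IsUpperSet 𝒰 → ∀ S,
      Monotone fun n => hullEvent G (l n : Set β) 𝒰 S := fun h𝒰 S a b hab ω hω =>
    h𝒰 (hmono ω S hab) hω
  -- The event varies because the induction hypothesis is applied to superlevel sets of a hull
  -- probability, not to `𝒰` itself.
  induction m generalizing 𝒰 M with
  | zero =>
    have h1 : {x | successiveHull G v₀ 0 (fun i => F i x) ∈ 𝒰} =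
        ⋃ n, F 0 ⁻¹' hullEvent G (l n) 𝒰 {v₀} := by
      ext x
      have : successiveHull G v₀ 0 (fun i => F i x) = hull G (F 0 x) {v₀} := component_eq_hull
      simp only [Set.mem_ofPred_eq, this, hhull h𝒰 hM, Set.mem_iUnion, Set.mem_preimage]
    rw [h1]
    refine measureReal_iUnion_le (fun a b hab => Set.preimage_mono (hmonoE h𝒰 _ hab)) fun n => ?_
    have hd := dependsOnlyOn_hullEvent (l n) 𝒰 {v₀}
    rw [← map_measureReal_apply (hF 0) hd.measurableSet,
      (hlaw 0).measureReal_eq hne hlf hμ hd]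
    refine measureReal_mono fun ω hω => ?_
    exact h𝒰 (hull_mono (Set.inter_subset_inter_right _ (hlE n)) subset_rfl) hω
  | succ m ih =>
    let Q : Ω → Set V(G) := fun x => successiveHull G v₀ m (fun i => F i.castSucc x)
    have hQ : Measurable Q := (measurable_successiveHull hconn hlf v₀ m).comp
      (measurable_pi_lambda _ fun i => hF i.castSucc)
    have hQF : IndepFun Q (F (Fin.last (m + 1))) P := by
      have h := hind.indepFun_finset (Finset.univ.erase (Fin.last (m + 1))) {Fin.last (m + 1)}
        (by simp) hF
      let φ : ((i : (Finset.univ.erase (Fin.last (m + 1)) : Finset (Fin (m + 2)))) → Set β) →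
          Set V(G) := fun v => successiveHull G v₀ m fun i =>
            v ⟨i.castSucc, by simp [Fin.castSucc_ne_last]⟩
      let ψ : ((i : ({Fin.last (m + 1)} : Finset (Fin (m + 2)))) → Set β) → Set β := fun v =>
        v ⟨Fin.last (m + 1), by simp⟩
      have hφ : Measurable φ := (measurable_successiveHull hconn hlf v₀ m).comp
        (measurable_pi_lambda _ fun i => measurable_pi_apply _)
      exact h.comp hφ (measurable_pi_apply _ : Measurable ψ)
    have h1 : {x | successiveHull G v₀ (m + 1) (fun i => F i x) ∈ 𝒰} =
        ⋃ n, {x | F (Fin.last (m + 1)) x ∈ hullEvent G (l n) 𝒰 (Q x)} := by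
      ext x
      simp only [Set.mem_ofPred_eq, successiveHull_succ, hhull h𝒰 hM, Set.mem_iUnion]
      rfl
    rw [h1]
    refine measureReal_iUnion_le
      (s := fun n => {x | F (Fin.last (m + 1)) x ∈ hullEvent G (l n) 𝒰 (Q x)})
      (fun a b hab x hx => hmonoE h𝒰 (Q x) hab hx) fun n => ?_
    obtain ⟨M', hM'⟩ := exists_dependsOnlyOn_hullEvent hM (l n)
    rw [measureReal_hullEvent_eq_integral hQ (hF _) hQF hM']
    have heq : ∀ S, (P.map (F (Fin.last (m + 1)))).real (hullEvent G (l n) 𝒰 S) =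
        μ.real (hullEvent G (l n) 𝒰 S) := fun S =>
      (hlaw _).measureReal_eq hne hlf hμ (dependsOnlyOn_hullEvent (l n) 𝒰 S)
    simp only [heq]
    refine le_trans ?_ (integral_hullEvent_le hconn hlf hμ v₀ m h𝒰 hM (hlE n))
    -- The integrand increases with the vertex set and depends on `M'` only, so its superlevel
    -- events fall under the induction hypothesis, which replaces `Q` by the explored set.
    refine integral_le_integral_of_upperSet (g := fun S => μ.real (hullEvent G (l n) 𝒰 S))
      (M := M') (measurable_explored hconn hlf v₀ m) hQ ?_ (fun _ => measureReal_nonneg)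
      (fun _ => measureReal_le_one)
      (fun S S' h => measureReal_mono (hullEvent_mono _ h𝒰 h)) fun S => by simp only [hM' S]
    intro 𝒱 h𝒱 hM𝒱
    exact ih (fun i => F i.castSucc) (fun i => hF _) (fun i => hlaw _)
      (hind.precomp (Fin.castSucc_injective _)) h𝒱 hM𝒱

end Domination

/-! ### Strassen's theorem and the monotone coupling -/

section Strassen

/-- **Strassen's theorem** on a finite preorder, for weights. -/
lemma exists_weight_of_sum_mul_le {ι : Type*} [Fintype ι] [DecidableEq ι] [Preorder ι]
    [DecidableLE ι] {a b : ι → ℝ}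
    (ha0 : ∀ i, 0 ≤ a i) (hb0 : ∀ i, 0 ≤ b i) (ha1 : ∑ i, a i = 1)
    (h : ∀ g : ι → ℝ, Monotone g → ∑ i, b i * g i ≤ ∑ i, a i * g i) :
    ∃ w : {p : ι × ι // p.2 ≤ p.1} → ℝ, (∀ p, 0 ≤ w p) ∧ ∑ p, w p = 1 ∧
      (∀ i, ∑ p, (if p.1.1 = i then w p else 0) = a i) ∧
      (∀ i, ∑ p, (if p.1.2 = i then w p else 0) = b i) := by
  classical
  let R := {p : ι × ι // p.2 ≤ p.1}
  let L : (R → ℝ) →ₗ[ℝ] (ι → ℝ) × (ι → ℝ) :=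
    { toFun := fun w => (fun i => ∑ p, (if p.1.1 = i then w p else 0),
        fun i => ∑ p, (if p.1.2 = i then w p else 0))
      map_add' := fun w w' => by
        ext i <;> simp [← Finset.sum_add_distrib, ite_add_ite]
      map_smul' := fun t w => by
        ext i <;> simp [Finset.mul_sum] }
  have hLsingle : ∀ p : R, L (Pi.single p 1) = (Pi.single p.1.1 1, Pi.single p.1.2 1) := by
    intro p
    ext i
    · change ∑ q : R, (if q.1.1 = i then (Pi.single p 1 : R → ℝ) q else 0) = _
      rw [Finset.sum_eq_single p (fun q _ hq => by simp [hq]) (by simp)]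
      simp [Pi.single_apply, eq_comm]
    · change ∑ q : R, (if q.1.2 = i then (Pi.single p 1 : R → ℝ) q else 0) = _
      rw [Finset.sum_eq_single p (fun q _ hq => by simp [hq]) (by simp)]
      simp [Pi.single_apply, eq_comm]
  by_cases hab : (a, b) ∈ L '' stdSimplex ℝ R
  · obtain ⟨w, hw, hLw⟩ := hab
    exact ⟨w, hw.1, hw.2, fun i => congrFun (congrArg Prod.fst hLw) i,
      fun i => congrFun (congrArg Prod.snd hLw) i⟩
  · exfalso
    -- The marginal pairs of probability weights on `R` form a compact convex set. If `(a, b)` is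
    -- not in it, Hahn–Banach gives a separating functional, that is, a pair `φ`, `ψ` with `φ i + ψ
    -- j < u` whenever `j ≤ i`.
    have hclosed : IsClosed (L '' stdSimplex ℝ R) :=
      ((isCompact_stdSimplex ℝ R).image L.continuous_of_finiteDimensional).isClosed
    obtain ⟨f, u, hfu, huf⟩ := geometric_hahn_banach_closed_point
      ((convex_stdSimplex ℝ R).linear_image L) hclosed hab
    set φ : ι → ℝ := fun i => f (Pi.single i 1, 0) with hφ
    set ψ : ι → ℝ := fun i => f (0, Pi.single i 1) with hψ
    have hf : ∀ x y : ι → ℝ, f (x, y) = ∑ i, x i * φ i + ∑ i, y i * ψ i := by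
      intro x y
      have hxy : (x, y) = ∑ i, x i • ((Pi.single i 1, 0) : (ι → ℝ) × (ι → ℝ)) +
          ∑ i, y i • ((0, Pi.single i 1) : (ι → ℝ) × (ι → ℝ)) := by
        ext i <;> simp [Prod.fst_sum, Prod.snd_sum, Finset.sum_apply, Pi.single_apply]
      rw [hxy]
      simp only [map_add, map_sum, map_smul, smul_eq_mul, hφ, hψ]
    have hlt : ∀ i j : ι, j ≤ i → φ i + ψ j < u := by
      intro i j hij
      have := hfu _ ⟨_, single_mem_stdSimplex ℝ (⟨(i, j), hij⟩ : R), hLsingle _⟩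
      rw [hf] at this
      simpa [Pi.single_apply] using this
    have hne : ∀ i : ι, (Finset.univ.filter (· ≤ i)).Nonempty := fun i => ⟨i, by simp⟩
    -- The maximum of `ψ` below `i` is monotone and satisfies `ψ ≤ g ≤ u - φ`. Replacing `ψ` by `g`
    -- and `φ` by `u - g` turns the separation at `(a, b)` into `∑ a g < ∑ b g`, against `h`.
    set g : ι → ℝ := fun i => (Finset.univ.filter (· ≤ i)).sup' (hne i) ψ with hg
    have hmono : Monotone g := fun i j hij =>
      Finset.sup'_mono _ (fun k hk => by
        simp only [Finset.mem_filter, Finset.mem_univ, true_and] at hk ⊢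
        exact hk.trans hij) _
    have hψg : ∀ i, ψ i ≤ g i := fun i => Finset.le_sup' ψ (by simp)
    have hφg : ∀ i, φ i ≤ u - g i := by
      intro i
      obtain ⟨j, hj, hgj⟩ := Finset.exists_mem_eq_sup' (hne i) ψ
      simp only [Finset.mem_filter, Finset.mem_univ, true_and] at hj
      have := hlt i j hj
      have h2 : g i = ψ j := hgj
      linarith
    rw [hf] at huf
    have h1 : ∑ i, a i * φ i ≤ ∑ i, a i * (u - g i) :=
      Finset.sum_le_sum fun i _ => mul_le_mul_of_nonneg_left (hφg i) (ha0 i)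
    have h2 : ∑ i, b i * ψ i ≤ ∑ i, b i * g i :=
      Finset.sum_le_sum fun i _ => mul_le_mul_of_nonneg_left (hψg i) (hb0 i)
    have h3 : ∑ i, a i * (u - g i) = u - ∑ i, a i * g i := by
      simp only [mul_sub, Finset.sum_sub_distrib, ← Finset.sum_mul, ha1, one_mul]
    linarith [h g hmono]

/-- **Strassen's theorem** on a finite preorder. -/
lemma exists_coupling_of_finite {ι : Type*} [Finite ι] [Preorder ι] [MeasurableSpace ι]
    [MeasurableSingletonClass ι] {a b : Measure ι} [IsProbabilityMeasure a]
    [IsProbabilityMeasure b] (h : ∀ 𝒰 : Set ι, IsUpperSet 𝒰 → b.real 𝒰 ≤ a.real 𝒰) :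
    ∃ ν : Measure (ι × ι), IsProbabilityMeasure ν ∧ ν.map Prod.fst = a ∧ ν.map Prod.snd = b ∧
      ∀ᵐ p ∂ν, p.2 ≤ p.1 := by
  classical
  have := Fintype.ofFinite ι
  have hint : ∀ (c : Measure ι) [IsProbabilityMeasure c] (g : ι → ℝ), Integrable g c :=
    fun c _ g => Integrable.of_finite
  have hsum : ∀ (c : Measure ι) [IsProbabilityMeasure c] (g : ι → ℝ),
      ∫ x, g x ∂c = ∑ i, c.real {i} * g i := fun c _ g => by
    rw [integral_fintype (hint c g)]
    simp
  obtain ⟨w, hw0, hw1, hwa, hwb⟩ := exists_weight_of_sum_mul_le (a := fun i => a.real {i})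
    (b := fun i => b.real {i}) (fun _ => measureReal_nonneg) (fun _ => measureReal_nonneg)
    (by simp) (by
      intro g hg
      rw [← hsum, ← hsum]
      -- Subtracting a lower bound makes `g` nonnegative, as the comparison of tails requires; it
      -- cancels since both laws have mass one.
      obtain ⟨t, ht⟩ := (Set.finite_range g).bddBelow
      have h0 : ∀ i, 0 ≤ g i - t := fun i => sub_nonneg.2 (ht ⟨i, rfl⟩)
      have := integral_le_integral_of_measureReal_lt_le (hint a fun i => g i - t)
        (hint b fun i => g i - t) .of_discrete .of_discrete h0 h0 fun s =>
          h {x | s < g x - t} fun i j hij hi =>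
            lt_of_lt_of_le hi (sub_le_sub_right (hg hij) _)
      rw [integral_sub (hint b g) (integrable_const _),
        integral_sub (hint a g) (integrable_const _)] at this
      simp only [integral_const, probReal_univ, smul_eq_mul, one_mul] at this
      linarith)
  let ν : Measure (ι × ι) := ∑ p, ENNReal.ofReal (w p) • Measure.dirac p.1
  have hν : ∀ S : Set (ι × ι), ν S = ENNReal.ofReal (∑ p, if p.1 ∈ S then w p else 0) := by
    intro S
    rw [ENNReal.ofReal_sum_of_nonneg fun p _ => by split_ifs <;> simp [hw0]]
    simp only [ν, Measure.coe_finsetSum, Finset.sum_apply, Measure.smul_apply, smul_eq_mul]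
    refine Finset.sum_congr rfl fun p _ => ?_
    rw [Measure.dirac_apply' _ (Set.toFinite S).measurableSet]
    by_cases hp : p.1 ∈ S <;> simp [hp]
  refine ⟨ν, ⟨by rw [hν]; simp [hw1]⟩, ?_, ?_, ?_⟩
  · refine Measure.ext_of_singleton fun i => ?_
    rw [Measure.map_apply measurable_fst (measurableSet_singleton i), hν]
    simp only [Set.mem_preimage, Set.mem_singleton_iff, hwa]
    exact ofReal_measureReal
  · refine Measure.ext_of_singleton fun i => ?_
    rw [Measure.map_apply measurable_snd (measurableSet_singleton i), hν]
    simp only [Set.mem_preimage, Set.mem_singleton_iff, hwb]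
    exact ofReal_measureReal
  · rw [ae_iff, hν, ENNReal.ofReal_eq_zero]
    refine (Finset.sum_eq_zero fun p _ => ?_).le
    rw [if_neg]
    simpa using p.2

variable {X : Type*}

lemma measurable_inter_finset (K : Finset X) : Measurable fun ω : Set X => ω ∩ K :=
  DependsOnlyOn.measurable (K := K) fun ω => by simp [Set.inter_assoc]

lemma measurableSet_mem (x : X) : MeasurableSet {ω : Set X | x ∈ ω} :=
  DependsOnlyOn.measurableSet (K := {x}) fun ω => by simp

/-- Finite-dimensional approximation of a monotone coupling. -/
lemma exists_coupling_inter {a b : Measure (Set X)} [IsProbabilityMeasure a]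
    [IsProbabilityMeasure b] (K : Finset X)
    (h : ∀ 𝒰 : Set (Set X), IsUpperSet 𝒰 → DependsOnlyOn (· ∈ 𝒰) K → b.real 𝒰 ≤ a.real 𝒰) :
    ∃ ν : Measure (Set X × Set X), IsProbabilityMeasure ν ∧
      ν.map Prod.fst = a.map (· ∩ (K : Set X)) ∧ ν.map Prod.snd = b.map (· ∩ (K : Set X)) ∧
      ∀ x, ∀ᵐ p ∂ν, x ∈ p.2 → x ∈ p.1 := by
  let π : Set X → Set K := fun ω => Subtype.val ⁻¹' ω
  let j : Set K → Set X := fun ω => Subtype.val '' ω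
  have hjπ : ∀ ω, j (π ω) = ω ∩ K := fun ω => by
    ext x
    simp [j, π, and_comm]
  have hdep : ∀ 𝒰 : Set (Set K), DependsOnlyOn (· ∈ π ⁻¹' 𝒰) K := fun 𝒰 ω => by
    have : π (ω ∩ K) = π ω := by ext; simp [π]
    simp [this]
  have hπ : Measurable π := fun 𝒰 _ => (hdep 𝒰).measurableSet
  have : MeasurableSingletonClass (Set K) :=
    inferInstanceAs (MeasurableSingletonClass (K → Prop))
  have hj : Measurable j := .of_discrete
  have := Measure.isProbabilityMeasure_map (μ := a) hπ.aemeasurable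
  have := Measure.isProbabilityMeasure_map (μ := b) hπ.aemeasurable
  obtain ⟨ν, hν, hνa, hνb, hνle⟩ := exists_coupling_of_finite (a := a.map π) (b := b.map π)
    fun 𝒰 h𝒰 => by
      rw [map_measureReal_apply hπ 𝒰.toFinite.measurableSet,
        map_measureReal_apply hπ 𝒰.toFinite.measurableSet]
      exact h _ (fun ω ω' hωω' hω => h𝒰 (Set.preimage_mono hωω') hω) (hdep 𝒰)
  have hjj : Measurable (Prod.map j j) := hj.prodMap hj
  refine ⟨ν.map (Prod.map j j), Measure.isProbabilityMeasure_map hjj.aemeasurable, ?_, ?_, ?_⟩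
  · rw [Measure.map_map measurable_fst hjj,
      show Prod.fst ∘ Prod.map j j = j ∘ Prod.fst from rfl, ← Measure.map_map hj measurable_fst,
      hνa, Measure.map_map hj hπ]
    congr 1
    exact funext hjπ
  · rw [Measure.map_map measurable_snd hjj,
      show Prod.snd ∘ Prod.map j j = j ∘ Prod.snd from rfl, ← Measure.map_map hj measurable_snd,
      hνb, Measure.map_map hj hπ]
    congr 1
    exact funext hjπ
  · intro x
    have hx : MeasurableSet {p : Set X × Set X | x ∈ p.2 → x ∈ p.1} := by
      refine .imp ?_ ?_
      · exact measurable_snd (measurableSet_mem x)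
      · exact measurable_fst (measurableSet_mem x)
    rw [ae_map_iff hjj.aemeasurable hx]
    filter_upwards [hνle] with p hp
    exact fun h => Set.image_mono hp h

/-- Two laws of random sets with the same inclusion probabilities coincide. -/
lemma ext_of_measure_subset {a b : Measure (Set X)} [IsProbabilityMeasure a]
    [IsProbabilityMeasure b]
    (h : ∀ L : Finset X, a {ω | (L : Set X) ⊆ ω} = b {ω | (L : Set X) ⊆ ω}) : a = b := by
  classical
  -- The inclusion events are stable under intersection, by taking unions of the sets `L`, and
  -- generate the product σ-algebra.
  refine ext_of_generate_finite (Set.range fun L : Finset X => {ω : Set X | (L : Set X) ⊆ ω})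
    (le_antisymm ?_ ?_) ?_ ?_ (by simp)
  · refine iSup_le fun x => ?_
    change MeasurableSpace.comap (fun ω : Set X => x ∈ ω) _ ≤ _
    refine @Measurable.comap_le _ _ _ _ _ (@measurable_to_prop _ (_) _ ?_)
    refine MeasurableSpace.measurableSet_generateFrom ⟨{x}, ?_⟩
    ext ω
    simp
  · refine MeasurableSpace.generateFrom_le ?_
    rintro _ ⟨L, rfl⟩
    refine DependsOnlyOn.measurableSet (K := L) fun ω => ?_
    simp
  · rintro _ ⟨L, rfl⟩ _ ⟨L', rfl⟩ _
    exact ⟨L ∪ L', by ext ω; simp⟩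
  · rintro _ ⟨L, rfl⟩
    exact h L

/-- **Strassen's theorem** for random subsets of a countable set. -/
lemma exists_monotone_coupling [Countable X] {a b : Measure (Set X)} [IsProbabilityMeasure a]
    [IsProbabilityMeasure b]
    (h : ∀ (K : Finset X) (𝒰 : Set (Set X)), IsUpperSet 𝒰 → DependsOnlyOn (· ∈ 𝒰) K →
      b.real 𝒰 ≤ a.real 𝒰) :
    ∃ ν : Measure (Set X × Set X), IsProbabilityMeasure ν ∧ ν.map Prod.fst = a ∧
      ν.map Prod.snd = b ∧ ∀ᵐ p ∂ν, p.2 ⊆ p.1 := by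
  classical
  choose ν hν hνa hνb hνle using fun K => exists_coupling_inter K (h K)
  -- The finite-dimensional couplings are transported to a compact product space, where an
  -- ultrafilter finer than `atTop` provides a limit law.
  let E := (X → Bool) × (X → Bool)
  let τ : Set X × Set X → E := fun p => (fun x => decide (x ∈ p.1), fun x => decide (x ∈ p.2))
  let ρ : E → Set X × Set X := fun e => ({x | e.1 x = true}, {x | e.2 x = true})
  have hρτ : ∀ p, ρ (τ p) = p := fun p => by simp [ρ, τ]
  have hτ : Measurable τ := by
    refine Measurable.prodMk (measurable_pi_lambda _ fun x => ?_)
      (measurable_pi_lambda _ fun x => ?_)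
    · refine measurable_to_bool ?_
      convert measurable_fst (measurableSet_mem x) using 1
      ext; simp
    · refine measurable_to_bool ?_
      convert measurable_snd (measurableSet_mem x) using 1
      ext; simp
  have hset : ∀ {f : E → X → Bool}, Measurable f → Measurable fun e => {x | f e x = true} := by
    intro f hf
    refine measurable_pi_lambda _ fun x => ?_
    exact measurableSet_setOfPred.1 (measurable_pi_iff.1 hf x (measurableSet_singleton true))
  have hρ : Measurable ρ := (hset measurable_fst).prodMk (hset measurable_snd)
  let κ : Finset X → ProbabilityMeasure E := fun K =>
    ⟨(ν K).map τ, Measure.isProbabilityMeasure_map hτ.aemeasurable⟩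
  let 𝓕 : Ultrafilter (Finset X) := Ultrafilter.of atTop
  obtain ⟨κ', -, hκ'⟩ := isCompact_univ.ultrafilter_le_nhds (𝓕.map κ) (by simp)
  have hlim : Tendsto κ 𝓕 (𝓝 κ') := hκ'
  -- Probabilities of clopen events pass to the limit, so a value attained for all large `K` is
  -- inherited.
  have hκ : ∀ {S : Set (Set X × Set X)}, MeasurableSet S → IsClopen (ρ ⁻¹' S) → ∀ {c : ENNReal},
      (∀ᶠ K in atTop, ν K S = c) → (κ' : Measure E).map ρ S = c := by
    intro S hS hclopen c hc
    rw [Measure.map_apply hρ hS]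
    have h1 := ProbabilityMeasure.tendsto_measure_of_isClopen_of_tendsto hlim hclopen
    have h2 := (ENNReal.continuous_coe.tendsto _).comp h1
    rw [ProbabilityMeasure.ennreal_coeFn_eq_coeFn_toMeasure] at h2
    refine tendsto_nhds_unique h2 (tendsto_const_nhds.congr' ?_)
    filter_upwards [Ultrafilter.of_le atTop hc] with K hK
    simp only [Function.comp_apply, ProbabilityMeasure.ennreal_coeFn_eq_coeFn_toMeasure]
    change c = (ν K).map τ (ρ ⁻¹' S)
    rw [Measure.map_apply hτ (hρ hS), ← Set.preimage_comp,
      show ρ ∘ τ = id from funext hρτ, Set.preimage_id, hK]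
  have hsub : ∀ L : Finset X, MeasurableSet {ω : Set X | (L : Set X) ⊆ ω} := fun L =>
    DependsOnlyOn.measurableSet (K := L) fun ω => by simp
  have hev : ∀ (c : Measure (Set X)) (L K : Finset X), L ≤ K →
      c.map (· ∩ (K : Set X)) {ω | (L : Set X) ⊆ ω} = c {ω | (L : Set X) ⊆ ω} := by
    intro c L K hLK
    rw [Measure.map_apply (measurable_inter_finset K) (hsub L)]
    congr 1
    ext ω
    simp [Finset.coe_subset.2 hLK]
  have hclopen : ∀ {f : E → X → Bool}, Continuous f → ∀ L : Finset X,
      IsClopen {e | (L : Set X) ⊆ {x | f e x = true}} := by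
    intro f hf L
    have : {e | (L : Set X) ⊆ {x | f e x = true}} = ⋂ x ∈ L, (fun e => f e x) ⁻¹' {true} := by
      ext e
      simp [Set.subset_def]
    rw [this]
    exact isClopen_biInter_finset fun x _ =>
      (isClopen_discrete _).preimage ((continuous_apply x).comp hf)
  have hprob : IsProbabilityMeasure ((κ' : Measure E).map ρ) :=
    Measure.isProbabilityMeasure_map hρ.aemeasurable
  have := Measure.isProbabilityMeasure_map (μ := (κ' : Measure E).map ρ) measurable_fst.aemeasurable
  have := Measure.isProbabilityMeasure_map (μ := (κ' : Measure E).map ρ) measurable_snd.aemeasurable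
  refine ⟨(κ' : Measure E).map ρ, hprob, ext_of_measure_subset fun L => ?_,
    ext_of_measure_subset fun L => ?_, ?_⟩
  · rw [Measure.map_apply measurable_fst (hsub L)]
    refine hκ (measurable_fst (hsub L)) (hclopen continuous_fst L) ?_
    filter_upwards [eventually_ge_atTop L] with K hK
    rw [← Measure.map_apply measurable_fst (hsub L), hνa, hev a L K hK]
  · rw [Measure.map_apply measurable_snd (hsub L)]
    refine hκ (measurable_snd (hsub L)) (hclopen continuous_snd L) ?_
    filter_upwards [eventually_ge_atTop L] with K hK
    rw [← Measure.map_apply measurable_snd (hsub L), hνb, hev b L K hK]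
  · simp only [Set.subset_def]
    -- Inclusion is a countable conjunction of pointwise conditions, each a clopen event of full
    -- probability before the limit.
    refine ae_all_iff.2 fun x => ?_
    have hx : MeasurableSet {p : Set X × Set X | x ∈ p.2 → x ∈ p.1} :=
      .imp (measurable_snd (measurableSet_mem x)) (measurable_fst (measurableSet_mem x))
    refine (prob_compl_eq_zero_iff hx).2 (hκ hx ?_ (.of_forall fun K =>
      (prob_compl_eq_zero_iff hx).1 (hνle K x)))
    have : ρ ⁻¹' {p | x ∈ p.2 → x ∈ p.1} = (fun e : E => (e.2 x, e.1 x)) ⁻¹'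
        {q | q.1 = true → q.2 = true} := rfl
    rw [this]
    exact (isClopen_discrete _).preimage (((continuous_apply x).comp continuous_snd).prodMk
      ((continuous_apply x).comp continuous_fst))

end Strassen
end WiredUSF

theorem theorem4p1 {α β : Type*} (G : Graph α β)
    (hconn : WiredUSF.Connected G) (hlf : WiredUSF.LocallyFinite G) (v₀ : V(G)) (m : ℕ)
    {Ω : Type*} [MeasurableSpace Ω] (P : Measure Ω) [IsProbabilityMeasure P]
    (F : Ω → Set β) (F' : Fin (m + 1) → Ω → Set β)
    (hF : Measurable F) (hF' : ∀ i, Measurable (F' i))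
    (hFlaw : WiredUSF.IsWiredUSF G (P.map F))
    (hF'law : ∀ i, WiredUSF.IsWiredUSF G (P.map (F' i)))
    (hindep : iIndepFun (Fin.cons F F' : Fin (m + 2) → Ω → Set β) P) :
    WiredUSF.StochDominates P
      (fun x => WiredUSF.adjacentHull G (F x) v₀ m)
      (fun x => WiredUSF.successiveHull G v₀ m (fun i => F' i x)) := by
  have := WiredUSF.countable_vertexSet hconn hlf v₀
  have hA : Measurable fun x => WiredUSF.explored G E(G) (F x) v₀ m :=
    (WiredUSF.measurable_explored hconn hlf v₀ m).comp hF
  have hQ : Measurable fun x => WiredUSF.successiveHull G v₀ m (fun i => F' i x) :=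
    (WiredUSF.measurable_successiveHull hconn hlf v₀ m).comp (measurable_pi_lambda _ hF')
  simp only [WiredUSF.adjacentHull_eq_explored]
  have := Measure.isProbabilityMeasure_map (μ := P) hA.aemeasurable
  have := Measure.isProbabilityMeasure_map (μ := P) hQ.aemeasurable
  -- Strassen's theorem leaves only the increasing events depending on finitely many vertices.
  refine WiredUSF.exists_monotone_coupling fun K 𝒰 h𝒰 hK => ?_
  rw [map_measureReal_apply hQ hK.measurableSet, map_measureReal_apply hA hK.measurableSet]
  have hind : iIndepFun F' P := hindep.precomp (g := Fin.succ) (Fin.succ_injective _)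
  have h := WiredUSF.measureReal_successiveHull_le hconn hlf hFlaw v₀ m F' hF' hF'law
    hind h𝒰 hK
  exact h.trans_eq (map_measureReal_apply hF
    (WiredUSF.measurable_explored hconn hlf v₀ m hK.measurableSet))
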